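/- **Setting.** Let $M$ be a closed (compact, boundaryless, second countable, Hausdorff) connected $C^\infty$ manifold of dimension $n\ge 2$ with a $C^\infty$ volume form $\omega$, inducing the measure $\mu$. Fix a finite atlas $(V_j,\phi_j)_{j\le m}$ of $M$ that is *conservative* (every $\phi_j$ carries $\omega$ to $dx^1\wedge\dots\wedge dx^n$, and $\phi_j(V_j)=\lambda\mathbb B^n$ for one $\lambda>0$) and *regular* (there is a conservative atlas $(W_j,\Phi_j)_{j\le m}$ with $\overline{V_j}\subset W_j$ and $\Phi_j|_{V_j}=\phi_j$). For a vector field $X$ on an open set $U\subset M$ let $X_j:\phi_j(V_j\cap U)\to\mathbb R^n$ be its local expressions. For $s\in\mathbb Z^+\cup\{\infty\}$ and $0\le\beta\le1$, $\mathfrak X_\mu^{s,\beta}(U)$ is the set of $C^s$ vector fields on $U$ that are divergence-free with respect to $\omega$ and, when $s<\infty$ and $\beta>0$, whose $X_j$ have all partial derivatives of order $s$ $\beta$-Hölder continuous on $\phi_j(V_j\cap U)$. For an integer $r\ge 1$ and $0<\alpha\le 1$ put $$\|X\|_{C^r;U}=\max_{j;\,0\le k\le r}\ \sup_{\phi_j(V_j\cap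 U)}\|D^kX_j\|,\qquad \|X\|_{C^{r,\alpha};U}=\max\Bigl(\|X\|_{C^r;U},\ \max_j\,[D^rX_j]_{\alpha;\phi_j(V_j\cap U)}\Bigr),$$ where $[\cdot]_\alpha$ is the $\alpha$-Hölder seminorm, and $\|X\|_{C^{r,0};U}=\|X\|_{C^r;U}$ (values in $[0,\infty]$; the index $U$ is dropped if $U=M$). $X$ is *$C^r$-bounded* on $U$ if $\|X\|_{C^r;U}<\infty$. **Theorem 3** ($C^{s,\beta}$ conservative pasting with $C^{r,\alpha}$-closeness). Let $K\subset M$ be compact with an open neighbourhood $U\subsetneq M$ such that $U\setminus K$ is connected. Then there is an open set $V$ with $K\subset V\subset U$, depending only on $K$ and $U$, and for every integer $r\ge1$ there is a constant $C=C(r,K,U)>1$, such that the following holds for all $s\in\mathbb Z^+\cup\{\infty\}$ and $0\le\alpha,\beta\le1$ with $r\le s$ and $r+\alpha\le s+\beta$. Given $X\in\mathfrak X_\mu^{s,\beta}(M)$ and a $C^r$-bounded $Y\in\mathfrak X_\mu^{s,\beta}(U)$, there is $Z\in\mathfrak X_\mu^{s,\beta}(M)$ satisfying 1. $Z=Y$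 in $V$; 2. $Z=X$ in a neighbourhood of $U^c$; 3. $\|Z-X\|_{C^{r,\alpha}}\le C\,\|Y-X\|_{C^{r,\alpha};U}$; and moreover, except in the case $r=s$ and $0<\alpha=\beta\le1$, $Z$ can be chosen so that in addition it is $C^\infty$ at every point where it coincides neither with $X$ nor with $Y$. -/

import Mathlib

open Set Filter Topology
open scoped Manifold ContDiff NNReal ENNReal

noncomputable section

namespace ConservativePasting

variable {n : ℕ} {M : Type*} [TopologicalSpace M] [ChartedSpace (EuclideanSpace ℝ (Fin n)) M]

/-- The coefficient `ρ` of an `n`-form `vol = ρ dx¹ ∧ ⋯ ∧ dxⁿ` in the chart `e`, a function on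
the image of `e`. -/
def formCoeff (vol : ∀ x : M, TangentSpace (𝓡 n) x [⋀^Fin n]→L[ℝ] ℝ)
    (e : OpenPartialHomeomorph M (EuclideanSpace ℝ (Fin n))) (y : EuclideanSpace ℝ (Fin n)) : ℝ :=
  vol (e.symm y) fun i => mfderiv (𝓡 n) (𝓡 n) e.symm y (EuclideanSpace.single i (1 : ℝ))

/-- The expression `e_* X` of a vector field in the chart `e`, a function on the image of `e`
(its values off the image are irrelevant). -/
def localRep (e : OpenPartialHomeomorph M (EuclideanSpace ℝ (Fin n)))
    (X : ∀ x : M, TangentSpace (𝓡 n) x) (y : EuclideanSpace ℝ (Fin n)) :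
    EuclideanSpace ℝ (Fin n) :=
  mfderiv (𝓡 n) (𝓡 n) e (e.symm y) (X (e.symm y))

variable (n M) in
/-- A `C^∞` volume form: a smooth nowhere vanishing `n`-form on the `n`-manifold `M`. -/
structure VolumeForm where
  form : ∀ x : M, TangentSpace (𝓡 n) x [⋀^Fin n]→L[ℝ] ℝ
  smooth : ∀ e ∈ IsManifold.maximalAtlas (𝓡 n) ∞ M, ContDiffOn ℝ ∞ (formCoeff form e) e.target
  ne_zero : ∀ x, form x ≠ 0

/-- The divergence of `X` with respect to `vol`, in the chart `e`, at the point with coordinates `y`: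
`ρ⁻¹ ∑ᵢ ∂ᵢ (ρ Xⁱ)`, where `vol = ρ dx¹ ∧ ⋯ ∧ dxⁿ`. -/
def chartDiv (vol : VolumeForm n M) (e : OpenPartialHomeomorph M (EuclideanSpace ℝ (Fin n)))
    (X : ∀ x : M, TangentSpace (𝓡 n) x) (y : EuclideanSpace ℝ (Fin n)) : ℝ :=
  (formCoeff vol.form e y)⁻¹ *
    ∑ i, fderiv ℝ (fun z => formCoeff vol.form e z * localRep e X z i) y
      (EuclideanSpace.single i (1 : ℝ))

/-- `X` is divergence-free on `U` with respect to `vol`. -/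
def IsDivFreeOn (vol : VolumeForm n M) (X : ∀ x : M, TangentSpace (𝓡 n) x) (U : Set M) : Prop :=
  ∀ e ∈ IsManifold.maximalAtlas (𝓡 n) ∞ M, ∀ y ∈ e.target, e.symm y ∈ U → chartDiv vol e X y = 0

/-- A finite conservative atlas: finitely many smooth charts covering `M`, all with the same ball
`l 𝔹ⁿ` as image, in each of which `vol` is the canonical volume form `dx¹ ∧ ⋯ ∧ dxⁿ`. -/
structure IsConservativeAtlas (vol : VolumeForm n M) {m : ℕ}
    (φ : Fin m → OpenPartialHomeomorph M (EuclideanSpace ℝ (Fin n))) : Prop where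
  mem : ∀ j, φ j ∈ IsManifold.maximalAtlas (𝓡 n) ∞ M
  cover : ⋃ j, (φ j).source = univ
  image : ∃ l : ℝ, 0 < l ∧ ∀ j, (φ j).target = Metric.ball 0 l
  canonical : ∀ j, ∀ y ∈ (φ j).target, formCoeff vol.form (φ j) y = 1

/-- A finite conservative atlas `(Vⱼ, φⱼ)` that is regular: there is a larger conservative atlas
`(Wⱼ, Φⱼ)` with `closure Vⱼ ⊆ Wⱼ` and `Φⱼ = φⱼ` on `Vⱼ`. -/
structure RegularConservativeAtlas (vol : VolumeForm n M) where
  m : ℕ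
  chart : Fin m → OpenPartialHomeomorph M (EuclideanSpace ℝ (Fin n))
  conservative : IsConservativeAtlas vol chart
  regular : ∃ Φ : Fin m → OpenPartialHomeomorph M (EuclideanSpace ℝ (Fin n)),
    IsConservativeAtlas vol Φ ∧
      ∀ j, closure (chart j).source ⊆ (Φ j).source ∧ EqOn (Φ j) (chart j) (chart j).source

namespace RegularConservativeAtlas

variable {vol : VolumeForm n M} (A : RegularConservativeAtlas vol)

/-- The domain `φⱼ(Vⱼ ∩ U)` of the `j`-th local expression of a vector field on `U`. -/
def dom (U : Set M) (j : Fin A.m) : Set (EuclideanSpace ℝ (Fin n)) :=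
  A.chart j '' ((A.chart j).source ∩ U)

/-- The `k`-th derivative `Dᵏ Xⱼ` of the `j`-th local expression of `X`. -/
def derivRep (k : ℕ) (X : ∀ x : M, TangentSpace (𝓡 n) x) (j : Fin A.m) :
    EuclideanSpace ℝ (Fin n) → EuclideanSpace ℝ (Fin n) [×k]→L[ℝ] EuclideanSpace ℝ (Fin n) :=
  iteratedFDeriv ℝ k (localRep (A.chart j) X)

/-- The Whitney `C^r` norm on `U`, with values in `[0, ∞]`. -/
def normC (r : ℕ) (X : ∀ x : M, TangentSpace (𝓡 n) x) (U : Set M) : ℝ≥0∞ :=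
  ⨆ j, ⨆ k ≤ r, ⨆ y ∈ A.dom U j, ENNReal.ofReal ‖A.derivRep k X j y‖

/-- The Whitney-Hölder `C^{r,α}` norm on `U`, with values in `[0, ∞]`: the maximum of the `C^r` norm
and of the `α`-Hölder seminorms of the `r`-th derivatives of the local expressions; it is the `C^r`
norm if `α = 0`. -/
def normCH (r : ℕ) (α : ℝ≥0) (X : ∀ x : M, TangentSpace (𝓡 n) x) (U : Set M) : ℝ≥0∞ :=
  if α = 0 then A.normC r X U
  else max (A.normC r X U) (⨆ j, eHolderNorm α ((A.dom U j).domRestrict (A.derivRep r X j)))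

/-- `X ∈ 𝔛_μ^{s,β}(U)`: `X` is of class `C^s` on `U`, the derivatives of order `s` of its local
expressions are `β`-Hölder continuous (no condition if `β = 0` or `s = ∞`), and `X` is
divergence-free on `U`. Only the values of `X` on `U` matter. -/
structure MemDivFree [IsManifold (𝓡 n) ∞ M] (s : ℕ∞) (β : ℝ≥0)
    (X : ∀ x : M, TangentSpace (𝓡 n) x) (U : Set M) : Prop where
  contMDiffOn : ContMDiffOn (𝓡 n) (𝓡 n).tangent (s : WithTop ℕ∞)
    (fun x => (⟨x, X x⟩ : TangentBundle (𝓡 n) M)) U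
  holder : β ≠ 0 → ∀ k : ℕ, s = k → ∀ j, MemHolder β ((A.dom U j).domRestrict (A.derivRep k X j))
  divFree : IsDivFreeOn vol X U

end RegularConservativeAtlas

end ConservativePasting

end

/-! Put `W = Y - X`, a divergence-free field on `U`, and let `ξ` be a cut-off function, equal to 1
near `K` and compactly supported in `U`. The field `X + ξ W` pastes `Y` to `X`, but it has
divergence `dξ(W)`. This function lives in a compact shell inside `U \ K`, and its integral is zero
because it is the divergence of the compactly supported field `ξ W`. If `v` has compact support in
`U \ K` and `div v = dξ(W)`, then `X + ξ W - v` is divergence-free, equals `Y` near `K` and `X` near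
the complement of `U`. Since `dξ(W)` contains no derivative of `W`, it is enough to solve the
divergence equation without gaining a derivative: `v` only has to be bounded by `dξ(W)` in the same
`C^{r,α}` norm. No elliptic theory is involved, and the exponents 0 and 1 are not exceptional.

In a cube such a `v` is explicit (`exists_cube_div_operator`). Along each line in the `i`-th
direction subtract from `f` a fixed bump with the same integral; what was subtracted has a compactly
supported primitive along the lines. After all the coordinates have been treated, only a multiple of
a product of bumps is left. On the manifold a partition of unity cuts `dξ(W)` into pieces lying in
cubes, each solvable up to its integral times a bump. Since `U \ K` is connected, all these bumps
can be traded for one function `ρ` modulo divergences of smooth fields supported in `U \ K`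
(`exists_isExact_sub`). The coefficients of `ρ` then add up to the integral of `dξ(W)`, which is
zero. The outcome is one linear operator `L` (`exists_correction`), independent of the regularity
class: the same construction gives both the quantitative `C^{r,α}` estimate and the membership in
`C^{s,β}`.

The field `X + L W` may fail to be smooth in a compact shell where it agrees neither with `X` nor
with `Y`. There it is mollified at the variable scale `ε b(x)`, with `b` a nonnegative bump: the
vector field is regarded as a closed `(n-1)`-form, pulled back by `x ↦ x + ε b(x) y`, and averaged
over `y`. Pull-backs of closed forms are closed (`ediv_pullKer`), nothing changes where `b = 0`, and
the result is smooth where `b > 0`. As `ε → 0` the change is small in `C^m` whenever the field is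
`C^m`. It is small in `C^{r,α}` as well if there is a spare derivative (`r < s`), if `α = 0`, or by
interpolation if `α < β`. This fails when `r = s` and `α = β > 0`, hence the excluded case. Finitely
many bumps suffice (`exists_smoothing`). -/

namespace ConservativePasting

/-! ### Hölder bounds for functions on open sets, and operators preserving them. -/

section HolderBounds

variable {E E' F F' : Type} [NormedAddCommGroup E] [NormedSpace ℝ E]
  [NormedAddCommGroup E'] [NormedSpace ℝ E'] [NormedAddCommGroup F] [NormedSpace ℝ F]
  [NormedAddCommGroup F'] [NormedSpace ℝ F']

/-- `f` is of class `C^r` on `O`, its derivatives of order at most `r` are bounded by `N` on `O`,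
and its `r`-th derivative is `α`-Hölder with constant `N` along segments contained in `O`. -/
structure BdOn (O : Set E) (r : ℕ) (α : ℝ≥0) (f : E → F) (N : ℝ) : Prop where
  contDiffOn : ContDiffOn ℝ r f O
  bound : ∀ k ≤ r, ∀ x ∈ O, ‖iteratedFDeriv ℝ k f x‖ ≤ N
  holder : ∀ x y, segment ℝ x y ⊆ O →
    ‖iteratedFDeriv ℝ r f x - iteratedFDeriv ℝ r f y‖ ≤ N * ‖x - y‖ ^ (α : ℝ)

variable {O : Set E} {r : ℕ} {α : ℝ≥0} {f g : E → F} {N N' : ℝ}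

lemma BdOn.congr (hO : IsOpen O) (h : BdOn O r α f N) (hfg : EqOn g f O) : BdOn O r α g N := by
  have key : ∀ k, ∀ x ∈ O, iteratedFDeriv ℝ k g x = iteratedFDeriv ℝ k f x := fun k x hx =>
    ((hfg.eventuallyEq_of_mem (hO.mem_nhds hx)).iteratedFDeriv ℝ k).eq_of_nhds
  refine ⟨h.1.congr hfg, fun k hk x hx => ?_, fun x y hxy => ?_⟩
  · rw [key k x hx]; exact h.2 k hk x hx
  · rw [key _ x (hxy (left_mem_segment ℝ x y)), key _ y (hxy (right_mem_segment ℝ x y))]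
    exact h.3 x y hxy

lemma BdOn.mono_set {O' : Set E} (h : BdOn O r α f N) (hO : O' ⊆ O) : BdOn O' r α f N :=
  ⟨h.1.mono hO, fun k hk x hx => h.2 k hk x (hO hx), fun x y hxy => h.3 x y (hxy.trans hO)⟩

lemma BdOn.mono_const (h : BdOn O r α f N) (hN : N ≤ N') : BdOn O r α f N' :=
  ⟨h.1, fun k hk x hx => (h.2 k hk x hx).trans hN, fun x y hxy => (h.3 x y hxy).trans (by gcongr)⟩

lemma BdOn.add (hO : IsOpen O) (h : BdOn O r α f N) (h' : BdOn O r α g N') :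
    BdOn O r α (fun x => f x + g x) (N + N') := by
  have key : ∀ k ≤ r, ∀ x ∈ O, iteratedFDeriv ℝ k (fun x => f x + g x) x =
      iteratedFDeriv ℝ k f x + iteratedFDeriv ℝ k g x := fun k hk x hx => by
    have h1 := (h.1.contDiffAt (hO.mem_nhds hx)).of_le (m := k) (by exact_mod_cast hk)
    have h2 := (h'.1.contDiffAt (hO.mem_nhds hx)).of_le (m := k) (by exact_mod_cast hk)
    exact iteratedFDeriv_add_apply h1 h2
  refine ⟨h.1.add h'.1, fun k hk x hx => ?_, fun x y hxy => ?_⟩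
  · rw [key k hk x hx]
    exact (norm_add_le _ _).trans (add_le_add (h.2 k hk x hx) (h'.2 k hk x hx))
  · rw [key _ le_rfl x (hxy (left_mem_segment ℝ x y)),
      key _ le_rfl y (hxy (right_mem_segment ℝ x y)), add_sub_add_comm, add_mul]
    exact (norm_add_le _ _).trans (add_le_add (h.3 x y hxy) (h'.3 x y hxy))

/-- Post-composition with a continuous linear map. -/
lemma BdOn.clm_comp (hO : IsOpen O) (h : BdOn O r α f N) (L : F →L[ℝ] F') :
    BdOn O r α (fun x => L (f x)) (‖L‖ * N) := by
  have key : ∀ k ≤ r, ∀ x ∈ O, iteratedFDeriv ℝ k (fun x => L (f x)) x =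
      L.compContinuousMultilinearMap (iteratedFDeriv ℝ k f x) := fun k hk x hx =>
    L.iteratedFDeriv_comp_left (h.1.contDiffAt (hO.mem_nhds hx)) (by exact_mod_cast hk)
  refine ⟨L.contDiff.comp_contDiffOn h.1, fun k hk x hx => ?_, fun x y hxy => ?_⟩
  · rw [key k hk x hx]
    exact (L.norm_compContinuousMultilinearMap_le _).trans (by gcongr; exact h.2 k hk x hx)
  · rw [key _ le_rfl x (hxy (left_mem_segment ℝ x y)),
      key _ le_rfl y (hxy (right_mem_segment ℝ x y))]
    have : L.compContinuousMultilinearMap (iteratedFDeriv ℝ r f x) -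
        L.compContinuousMultilinearMap (iteratedFDeriv ℝ r f y) =
        L.compContinuousMultilinearMap (iteratedFDeriv ℝ r f x - iteratedFDeriv ℝ r f y) := by
      ext v; simp
    rw [this, mul_assoc]
    exact (L.norm_compContinuousMultilinearMap_le _).trans (by gcongr; exact h.3 x y hxy)

lemma BdOn.neg (h : BdOn O r α f N) : BdOn O r α (fun x => - f x) N := by
  refine ⟨h.1.neg, fun k hk x hx => ?_, fun x y hxy => ?_⟩
  · have := iteratedFDeriv_neg_apply (𝕜 := ℝ) (i := k) (f := f) (x := x)
    simp only [Pi.neg_def] at this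
    rw [this, norm_neg]; exact h.2 k hk x hx
  · have := fun x => iteratedFDeriv_neg_apply (𝕜 := ℝ) (i := r) (f := f) (x := x)
    simp only [Pi.neg_def] at this
    rw [this, this, neg_sub_neg, norm_sub_rev]; exact h.3 x y hxy

lemma BdOn.const_smul (hO : IsOpen O) (h : BdOn O r α f N) (c : ℝ) :
    BdOn O r α (fun x => c • f x) (|c| * N) := by
  have key : ∀ k ≤ r, ∀ x ∈ O, iteratedFDeriv ℝ k (fun x => c • f x) x =
      c • iteratedFDeriv ℝ k f x := fun k hk x hx =>
    iteratedFDeriv_const_smul_apply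
      ((h.1.contDiffAt (hO.mem_nhds hx)).of_le (by exact_mod_cast hk))
  refine ⟨contDiffOn_const.smul h.1, fun k hk x hx => ?_, fun x y hxy => ?_⟩
  · rw [key k hk x hx, norm_smul, Real.norm_eq_abs]; gcongr; exact h.2 k hk x hx
  · rw [key _ le_rfl x (hxy (left_mem_segment ℝ x y)),
      key _ le_rfl y (hxy (right_mem_segment ℝ x y)), ← smul_sub, norm_smul, Real.norm_eq_abs,
      mul_assoc]
    gcongr; exact h.3 x y hxy

/-- Base case of inductions on `r`. Together with `bdOn_succ_iff`, which passes from `f` to `fderiv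
ℝ f`, it gives estimates of products and compositions without Leibniz or Faà di Bruno formulas; the
price is that the codomain must vary in the induction. -/
lemma bdOn_zero_iff : BdOn O 0 α f N ↔ ContinuousOn f O ∧ (∀ x ∈ O, ‖f x‖ ≤ N) ∧
    ∀ x y, segment ℝ x y ⊆ O → ‖f x - f y‖ ≤ N * ‖x - y‖ ^ (α : ℝ) := by
  have hn : ∀ x y, ‖iteratedFDeriv ℝ 0 f x - iteratedFDeriv ℝ 0 f y‖ = ‖f x - f y‖ := fun x y => by
    rw [iteratedFDeriv_zero_eq_comp, Function.comp_apply, Function.comp_apply, ← map_sub,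
      LinearIsometryEquiv.norm_map]
  constructor
  · rintro ⟨h1, h2, h3⟩
    refine ⟨h1.continuousOn, fun x hx => by simpa using h2 0 le_rfl x hx, fun x y hxy => ?_⟩
    rw [← hn]; exact h3 x y hxy
  · rintro ⟨h1, h2, h3⟩
    refine ⟨by simpa using h1, fun k hk x hx => ?_, fun x y hxy => ?_⟩
    · obtain rfl : k = 0 := by omega
      simpa using h2 x hx
    · rw [hn]; exact h3 x y hxy

lemma bdOn_succ_iff (hO : IsOpen O) : BdOn O (r + 1) α f N ↔ DifferentiableOn ℝ f O ∧
    (∀ x ∈ O, ‖f x‖ ≤ N) ∧ BdOn O r α (fderiv ℝ f) N := by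
  have hn : ∀ x y, ‖iteratedFDeriv ℝ (r+1) f x - iteratedFDeriv ℝ (r+1) f y‖ =
      ‖iteratedFDeriv ℝ r (fderiv ℝ f) x - iteratedFDeriv ℝ r (fderiv ℝ f) y‖ := fun x y => by
    simp [iteratedFDeriv_succ_eq_comp_right, ← dist_eq_norm_sub]
  have hc : ContDiffOn ℝ (r + 1 : ℕ) f O ↔ DifferentiableOn ℝ f O ∧ ContDiffOn ℝ r (fderiv ℝ f) O := by
    push_cast
    rw [contDiffOn_succ_iff_fderiv_of_isOpen hO]
    simp
  constructor
  · rintro ⟨h1, h2, h3⟩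
    refine ⟨(hc.1 h1).1, fun x hx => by simpa using h2 0 (by omega) x hx, (hc.1 h1).2,
      fun k hk x hx => ?_, fun x y hxy => ?_⟩
    · rw [norm_iteratedFDeriv_fderiv]; exact h2 (k+1) (by omega) x hx
    · rw [← hn]; exact h3 x y hxy
  · rintro ⟨h1, h2, h3⟩
    refine ⟨hc.2 ⟨h1, h3.1⟩, fun k hk x hx => ?_, fun x y hxy => ?_⟩
    · rcases k with _ | k
      · simpa using h2 x hx
      · rw [← norm_iteratedFDeriv_fderiv]; exact h3.2 k (by omega) x hx
    · rw [hn]; exact h3.3 x y hxy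

/-- Interpolation of Lipschitz and uniform bounds. -/
lemma le_two_mul_rpow_of_le {t d N : ℝ} (hd : 0 ≤ d) (hN : 0 ≤ N) (hα : α ≤ 1)
    (h1 : t ≤ N * d) (h2 : t ≤ 2 * N) : t ≤ 2 * N * d ^ (α : ℝ) := by
  have hα' : (α : ℝ) ≤ 1 := by exact_mod_cast hα
  rcases le_total d 1 with hd1 | hd1
  · rcases hd.eq_or_lt with rfl | hd0
    · have : t ≤ 0 := by simpa using h1
      exact this.trans (by positivity)
    · have : d ≤ d ^ (α : ℝ) := by
        simpa using Real.rpow_le_rpow_of_exponent_ge hd0 hd1 hα'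
      have h3 : 0 ≤ d ^ (α : ℝ) := by positivity
      nlinarith
  · have : 1 ≤ d ^ (α : ℝ) := Real.one_le_rpow hd1 α.2
    nlinarith

/-- Along a segment in an open set where the derivative is bounded by `N`, a bounded function
is Hölder of every exponent at most one. -/
lemma norm_sub_le_two_mul_of_fderiv_le (hO : IsOpen O) (hα : α ≤ 1) (hN : 0 ≤ N)
    (hd : DifferentiableOn ℝ f O)
    (hb : ∀ x ∈ O, ‖f x‖ ≤ N) (hb' : ∀ x ∈ O, ‖fderiv ℝ f x‖ ≤ N) {x y : E}
    (hxy : segment ℝ x y ⊆ O) : ‖f x - f y‖ ≤ 2 * N * ‖x - y‖ ^ (α : ℝ) := by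
  have hx := hxy (left_mem_segment ℝ x y)
  have hy := hxy (right_mem_segment ℝ x y)
  refine le_two_mul_rpow_of_le (norm_nonneg _) hN hα ?_ ?_
  · exact (convex_segment x y).norm_image_sub_le_of_norm_fderiv_le (𝕜 := ℝ) (f := f)
      (fun z hz => (hd z (hxy hz)).differentiableAt (hO.mem_nhds (hxy hz)))
      (fun z hz => hb' z (hxy hz)) (right_mem_segment ℝ x y) (left_mem_segment ℝ x y)
  · calc ‖f x - f y‖ ≤ ‖f x‖ + ‖f y‖ := norm_sub_le _ _
      _ ≤ 2 * N := by linarith [hb x hx, hb y hy]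

/-- A bounded derivative of order `r + 1` makes the one of order `r` Lipschitz along segments, so
Hölder of any exponent at most one. The factor 2 does not depend on `α`, and the Hölder part of the
hypothesis plays no role, whence the free `γ`. -/
lemma BdOn.of_succ (hO : IsOpen O) {γ : ℝ≥0} (hα : α ≤ 1) (hN : 0 ≤ N) (h : BdOn O (r + 1) γ f N) :
    BdOn O r α f (2 * N) := by
  induction r generalizing F with
  | zero =>
    obtain ⟨h1, h2, h3⟩ := (bdOn_succ_iff hO).1 h
    refine bdOn_zero_iff.2 ⟨h1.continuousOn, fun x hx => (h2 x hx).trans (by linarith), ?_⟩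
    intro x y hxy
    exact norm_sub_le_two_mul_of_fderiv_le hO hα hN h1 h2
      (fun x hx => by simpa using h3.2 0 le_rfl x hx) hxy
  | succ r ih =>
    obtain ⟨h1, h2, h3⟩ := (bdOn_succ_iff hO).1 h
    exact (bdOn_succ_iff hO).2 ⟨h1, fun x hx => (h2 x hx).trans (by linarith), ih h3⟩

lemma BdOn.contDiff (h : BdOn univ r α f N) : ContDiff ℝ r f := contDiffOn_univ.1 h.1

lemma BdOn.contDiff_one (h : BdOn univ r α f N) (hr : 1 ≤ r) : ContDiff ℝ 1 f :=
  h.contDiff.of_le (by exact_mod_cast hr)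

lemma BdOn.norm_le (h : BdOn O r α f N) {x : E} (hx : x ∈ O) : ‖f x‖ ≤ N := by
  simpa using h.2 0 (Nat.zero_le _) x hx

/-- The operator `w ↦ a · (w ∘ σ)`, with smooth compactly supported coefficient `a` and smooth
`σ`, is bounded in Hölder spaces, uniformly in the exponent. -/
lemma exists_bd_mul_comp_of_lipschitz (r : ℕ) (hO : IsOpen O) {a : E' → (F →L[ℝ] F')} {σ : E' → E}
    (ha : ContDiff ℝ ∞ a) (hac : HasCompactSupport a) (hσ : ContDiff ℝ ∞ σ) {L : ℝ≥0}
    (hL : LipschitzWith L σ) {δ : ℝ} (hδ : 0 < δ)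
    (hδO : ∀ x ∈ tsupport a, Metric.ball (σ x) δ ⊆ O) :
    ∃ C, 0 ≤ C ∧ ∀ (α : ℝ≥0) (w : E → F) (N : ℝ), α ≤ 1 → 0 ≤ N → BdOn O r α w N →
      BdOn univ r α (fun x => a x (w (σ x))) (C * N) := by
  have hσO : ∀ x ∈ tsupport a, σ x ∈ O := fun x hx => hδO x hx (Metric.mem_ball_self hδ)
  obtain ⟨A, hA⟩ := hac.exists_bound_of_continuous ha.continuous
  have hA0 : 0 ≤ A := (norm_nonneg _).trans (hA 0)
  have h0 : ∀ (w : E → F), ∀ x ∉ tsupport a, a x (w (σ x)) = 0 := fun w x hx => by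
    rw [image_eq_zero_of_notMem_tsupport hx]; rfl
  have hb : ∀ (w : E → F) (N : ℝ), 0 ≤ N → (∀ x ∈ O, ‖w x‖ ≤ N) → ∀ x, ‖a x (w (σ x))‖ ≤ A * N := by
    intro w N hN hw x
    by_cases hx : x ∈ tsupport a
    · exact (a x).le_of_opNorm_le_of_le (hA x) (hw _ (hσO x hx))
    · rw [h0 w x hx, norm_zero]; positivity
  induction r generalizing F F' A with
  | zero =>
    obtain ⟨B, hB⟩ := ha.lipschitzWith_of_hasCompactSupport hac (by simp)
    -- With `L + 1` in place of `L` the quotient makes sense for `L = 0`, and `(L + 1) ^ α ≤ L + 1`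
    -- because the base is at least one.
    set δ' := δ / (L + 1) with hδ'
    have hδ'0 : 0 < δ' := by positivity
    -- The summands account for the variation of `a`, the variation of `w ∘ σ` between close points,
    -- and pairs of distant points.
    refine ⟨2 * max A B + A * (L + 1) + 2 * A / min δ' 1, by positivity, fun α w N hα hN hw => ?_⟩
    obtain ⟨h1, h2, h3⟩ := bdOn_zero_iff.1 hw
    have hα' : (α : ℝ) ≤ 1 := by exact_mod_cast hα
    refine bdOn_zero_iff.2 ⟨?_, fun x _ => ?_, fun x y _ => ?_⟩
    · rw [continuousOn_univ, continuous_iff_continuousAt]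
      intro x
      by_cases hx : x ∈ tsupport a
      · exact ha.continuous.continuousAt.clm_apply
          (ContinuousAt.comp (h1.continuousAt (hO.mem_nhds (hσO x hx))) hσ.continuous.continuousAt)
      · refine (continuousAt_const (y := (0 : F'))).congr ?_
        filter_upwards [(isClosed_tsupport a).isOpen_compl.mem_nhds hx] with z hz
        exact (h0 w z hz).symm
    · refine (hb w N hN h2 x).trans ?_
      gcongr
      have : A ≤ max A B := le_max_left _ _
      have : 0 ≤ A * (L + 1) + 2 * A / min δ' 1 := by positivity
      linarith
    · wlog hx : x ∈ tsupport a generalizing x y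
      · by_cases hy : y ∈ tsupport a
        · rw [norm_sub_rev, norm_sub_rev x]; exact this y x (subset_univ _) hy
        · rw [h0 w x hx, h0 w y hy, sub_zero, norm_zero]; positivity
      have hC1 : 0 ≤ 2 * max A (B:ℝ) * N * ‖x - y‖ ^ (α : ℝ) := by positivity
      have hC2 : 0 ≤ A * (L + 1) * N * ‖x - y‖ ^ (α : ℝ) := by positivity
      have hC3 : 0 ≤ 2 * A / min δ' 1 * N * ‖x - y‖ ^ (α : ℝ) := by positivity
      have hsum : (2 * max A ↑B + A * (↑L + 1) + 2 * A / min δ' 1) * N * ‖x - y‖ ^ (α : ℝ)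
        = 2 * max A (B:ℝ) * N * ‖x - y‖ ^ (α : ℝ) + A * (L + 1) * N * ‖x - y‖ ^ (α : ℝ)
          + 2 * A / min δ' 1 * N * ‖x - y‖ ^ (α : ℝ) := by ring
      rw [hsum]
      -- The Hölder bound on `w` is available only along segments inside `O`. For close points the
      -- segment from `σ x` to `σ y` stays in a ball contained in `O`; for distant points the
      -- uniform bound is enough, since `‖x - y‖ ^ α` is bounded below independently of `α`.
      by_cases hd : ‖x - y‖ < δ'
      · have hseg : segment ℝ (σ x) (σ y) ⊆ Metric.ball (σ x) δ := by
          refine (convex_ball _ _).segment_subset (Metric.mem_ball_self hδ) ?_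
          rw [Metric.mem_ball]
          calc dist (σ y) (σ x) ≤ L * dist y x := hL.dist_le_mul _ _
            _ ≤ (L + 1) * ‖x - y‖ := by rw [dist_comm, dist_eq_norm]; gcongr; simp
            _ < (L + 1) * δ' := by gcongr
            _ = δ := by rw [hδ']; field_simp
        have hsegO := hseg.trans (hδO x hx)
        have e1 : a x (w (σ x)) - a y (w (σ y)) =
          a x (w (σ x) - w (σ y)) + (a x - a y) (w (σ y)) := by simp
        have e2 : ‖a x - a y‖ ≤ 2 * max A (B:ℝ) * ‖x - y‖ ^ (α : ℝ) := by
          refine le_two_mul_rpow_of_le (norm_nonneg _) (by positivity) hα ?_ ?_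
          · rw [← dist_eq_norm, ← dist_eq_norm]
            exact (hB.dist_le_mul _ _).trans (by gcongr; exact le_max_right _ _)
          · calc ‖a x - a y‖ ≤ ‖a x‖ + ‖a y‖ := norm_sub_le _ _
              _ ≤ 2 * A := by linarith [hA x, hA y]
              _ ≤ _ := by gcongr; exact le_max_left _ _
        have e3 : ‖w (σ x) - w (σ y)‖ ≤ N * ((L + 1) * ‖x - y‖ ^ (α : ℝ)) := by
          refine (h3 _ _ hsegO).trans ?_
          gcongr
          have : ‖σ x - σ y‖ ≤ (L + 1) * ‖x - y‖ := by
            rw [← dist_eq_norm, ← dist_eq_norm]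
            exact (hL.dist_le_mul _ _).trans (by gcongr; simp)
          calc ‖σ x - σ y‖ ^ (α : ℝ) ≤ ((L + 1) * ‖x - y‖) ^ (α : ℝ) := by gcongr
            _ = ((L:ℝ) + 1) ^ (α : ℝ) * ‖x - y‖ ^ (α : ℝ) :=
              Real.mul_rpow (by positivity) (norm_nonneg _)
            _ ≤ _ := by
              gcongr
              have hL1 : (1 : ℝ) ≤ (L : ℝ) + 1 := by simp
              simpa using Real.rpow_le_rpow_of_exponent_le hL1 hα'
        rw [e1]
        calc _ ≤ ‖a x (w (σ x) - w (σ y))‖ + ‖(a x - a y) (w (σ y))‖ := norm_add_le _ _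
          _ ≤ A * (N * ((L + 1) * ‖x - y‖ ^ (α : ℝ))) + 2 * max A (B:ℝ) * ‖x - y‖ ^ (α : ℝ) * N :=
            add_le_add ((a x).le_of_opNorm_le_of_le (hA x) e3)
              ((a x - a y).le_of_opNorm_le_of_le e2 (h2 _ (hsegO (right_mem_segment ℝ _ _))))
          _ = 2 * max A (B:ℝ) * N * ‖x - y‖ ^ (α : ℝ) + A * (L + 1) * N * ‖x - y‖ ^ (α : ℝ) := by ring
          _ ≤ _ := le_add_of_nonneg_right hC3
      · push Not at hd
        have hm0 : 0 < min δ' 1 := by positivity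
        have : min δ' 1 ≤ ‖x - y‖ ^ (α : ℝ) := by
          calc min δ' 1 = (min δ' 1) ^ (1 : ℝ) := by simp
            _ ≤ (min δ' 1) ^ (α : ℝ) := Real.rpow_le_rpow_of_exponent_ge hm0 (min_le_right _ _) hα'
            _ ≤ _ := by gcongr; exact (min_le_left _ _).trans hd
        calc _ ≤ ‖a x (w (σ x))‖ + ‖a y (w (σ y))‖ := norm_sub_le _ _
          _ ≤ 2 * A * N := by linarith [hb w N hN h2 x, hb w N hN h2 y]
          _ = 2 * A / min δ' 1 * N * min δ' 1 := by field_simp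
          _ ≤ 2 * A / min δ' 1 * N * ‖x - y‖ ^ (α : ℝ) := by gcongr
          _ ≤ _ := le_add_of_nonneg_left (add_nonneg hC1 hC2)
  | succ r ih =>
    -- The derivative of `a · (w ∘ σ)` is `a₁ · (w ∘ σ) + a₂ · (Dw ∘ σ)`: two operators of the same
    -- kind, to be bounded at order `r`. In the first one `w` loses a derivative, which costs the
    -- factor 2 of `BdOn.of_succ`.
    let a₁ : E' → (F →L[ℝ] E' →L[ℝ] F') := fun x => (fderiv ℝ a x).flip
    let a₂ : E' → ((E →L[ℝ] F) →L[ℝ] E' →L[ℝ] F') := fun x =>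
      ((ContinuousLinearMap.compL ℝ E' F F') (a x)).comp
        ((ContinuousLinearMap.compL ℝ E' E F).flip (fderiv ℝ σ x))
    have ha' : ContDiff ℝ ∞ (fderiv ℝ a) := ha.fderiv_right (by simp)
    have hσ' : ContDiff ℝ ∞ (fderiv ℝ σ) := hσ.fderiv_right (by simp)
    have hflip : ContDiff ℝ ∞ (fun l : E' →L[ℝ] F →L[ℝ] F' => l.flip) :=
      IsBoundedLinearMap.contDiff (IsLinearMap.with_bound
        ⟨fun _ _ => by ext; rfl, fun _ _ => by ext; rfl⟩ 1 fun l => by simp)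
    have ha₁ : ContDiff ℝ ∞ a₁ := hflip.comp ha'
    have ha₂ : ContDiff ℝ ∞ a₂ := by
      have e1 : ContDiff ℝ ∞ (fun l : F →L[ℝ] F' => ContinuousLinearMap.compL ℝ E' F F' l) :=
        ContinuousLinearMap.contDiff _
      have e2 : ContDiff ℝ ∞ (fun l : E' →L[ℝ] E =>
          (ContinuousLinearMap.compL ℝ E' E F).flip l) := ContinuousLinearMap.contDiff _
      exact (e1.comp ha).clm_comp (e2.comp hσ')
    have hs₁ : tsupport a₁ ⊆ tsupport a := by
      refine (closure_mono ?_).trans (tsupport_fderiv_subset ℝ (f := a))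
      intro x hx hx'
      exact hx (by simp only [a₁, hx']; ext; rfl)
    have hs₂ : tsupport a₂ ⊆ tsupport a := by
      refine closure_mono ?_
      intro x hx hx'
      exact hx (by simp only [a₂, hx']; ext; simp)
    have hc₁ : HasCompactSupport a₁ := hac.of_isClosed_subset (isClosed_tsupport _) hs₁
    have hc₂ : HasCompactSupport a₂ := hac.of_isClosed_subset (isClosed_tsupport _) hs₂
    have mk : ∀ {G G' : Type} [NormedAddCommGroup G] [NormedSpace ℝ G] [NormedAddCommGroup G']
        [NormedSpace ℝ G'] (c : E' → (G →L[ℝ] G')), ContDiff ℝ ∞ c → HasCompactSupport c →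
        tsupport c ⊆ tsupport a → ∃ C, 0 ≤ C ∧ ∀ (α : ℝ≥0) (w : E → G) (N : ℝ), α ≤ 1 → 0 ≤ N →
          BdOn O r α w N → BdOn univ r α (fun x => c x (w (σ x))) (C * N) := by
      intro G G' _ _ _ _ c hc hcc hcs
      obtain ⟨A', hA'⟩ := hcc.exists_bound_of_continuous hc.continuous
      have h0' : ∀ (w : E → G), ∀ x ∉ tsupport c, c x (w (σ x)) = 0 := fun w x hx => by
        rw [image_eq_zero_of_notMem_tsupport hx]; rfl
      have hA'0 : 0 ≤ A' := (norm_nonneg _).trans (hA' 0)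
      refine ih hc hcc (fun x hx => hδO x (hcs hx)) (fun x hx => hσO x (hcs hx)) _ hA' hA'0 h0' ?_
      intro w N hN hw x
      by_cases hx : x ∈ tsupport c
      · exact (c x).le_of_opNorm_le_of_le (hA' x) (hw _ (hσO x (hcs hx)))
      · rw [h0' w x hx, norm_zero]; positivity
    obtain ⟨C₁, hC₁, H₁⟩ := mk a₁ ha₁ hc₁ hs₁
    obtain ⟨C₂, hC₂, H₂⟩ := mk a₂ ha₂ hc₂ hs₂
    refine ⟨A + (C₁ * 2 + C₂), by positivity, fun α w N hα hN hw => ?_⟩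
    have hw' := BdOn.of_succ hO hα hN hw
    obtain ⟨h1, h2, h3⟩ := (bdOn_succ_iff hO).1 hw
    have hder : ∀ x, HasFDerivAt (fun x => a x (w (σ x))) (a₁ x (w (σ x)) + a₂ x (fderiv ℝ w (σ x))) x := by
      intro x
      by_cases hx : x ∈ tsupport a
      · have d1 := ((h1 _ (hσO x hx)).differentiableAt (hO.mem_nhds (hσO x hx))).hasFDerivAt
        have d2 := ((hσ.differentiable (by simp)) x).hasFDerivAt
        have d3 := ((ha.differentiable (by simp)) x).hasFDerivAt
        refine (d3.clm_apply (d1.comp x d2)).congr_fderiv ?_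
        ext v
        simp only [a₁, a₂, add_apply, ContinuousLinearMap.comp_apply,
          ContinuousLinearMap.flip_apply, ContinuousLinearMap.compL_apply, Function.comp_apply]
        abel
      · have e1 : a₁ x = 0 := image_eq_zero_of_notMem_tsupport (fun h => hx (hs₁ h))
        have e2 : a₂ x = 0 := image_eq_zero_of_notMem_tsupport (fun h => hx (hs₂ h))
        rw [e1, e2]
        refine (HasFDerivAt.congr_of_eventuallyEq (f := fun _ => (0 : F')) ?_ ?_)
        · simpa using hasFDerivAt_const (0 : F') x
        · filter_upwards [(isClosed_tsupport a).isOpen_compl.mem_nhds hx] with z hz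
          exact h0 w z hz
    refine (bdOn_succ_iff isOpen_univ).2 ⟨fun x _ => (hder x).differentiableAt.differentiableWithinAt,
      fun x _ => (hb w N hN h2 x).trans (by gcongr; linarith [mul_nonneg hC₁ zero_le_two]), ?_⟩
    have : fderiv ℝ (fun x => a x (w (σ x))) =
        fun x => a₁ x (w (σ x)) + a₂ x (fderiv ℝ w (σ x)) := funext fun x => (hder x).fderiv
    rw [this]
    refine ((H₁ α w _ hα (by positivity) hw').add isOpen_univ (H₂ α _ N hα hN h3)).mono_const ?_
    nlinarith [mul_nonneg hA0 hN]

lemma exists_cutoff [FiniteDimensional ℝ E] {K S : Set E} (hK : IsCompact K) (hS : IsOpen S)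
    (hKS : K ⊆ S) : ∃ χ : E → ℝ, ContDiff ℝ ∞ χ ∧ HasCompactSupport χ ∧ tsupport χ ⊆ S ∧
      (∀ᶠ x in 𝓝ˢ K, χ x = 1) ∧ ∀ x, χ x ∈ Icc (0 : ℝ) 1 := by
  obtain ⟨T, hT, hKT, hTS⟩ := exists_compact_between hK hS hKS
  obtain ⟨f, h1, h0, h01⟩ := exists_contMDiffMap_one_nhds_of_subset_interior 𝓘(ℝ, E)
    (n := (⊤ : ℕ∞)) hK.isClosed hKT
  have hs : tsupport f ⊆ T := closure_minimal
    (fun x hx => by_contra fun h => hx (h0 x h)) hT.isClosed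
  exact ⟨f, f.contMDiff.contDiff, hT.of_isClosed_subset (isClosed_tsupport _) hs, hs.trans hTS,
    h1, h01⟩

/-- The operator `w ↦ a · (w ∘ σ)`, with `a` smooth and compactly supported and `σ` smooth near the
support of `a`, is bounded in Hölder spaces, uniformly in the exponent. -/
lemma exists_bd_mul_comp [FiniteDimensional ℝ E'] (r : ℕ) (hO : IsOpen O)
    {a : E' → (F →L[ℝ] F')} {σ : E' → E} (ha : ContDiff ℝ ∞ a) (hac : HasCompactSupport a)
    {S : Set E'} (hS : IsOpen S) (haS : tsupport a ⊆ S) (hσ : ContDiffOn ℝ ∞ σ S)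
    (hσO : MapsTo σ (tsupport a) O) :
    ∃ C, 0 ≤ C ∧ ∀ (α : ℝ≥0) (w : E → F) (N : ℝ), α ≤ 1 → 0 ≤ N → BdOn O r α w N →
      BdOn univ r α (fun x => a x (w (σ x))) (C * N) := by
  obtain ⟨χ, hχ, hχc, hχS, hχ1, -⟩ := exists_cutoff hac hS haS
  have hχ1' : ∀ x ∈ tsupport a, χ x = 1 := fun x hx => (hχ1.self_of_nhdsSet x hx)
  -- `σ` is replaced by a globally defined map with compact support, hence Lipschitz, that agrees
  -- with it on the support of `a`. Compactness of the image of that support then provides `δ`.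
  let τ : E' → E := fun x => χ x • σ x
  have hτ : ContDiff ℝ ∞ τ := by
    rw [contDiff_iff_contDiffAt]
    intro x
    by_cases hx : x ∈ tsupport χ
    · exact hχ.contDiffAt.smul (hσ.contDiffAt (hS.mem_nhds (hχS hx)))
    · refine contDiffAt_const (c := (0 : E)).congr_of_eventuallyEq ?_
      filter_upwards [(isClosed_tsupport χ).isOpen_compl.mem_nhds hx] with z hz
      simp [τ, image_eq_zero_of_notMem_tsupport hz]
  have hτc : HasCompactSupport τ := hχc.smul_right
  obtain ⟨L, hL⟩ := hτ.lipschitzWith_of_hasCompactSupport hτc (by simp)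
  have hτσ : ∀ x ∈ tsupport a, τ x = σ x := fun x hx => by simp [τ, hχ1' x hx]
  have himg : IsCompact (τ '' tsupport a) := hac.isCompact.image hτ.continuous
  obtain ⟨δ, hδ, hδO⟩ := himg.exists_thickening_subset_open hO (by
    rintro _ ⟨x, hx, rfl⟩; rw [hτσ x hx]; exact hσO hx)
  obtain ⟨C, hC, H⟩ := exists_bd_mul_comp_of_lipschitz (F := F) r hO ha hac hτ hL hδ
    (fun x hx => (Metric.ball_subset_thickening (mem_image_of_mem τ hx) δ).trans hδO)
  refine ⟨C, hC, fun α w N hα hN hw => ?_⟩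
  refine (H α w N hα hN hw).congr isOpen_univ (fun x _ => ?_)
  by_cases hx : x ∈ tsupport a
  · simp only [hτσ x hx]
  · simp only [image_eq_zero_of_notMem_tsupport hx]; rfl

/-- Derivation under the integral sign. -/
lemma hasFDerivAt_integral_prodMk {P Y : Type} [NormedAddCommGroup P] [NormedSpace ℝ P]
    [NormedAddCommGroup Y] [NormedSpace ℝ Y] [SecondCountableTopology Y] [MeasurableSpace Y]
    [BorelSpace Y] (μ : MeasureTheory.Measure Y) [MeasureTheory.IsFiniteMeasure μ]
    {H : P × Y → F} (hd : ContDiff ℝ 1 H) {N : ℝ} (hN : ∀ z, ‖H z‖ ≤ N)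
    (hN' : ∀ z, ‖fderiv ℝ H z‖ ≤ N) (p : P) :
    HasFDerivAt (fun p => ∫ y, H (p, y) ∂μ)
      (∫ y, (fderiv ℝ H (p, y)).comp (ContinuousLinearMap.inl ℝ P Y) ∂μ) p := by
  have hc : Continuous (fderiv ℝ H) := hd.continuous_fderiv (by simp)
  have hN0 : 0 ≤ N := (norm_nonneg _).trans (hN (p, 0))
  refine hasFDerivAt_integral_of_dominated_of_fderiv_le (bound := fun _ => N) (s := univ)
    (F' := fun p y => (fderiv ℝ H (p, y)).comp (ContinuousLinearMap.inl ℝ P Y))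
    univ_mem (.of_forall fun q => ?_) ?_ ?_ (.of_forall fun y q _ => ?_) ?_
    (.of_forall fun y q _ => ?_)
  · exact (hd.continuous.comp (Continuous.prodMk_right q)).aestronglyMeasurable
  · exact MeasureTheory.Integrable.of_bound
      (hd.continuous.comp (Continuous.prodMk_right p)).aestronglyMeasurable N
      (.of_forall fun y => hN _)
  · exact ((hc.comp (Continuous.prodMk_right p)).clm_comp continuous_const).aestronglyMeasurable
  · calc _ ≤ ‖fderiv ℝ H (q, y)‖ * ‖ContinuousLinearMap.inl ℝ P Y‖ :=
        ContinuousLinearMap.opNorm_comp_le _ _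
      _ ≤ N * 1 := by
        gcongr
        · exact hN' _
        · exact ContinuousLinearMap.norm_inl_le_one ℝ P Y
      _ = N := mul_one N
  · exact MeasureTheory.integrable_const N
  · exact (((hd.differentiable (by simp)) (q, y)).hasFDerivAt).comp q (hasFDerivAt_prodMk_left q y)

/-- Averaging over a parameter is bounded in Hölder spaces. -/
lemma BdOn.integral {P Y : Type} [NormedAddCommGroup P] [NormedSpace ℝ P] [NormedAddCommGroup Y]
    [NormedSpace ℝ Y] [SecondCountableTopology Y] [SecondCountableTopology P] [MeasurableSpace Y] [BorelSpace Y]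
    (μ : MeasureTheory.Measure Y) [MeasureTheory.IsFiniteMeasure μ] {H : P × Y → F}
    (h : BdOn univ r α H N) (hN : 0 ≤ N) :
    BdOn univ r α (fun p => ∫ y, H (p, y) ∂μ) (μ.real univ * N) := by
  induction r generalizing F with
  | zero =>
    obtain ⟨h1, h2, h3⟩ := bdOn_zero_iff.1 h
    rw [continuousOn_univ] at h1
    have hm : ∀ p, MeasureTheory.AEStronglyMeasurable (fun y => H (p, y)) μ := fun p =>
      (h1.comp (Continuous.prodMk_right p)).aestronglyMeasurable
    have hi : ∀ p, MeasureTheory.Integrable (fun y => H (p, y)) μ := fun p =>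
      MeasureTheory.Integrable.of_bound (hm p) N (.of_forall fun y => h2 _ trivial)
    refine bdOn_zero_iff.2 ⟨?_, fun p _ => ?_, fun p q _ => ?_⟩
    · rw [continuousOn_univ]
      exact MeasureTheory.continuous_of_dominated (bound := fun _ => N) hm
        (fun p => .of_forall fun y => h2 _ trivial) (MeasureTheory.integrable_const N)
        (.of_forall fun y => h1.comp (Continuous.prodMk_left y))
    · rw [mul_comm]
      exact MeasureTheory.norm_integral_le_of_norm_le_const (.of_forall fun y => h2 _ trivial)
    · rw [← MeasureTheory.integral_sub (hi p) (hi q)]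
      refine (MeasureTheory.norm_integral_le_of_norm_le_const (C := N * ‖p - q‖ ^ (α : ℝ))
        (.of_forall fun y => ?_)).trans (le_of_eq (by ring))
      have := h3 (p, y) (q, y) (subset_univ _)
      simpa [Prod.norm_def] using this
  | succ r ih =>
    obtain ⟨h1, h2, h3⟩ := (bdOn_succ_iff isOpen_univ).1 h
    have hd := fun p => hasFDerivAt_integral_prodMk μ
      ((contDiffOn_univ.1 h.1).of_le (by simp)) (fun z => h2 z trivial)
      (fun z => h3.norm_le (mem_univ z)) p
    refine (bdOn_succ_iff isOpen_univ).2 ⟨fun p _ => (hd p).differentiableAt.differentiableWithinAt,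
      fun p _ => ?_, ?_⟩
    · rw [mul_comm]
      exact MeasureTheory.norm_integral_le_of_norm_le_const (.of_forall fun y => h2 _ trivial)
    · have e : fderiv ℝ (fun p => ∫ y, H (p, y) ∂μ) = fun p =>
          ∫ y, (fderiv ℝ H (p, y)).comp (ContinuousLinearMap.inl ℝ P Y) ∂μ :=
        funext fun p => (hd p).fderiv
      rw [e]
      refine ih (H := fun z => (fderiv ℝ H z).comp (ContinuousLinearMap.inl ℝ P Y)) ?_
      refine (h3.clm_comp isOpen_univ ((ContinuousLinearMap.compL ℝ P (P × Y) F).flip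
        (ContinuousLinearMap.inl ℝ P Y))).mono_const ?_
      have : ‖(ContinuousLinearMap.compL ℝ P (P × Y) F).flip
        (ContinuousLinearMap.inl ℝ P Y)‖ ≤ 1 := by
        refine ContinuousLinearMap.opNorm_le_bound _ zero_le_one fun L => ?_
        rw [one_mul]
        calc _ ≤ ‖L‖ * ‖ContinuousLinearMap.inl ℝ P Y‖ := ContinuousLinearMap.opNorm_comp_le _ _
          _ ≤ ‖L‖ * 1 := by gcongr; exact ContinuousLinearMap.norm_inl_le_one ℝ P Y
          _ = ‖L‖ := mul_one _
      nlinarith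

/-- A compactly supported `C^{r+1}` function is bounded in every `C^{r,α}`, uniformly in `α`. -/
lemma exists_bdOn_of_hasCompactSupport (hf : ContDiff ℝ r f) (hfc : HasCompactSupport f) :
    ∃ N, 0 ≤ N ∧ BdOn univ r 0 f N := by
  have : ∀ k : ℕ, k ≤ r → ∃ N, ∀ x, ‖iteratedFDeriv ℝ k f x‖ ≤ N := fun k hk =>
    (hfc.iteratedFDeriv k).exists_bound_of_continuous
      (hf.continuous_iteratedFDeriv (by exact_mod_cast hk))
  choose! B hB using this
  have hB0 : ∀ k ≤ r, 0 ≤ B k := fun k hk => (norm_nonneg _).trans (hB k hk 0)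
  have hB' : ∀ k ≤ r, B k ≤ ∑ k ∈ Finset.range (r + 1), B k := fun k hk =>
    Finset.single_le_sum (f := B) (fun i hi => hB0 i (by simpa [Nat.lt_succ_iff] using hi))
      (by simpa [Nat.lt_succ_iff] using hk)
  have hS : 0 ≤ ∑ k ∈ Finset.range (r + 1), B k := (hB0 0 (by simp)).trans (hB' 0 (by simp))
  -- At exponent 0 the Hölder condition only bounds the oscillation of the top derivative, by twice
  -- its supremum.
  refine ⟨2 * ∑ k ∈ Finset.range (r + 1), B k, by positivity, contDiffOn_univ.2 hf,
    fun k hk x _ => ((hB k hk x).trans (hB' k hk)).trans (by linarith), fun x y _ => ?_⟩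
  simp only [NNReal.coe_zero, Real.rpow_zero, mul_one]
  calc _ ≤ ‖iteratedFDeriv ℝ r f x‖ + ‖iteratedFDeriv ℝ r f y‖ := norm_sub_le _ _
    _ ≤ _ := by linarith [hB r le_rfl x, hB r le_rfl y, hB' r le_rfl]

end HolderBounds

/-! ### The divergence equation in a cube, without loss of derivatives. -/

section Cube

/-- The divergence of a vector field on Euclidean space. -/
noncomputable def ediv {n : ℕ} (f : EuclideanSpace ℝ (Fin n) → EuclideanSpace ℝ (Fin n))
    (x : EuclideanSpace ℝ (Fin n)) : ℝ :=
  ∑ i, fderiv ℝ f x (EuclideanSpace.single i (1 : ℝ)) i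

/-- The closed cube of centre `c` and half side `a`. -/
def cube {n : ℕ} (c : EuclideanSpace ℝ (Fin n)) (a : ℝ) : Set (EuclideanSpace ℝ (Fin n)) :=
  {x | ∀ i, |x i - c i| ≤ a}

variable {n : ℕ}

local notation "𝔼" => EuclideanSpace ℝ (Fin n)

lemma ediv_congr {f g : 𝔼 → 𝔼} {x : 𝔼} (h : f =ᶠ[𝓝 x] g) : ediv f x = ediv g x := by
  simp only [ediv, h.fderiv_eq]

lemma ediv_add {f g : 𝔼 → 𝔼} {x : 𝔼} (hf : DifferentiableAt ℝ f x) (hg : DifferentiableAt ℝ g x) :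
    ediv (fun x => f x + g x) x = ediv f x + ediv g x := by
  simp only [ediv, fderiv_fun_add hf hg, add_apply, PiLp.add_apply,
    Finset.sum_add_distrib]

lemma isCompact_cube (c : 𝔼) (a : ℝ) : IsCompact (cube c a) := by
  have h : cube c a = (EuclideanSpace.equiv (Fin n) ℝ) ⁻¹'
      (Set.pi univ fun i => Icc (c i - a) (c i + a)) := by
    ext x
    simp only [cube, mem_ofPred_eq, mem_preimage, mem_univ_pi, mem_Icc, abs_le]
    refine forall_congr' fun i => ?_
    simp only [EuclideanSpace.equiv, PiLp.coe_continuousLinearEquiv]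
    constructor <;> rintro ⟨h1, h2⟩ <;> constructor <;> linarith
  rw [h]
  exact (EuclideanSpace.equiv (Fin n) ℝ).toHomeomorph.isCompact_preimage.2
    (isCompact_univ_pi fun i => isCompact_Icc)

lemma hasCompactSupport_of_cube {F : Type*} [Zero F] {c : 𝔼} {a : ℝ} {f : 𝔼 → F}
    (h : ∀ x ∉ cube c a, f x = 0) : HasCompactSupport f :=
  HasCompactSupport.intro (isCompact_cube c a) h

/-- Integration by parts against the constant 1 in each coordinate. -/
lemma integral_ediv_eq_zero {f : 𝔼 → 𝔼} (hf : ContDiff ℝ 1 f) (hc : HasCompactSupport f) :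
    ∫ x, ediv f x = 0 := by
  have hcd : Continuous (fderiv ℝ f) := hf.continuous_fderiv (by simp)
  have hi : ∀ i, MeasureTheory.Integrable
      (fun x => fderiv ℝ f x (EuclideanSpace.single i (1 : ℝ)) i) := fun i =>
    Continuous.integrable_of_hasCompactSupport
      (by have := hcd.clm_apply (continuous_const (y := EuclideanSpace.single i (1 : ℝ))); fun_prop)
      ((hc.fderiv ℝ).mono (by
        intro x hx hx'; exact hx (by simp [hx'])))
  simp only [ediv]
  rw [MeasureTheory.integral_finsetSum _ fun i _ => hi i]
  refine Finset.sum_eq_zero fun i _ => ?_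
  have hd : ∀ x, fderiv ℝ (fun x => f x i) x (EuclideanSpace.single i 1) =
      fderiv ℝ f x (EuclideanSpace.single i (1 : ℝ)) i := fun x => by
    have := ((EuclideanSpace.proj (𝕜 := ℝ) i).hasFDerivAt.comp x
      ((hf.differentiable (by simp)) x).hasFDerivAt).fderiv
    have h2 : (⇑(EuclideanSpace.proj (𝕜 := ℝ) i) ∘ f) = fun x => f x i := rfl
    rw [h2] at this
    rw [this]; rfl
  have h := integral_mul_fderiv_eq_neg_fderiv_mul_of_integrable (𝕜 := ℝ)
    (μ := (MeasureTheory.volume : MeasureTheory.Measure 𝔼)) (f := fun _ => (1 : ℝ)) (g := fun x => f x i)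
    (v := EuclideanSpace.single i 1) (by simp) (by simpa [hd] using hi i)
    (by
      simp only [one_mul]
      exact Continuous.integrable_of_hasCompactSupport (by have := hf.continuous; fun_prop)
        (hc.mono (by intro x hx hx'; exact hx (by simp [hx']))))
    (by simp) (fun x _ => by
      have := (hf.differentiable (by simp)) x
      exact (EuclideanSpace.proj (𝕜 := ℝ) i).differentiableAt.comp x this)
  simpa [hd] using h

/-- Weighted averages along lines are bounded in Hölder spaces. -/
lemma exists_bd_line_average (r : ℕ) {κ : 𝔼 × ℝ → ℝ} (hκ : ContDiff ℝ ∞ κ)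
    (hκc : HasCompactSupport κ) (v : 𝔼) (μ : MeasureTheory.Measure ℝ)
    [MeasureTheory.IsFiniteMeasure μ] :
    ∃ C, 0 ≤ C ∧ ∀ (α : ℝ≥0) (f : 𝔼 → ℝ) (N : ℝ), α ≤ 1 → 0 ≤ N → BdOn univ r α f N →
      BdOn univ r α (fun x => ∫ t, κ (x, t) * f (x + t • v) ∂μ) (C * N) := by
  obtain ⟨C, hC, H⟩ := exists_bd_mul_comp (E := 𝔼) (F := ℝ) (F' := ℝ) r isOpen_univ
    (a := fun z : 𝔼 × ℝ => κ z • ContinuousLinearMap.id ℝ ℝ) (σ := fun z => z.1 + z.2 • v)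
    (hκ.smul contDiff_const) (hκc.smul_right) isOpen_univ (subset_univ _)
    (by fun_prop) (fun _ _ => trivial)
  refine ⟨μ.real univ * C, by positivity, fun α f N hα hN hf => ?_⟩
  have := (H α f N hα hN hf).integral μ (by positivity)
  rw [mul_assoc]
  simpa using this

lemma mem_cube_add_single {c x : 𝔼} {a t : ℝ} {i : Fin n} :
    x + t • EuclideanSpace.single i (1 : ℝ) ∈ cube c a ↔
      |x i + t - c i| ≤ a ∧ ∀ j, j ≠ i → |x j - c j| ≤ a := by
  simp only [cube, mem_ofPred_eq, PiLp.add_apply, PiLp.smul_apply, smul_eq_mul,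
    PiLp.single_apply, mul_ite, mul_one, mul_zero]
  constructor
  · intro h
    refine ⟨by simpa using h i, fun j hj => by simpa [hj] using h j⟩
  · rintro ⟨h1, h2⟩ j
    by_cases hj : j = i
    · subst hj; simpa using h1
    · simpa [hj] using h2 j hj

/-- Replace a function by its averages along the `i`-th coordinate lines. -/
noncomputable def lineMean (ρ : ℝ → ℝ) (c : 𝔼) (i : Fin n) (f : 𝔼 → ℝ) (x : 𝔼) : ℝ :=
  ρ (x i - c i) * ∫ t : ℝ, f (x + t • EuclideanSpace.single i (1 : ℝ))

/-- The primitive in the direction of the `i`-th coordinate. -/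
noncomputable def linePrim (i : Fin n) (f : 𝔼 → ℝ) (x : 𝔼) : ℝ :=
  ∫ t in Iic (0 : ℝ), f (x + t • EuclideanSpace.single i (1 : ℝ))

variable {ρ : ℝ → ℝ} {c : EuclideanSpace ℝ (Fin n)} {a : ℝ} {f : EuclideanSpace ℝ (Fin n) → ℝ}

lemma lineMean_eq_zero {i : Fin n} (hρ : ∀ t, a < |t| → ρ t = 0)
    (hf : ∀ x ∉ cube c a, f x = 0) : ∀ x ∉ cube c a, lineMean ρ c i f x = 0 := by
  intro x hx
  by_cases hi : a < |x i - c i|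
  · rw [lineMean, hρ _ hi, zero_mul]
  · have : ∀ t : ℝ, f (x + t • EuclideanSpace.single i (1 : ℝ)) = 0 := fun t => hf _ fun h => hx
      fun j => by
        by_cases hj : j = i
        · subst hj; exact not_lt.1 hi
        · exact (mem_cube_add_single.1 h).2 j hj
    simp [lineMean, this]

lemma exists_cutoff_cube (c : 𝔼) (a : ℝ) : ∃ κ : 𝔼 × ℝ → ℝ, ContDiff ℝ ∞ κ ∧
    HasCompactSupport κ ∧ ∀ x ∈ cube c a, ∀ t, |t| ≤ 2 * a → κ (x, t) = 1 := by
  obtain ⟨κ, h1, h2, -, h3, -⟩ := exists_cutoff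
    ((isCompact_cube c a).prod (isCompact_Icc (a := -(2 * a)) (b := 2 * a))) isOpen_univ
    (subset_univ _)
  exact ⟨κ, h1, h2, fun x hx t ht => h3.self_of_nhdsSet (x, t) ⟨hx, abs_le.1 ht⟩⟩

/-- For `f` supported in the cube and `x` in the cube only `|t| ≤ 2a` contributes, so the line
integral may be cut off and becomes an average of the kind treated in `exists_bd_line_average`. -/
lemma exists_bd_lineMean (hρ0 : ContDiff ℝ ∞ ρ) (hρ : ∀ t, a < |t| → ρ t = 0) (i : Fin n) (r : ℕ) :
    ∃ C, 0 ≤ C ∧ ∀ (α : ℝ≥0) (f : 𝔼 → ℝ) (N : ℝ), α ≤ 1 → 0 ≤ N → (∀ x ∉ cube c a, f x = 0) →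
      BdOn univ r α f N → BdOn univ r α (lineMean ρ c i f) (C * N) := by
  obtain ⟨κ, hκ, hκc, hκ1⟩ := exists_cutoff_cube c a
  obtain ⟨C, hC, H⟩ := exists_bd_line_average r (κ := fun z => κ z * ρ (z.1 i - c i))
    (hκ.mul (hρ0.comp (by fun_prop))) hκc.mul_right (EuclideanSpace.single i (1 : ℝ))
    (MeasureTheory.volume.restrict (Icc (-(2 * a)) (2 * a)))
  refine ⟨C, hC, fun α f N hα hN hf0 hf => (H α f N hα hN hf).congr isOpen_univ fun x _ => ?_⟩
  by_cases hx : x ∈ cube c a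
  · rw [lineMean, ← MeasureTheory.integral_const_mul,
      ← MeasureTheory.setIntegral_eq_integral_of_forall_compl_eq_zero (s := Icc (-(2 * a)) (2 * a))]
    · refine MeasureTheory.setIntegral_congr_fun measurableSet_Icc fun t ht => ?_
      simp only [hκ1 x hx t (abs_le.2 ht), one_mul]
    · intro t ht
      rw [hf0 _ fun h => ht ?_, mul_zero]
      have h1 := abs_le.1 (mem_cube_add_single.1 h).1
      have h2 := abs_le.1 (hx i)
      constructor <;> linarith [h1.1, h1.2, h2.1, h2.2]
  · rw [lineMean_eq_zero hρ hf0 x hx, eq_comm]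
    refine MeasureTheory.integral_eq_zero_of_ae (.of_forall fun t => ?_)
    by_cases hi : a < |x i - c i|
    · simp [hρ _ hi]
    · have : f (x + t • EuclideanSpace.single i (1 : ℝ)) = 0 := hf0 _ fun h => hx
        fun j => by
          by_cases hj : j = i
          · subst hj; exact not_lt.1 hi
          · exact (mem_cube_add_single.1 h).2 j hj
      simp [this]

/-- On the far side of the cube the primitive is the integral over the whole line: this is where the
zero mean on lines is needed. -/
lemma linePrim_eq_zero {i : Fin n} (hf : ∀ x ∉ cube c a, f x = 0)
    (h0 : ∀ x, ∫ t : ℝ, f (x + t • EuclideanSpace.single i (1 : ℝ)) = 0) :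
    ∀ x ∉ cube c a, linePrim i f x = 0 := by
  intro x hx
  by_cases hj : ∃ j, j ≠ i ∧ a < |x j - c j|
  · obtain ⟨j, hji, hj⟩ := hj
    have : ∀ t : ℝ, f (x + t • EuclideanSpace.single i (1 : ℝ)) = 0 := fun t => hf _ fun h =>
      (mem_cube_add_single.1 h).2 j hji |>.not_gt hj
    simp [linePrim, this]
  · push Not at hj
    have hi : a < |x i - c i| := by
      by_contra h
      exact hx fun j => if hji : j = i then hji ▸ not_lt.1 h else hj j hji
    rcases lt_abs.1 hi with hi | hi
    · refine (MeasureTheory.setIntegral_eq_integral_of_forall_compl_eq_zero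
        fun t ht => hf _ fun h => ?_).trans (h0 x)
      have := abs_le.1 (mem_cube_add_single.1 h).1
      simp only [mem_Iic, not_le] at ht
      linarith
    · refine MeasureTheory.setIntegral_eq_zero_of_forall_eq_zero fun t ht => hf _ fun h => ?_
      have := abs_le.1 (mem_cube_add_single.1 h).1
      simp only [mem_Iic] at ht
      linarith

lemma exists_bd_linePrim (c : 𝔼) (a : ℝ) (i : Fin n) (r : ℕ) :
    ∃ C, 0 ≤ C ∧ ∀ (α : ℝ≥0) (f : 𝔼 → ℝ) (N : ℝ), α ≤ 1 → 0 ≤ N → (∀ x ∉ cube c a, f x = 0) →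
      (∀ x, ∫ t : ℝ, f (x + t • EuclideanSpace.single i (1 : ℝ)) = 0) →
      BdOn univ r α f N → BdOn univ r α (linePrim i f) (C * N) := by
  obtain ⟨χ, hχ, hχc, -, hχ1, -⟩ := exists_cutoff (isCompact_cube c a) isOpen_univ (subset_univ _)
  obtain ⟨R, hR⟩ := hχc.isCompact.isBounded.subset_closedBall c
  obtain ⟨ζ, hζ, hζc, -, hζ1, -⟩ := exists_cutoff
    (isCompact_Icc (a := -(R + a)) (b := 0)) isOpen_univ (subset_univ _)
  have hκc : HasCompactSupport fun z : 𝔼 × ℝ => χ z.1 * ζ z.2 :=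
    HasCompactSupport.intro (hχc.isCompact.prod hζc.isCompact) fun z hz => by
      by_cases h : z.1 ∈ tsupport χ
      · rw [image_eq_zero_of_notMem_tsupport fun h' => hz ⟨h, h'⟩, mul_zero]
      · rw [image_eq_zero_of_notMem_tsupport h, zero_mul]
  obtain ⟨C, hC, H⟩ := exists_bd_line_average r (κ := fun z => χ z.1 * ζ z.2)
    ((hχ.comp contDiff_fst).mul (hζ.comp contDiff_snd)) hκc (EuclideanSpace.single i (1 : ℝ))
    (MeasureTheory.volume.restrict (Icc (-(R + a)) 0))
  refine ⟨C, hC, fun α f N hα hN hf0 h0 hf => (H α f N hα hN hf).congr isOpen_univ fun x _ => ?_⟩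
  -- The primitive vanishes off the cube, so inserting `χ` is harmless. It confines `x` to a ball of
  -- radius `R`, where only `t ≥ -(R + a)` matters.
  have e1 : linePrim i f x = χ x * linePrim i f x := by
    by_cases hx : x ∈ cube c a
    · rw [hχ1.self_of_nhdsSet x hx, one_mul]
    · rw [linePrim_eq_zero hf0 h0 x hx, mul_zero]
  rw [e1]
  by_cases hx : x ∈ tsupport χ
  · rw [linePrim, ← MeasureTheory.integral_const_mul]
    refine (MeasureTheory.setIntegral_eq_of_subset_of_forall_sdiff_eq_zero measurableSet_Iic
      Icc_subset_Iic_self fun t ht => ?_).trans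
      (MeasureTheory.setIntegral_congr_fun measurableSet_Icc fun t ht => ?_)
    · rw [hf0 _ fun h => ht.2 ⟨?_, ht.1⟩, mul_zero]
      have h1 := abs_le.1 (mem_cube_add_single.1 h).1
      have h2 : |x i - c i| ≤ R := (PiLp.norm_apply_le (x - c) i).trans
        (by simpa [dist_eq_norm] using hR hx)
      linarith [(abs_le.1 h2).2]
    · simp only [hζ1.self_of_nhdsSet t ht, mul_one]
  · simp [image_eq_zero_of_notMem_tsupport hx]

/-- The fundamental theorem of calculus on the line through `x`; translation of the integration
variable turns `linePrim` at `x + s e` into the integral of `h` up to `s`. -/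
lemma fderiv_linePrim_apply (hf : ContDiff ℝ 1 f) (hc : HasCompactSupport f) {i : Fin n}
    (hd : Differentiable ℝ (linePrim i f)) (x : 𝔼) :
    fderiv ℝ (linePrim i f) x (EuclideanSpace.single i 1) = f x := by
  set e : 𝔼 := EuclideanSpace.single i 1
  let h : ℝ → ℝ := fun t => f (x + t • e)
  have he : ‖e‖ = 1 := by simp [e]
  have hh : Continuous h := hf.continuous.comp (by fun_prop)
  have hhc : HasCompactSupport h := by
    refine hc.comp_isClosedEmbedding (g := fun t : ℝ => x + t • e) ?_
    refine Isometry.isClosedEmbedding (Isometry.of_dist_eq fun s t => ?_)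
    simp [dist_eq_norm, ← sub_smul, norm_smul, he]
  have hi : MeasureTheory.Integrable h := hh.integrable_of_hasCompactSupport hhc
  have e1 : ∀ s : ℝ, linePrim i f (x + s • e) = (∫ t in Iic 0, h t) + ∫ t in (0 : ℝ)..s, h t := by
    intro s
    rw [← intervalIntegral.integral_Iic_sub_Iic hi.integrableOn hi.integrableOn, add_sub_cancel,
      linePrim, ← MeasureTheory.integral_indicator measurableSet_Iic,
      ← MeasureTheory.integral_indicator measurableSet_Iic,
      ← MeasureTheory.integral_add_left_eq_self ((Iic s).indicator h) s]
    congr 1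
    ext t
    simp only [indicator, mem_Iic, h, add_le_iff_nonpos_right, add_assoc, ← add_smul, e]
  have d1 : HasDerivAt (fun s : ℝ => linePrim i f (x + s • e)) (h 0) 0 := by
    simp only [e1]
    exact (hh.integral_hasStrictDerivAt 0 0).hasDerivAt.const_add _
  have d2 : HasDerivAt (fun s : ℝ => linePrim i f (x + s • e)) (fderiv ℝ (linePrim i f) x e) 0 := by
    have h1 : HasFDerivAt (linePrim i f) (fderiv ℝ (linePrim i f) x) (x + (0 : ℝ) • e) := by
      simpa using (hd x).hasFDerivAt
    have h2 : HasDerivAt (fun s : ℝ => x + s • e) e 0 := by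
      simpa using ((hasDerivAt_id (0 : ℝ)).smul_const e).const_add x
    exact h1.comp_hasDerivAt 0 h2
  have := d2.unique d1
  simpa [h] using this

/-- `f` is the product of `∏ ρ(xᵢ - cᵢ)`, `i ∈ S`, and of a function that does not depend on the
coordinates in `S`. -/
def IsSeparated (ρ : ℝ → ℝ) (c : EuclideanSpace ℝ (Fin n)) (S : Finset (Fin n))
    (f : EuclideanSpace ℝ (Fin n) → ℝ) : Prop :=
  ∃ h : EuclideanSpace ℝ (Fin n) → ℝ, (∀ x, f x = (∏ i ∈ S, ρ (x i - c i)) * h x) ∧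
    ∀ i ∈ S, ∀ x, ∀ t : ℝ, h (x + t • EuclideanSpace.single i (1 : ℝ)) = h x

/-- The line integral removes the dependence on `x i`, and the prefactor of `lineMean` supplies the
missing `ρ`. The factors for `j ∈ S` come out of the integral because they are constant along the
`i`-th lines. -/
lemma IsSeparated.lineMean {S : Finset (Fin n)} (hf : IsSeparated ρ c S f) {i : Fin n}
    (hi : i ∉ S) : IsSeparated ρ c (insert i S) (lineMean ρ c i f) := by
  obtain ⟨h, h1, h2⟩ := hf
  refine ⟨fun x => ∫ t : ℝ, h (x + t • EuclideanSpace.single i (1 : ℝ)), fun x => ?_,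
    fun j hj x s => ?_⟩
  · rw [Finset.prod_insert hi, mul_assoc, ← MeasureTheory.integral_const_mul]
    simp only [ConservativePasting.lineMean]
    congr 2
    ext t
    rw [h1]
    congr 1
    refine Finset.prod_congr rfl fun j hj => ?_
    have : j ≠ i := fun h => hi (h ▸ hj)
    simp [this]
  · rcases Finset.mem_insert.1 hj with rfl | hj
    · simp only [add_assoc, ← add_smul]
      exact MeasureTheory.integral_add_left_eq_self
        (fun t : ℝ => h (x + t • EuclideanSpace.single j (1 : ℝ))) s
    · refine MeasureTheory.integral_congr_ae (.of_forall fun t => ?_)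
      change h _ = h _
      rw [add_right_comm, h2 j hj]

lemma IsSeparated.exists_eq_const_mul (hf : IsSeparated ρ c Finset.univ f) :
    ∃ m : ℝ, ∀ x, f x = m * ∏ i, ρ (x i - c i) := by
  obtain ⟨h, h1, h2⟩ := hf
  refine ⟨h 0, fun x => ?_⟩
  rw [h1, mul_comm]
  congr 1
  -- `h` is constant: `x` is reached from the origin by successive moves along the axes, none of
  -- which changes `h`.
  have : ∀ S : Finset (Fin n), h (∑ i ∈ S, x i • EuclideanSpace.single i (1 : ℝ)) = h 0 := by
    intro S
    induction S using Finset.induction_on with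
    | empty => simp
    | insert i S hi ih => rw [Finset.sum_insert hi, add_comm, h2 i (Finset.mem_univ i), ih]
  rw [← this Finset.univ]
  congr 1
  have := (EuclideanSpace.basisFun (Fin n) ℝ).sum_repr x
  simpa using this.symm

/-- As `ρ` has integral one, `f` and its line mean have the same integral over each line in the
direction `i`. -/
lemma integral_sub_lineMean {i : Fin n} (hf : ContDiff ℝ 1 f) (hc : HasCompactSupport f)
    (hρ0 : Continuous ρ) (hρc : HasCompactSupport ρ) (hρ1 : ∫ t, ρ t = 1) (x : 𝔼) :
    ∫ t : ℝ, (f (x + t • EuclideanSpace.single i (1 : ℝ)) -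
      lineMean ρ c i f (x + t • EuclideanSpace.single i (1 : ℝ))) = 0 := by
  set e : 𝔼 := EuclideanSpace.single i 1 with hedef
  have he : ‖e‖ = 1 := by simp [e]
  have hi : MeasureTheory.Integrable fun t : ℝ => f (x + t • e) := by
    refine (hf.continuous.comp (by fun_prop)).integrable_of_hasCompactSupport ?_
    refine hc.comp_isClosedEmbedding (g := fun t : ℝ => x + t • e) ?_
    refine Isometry.isClosedEmbedding (Isometry.of_dist_eq fun s t => ?_)
    simp [dist_eq_norm, ← sub_smul, norm_smul, he]
  have e1 : ∀ t : ℝ, lineMean ρ c i f (x + t • e) = ρ (x i - c i + t) * ∫ s : ℝ, f (x + s • e) := by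
    intro t
    rw [lineMean]
    congr 1
    · congr 1
      simp [e]; ring
    · simp only [← hedef, add_assoc, ← add_smul]
      exact MeasureTheory.integral_add_left_eq_self (fun s : ℝ => f (x + s • e)) t
  simp only [e1]
  have hi' : MeasureTheory.Integrable fun t : ℝ => ρ (x i - c i + t) :=
    (hρ0.integrable_of_hasCompactSupport hρc).comp_add_left _
  rw [MeasureTheory.integral_sub hi (hi'.mul_const _), MeasureTheory.integral_mul_const,
    MeasureTheory.integral_add_left_eq_self ρ (x i - c i), hρ1, one_mul, sub_self]

/-- The divergence equation in a cube, reduced to functions separated in the coordinates of `S`,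
with bounds in all Hölder spaces without loss of derivatives. -/
lemma exists_div_operator_separated (hρ0 : ContDiff ℝ ∞ ρ) (hρ : ∀ t, a < |t| → ρ t = 0)
    (hρ1 : ∫ t, ρ t = 1) (S : Finset (Fin n)) :
    ∃ (V : (𝔼 → ℝ) → 𝔼 → 𝔼) (T : (𝔼 → ℝ) → 𝔼 → ℝ),
      (∀ f, (∀ x ∉ cube c a, f x = 0) → ContDiff ℝ 1 f → (∀ x ∉ cube c a, V f x = 0) ∧
        (∀ x ∉ cube c a, T f x = 0) ∧ IsSeparated ρ c S (T f) ∧ ∀ x, ediv (V f) x = f x - T f x) ∧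
      ∀ r : ℕ, 1 ≤ r → ∃ C, 0 ≤ C ∧ ∀ (α : ℝ≥0) (f : 𝔼 → ℝ) (N : ℝ), α ≤ 1 → 0 ≤ N →
        (∀ x ∉ cube c a, f x = 0) → BdOn univ r α f N →
        BdOn univ r α (V f) (C * N) ∧ BdOn univ r α (T f) (C * N) := by
  have hρc : HasCompactSupport ρ := HasCompactSupport.intro (isCompact_Icc (a := -a) (b := a))
    fun t ht => hρ t (not_le.1 fun h => ht (abs_le.1 h))
  induction S using Finset.induction_on with
  | empty =>
    refine ⟨fun _ _ => 0, fun f => f, fun f hf hf1 => ⟨fun _ _ => rfl, hf, ⟨f, by simp, by simp⟩,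
      fun x => by simp [ediv]⟩, fun r hr => ⟨1, zero_le_one, fun α f N hα hN hf hfb => ⟨?_, by simpa⟩⟩⟩
    refine ⟨contDiffOn_const, fun k hk x _ => ?_, fun x y _ => ?_⟩
    · rw [iteratedFDeriv_fun_zero]; simpa
    · simp only [iteratedFDeriv_fun_zero]
      simp; positivity
  | insert i S hi ih =>
    obtain ⟨V, T, H1, H2⟩ := ih
    -- The regularity of `V f` and `T f` is not part of the statement; it is read off from the
    -- quantitative bound with `r = 1`, `α = 0`.
    have hT1 : ∀ f, (∀ x ∉ cube c a, f x = 0) → ContDiff ℝ 1 f →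
        ContDiff ℝ 1 (V f) ∧ ContDiff ℝ 1 (T f) := fun f hf hf1 => by
      obtain ⟨C, -, HC⟩ := H2 1 le_rfl
      obtain ⟨N, hN, hb⟩ := exists_bdOn_of_hasCompactSupport (r := 1) (by exact_mod_cast hf1)
        (hasCompactSupport_of_cube hf)
      have := HC 0 f N zero_le_one hN hf hb
      exact ⟨this.1.contDiff_one le_rfl, this.2.contDiff_one le_rfl⟩
    have hg : ∀ f, (∀ x ∉ cube c a, f x = 0) → ContDiff ℝ 1 f →
        (∀ x ∉ cube c a, T f x - lineMean ρ c i (T f) x = 0) ∧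
        ∀ x, ∫ t : ℝ, (T f (x + t • EuclideanSpace.single i (1 : ℝ)) -
          lineMean ρ c i (T f) (x + t • EuclideanSpace.single i (1 : ℝ))) = 0 := fun f hf hf1 => by
      obtain ⟨-, h2, -, -⟩ := H1 f hf hf1
      refine ⟨fun x hx => by rw [h2 x hx, lineMean_eq_zero hρ h2 x hx, sub_zero], fun x => ?_⟩
      exact integral_sub_lineMean (hT1 f hf hf1).2 (hasCompactSupport_of_cube h2) hρ0.continuous
        hρc hρ1 x
    have hB : ∀ r : ℕ, 1 ≤ r → ∃ C, 0 ≤ C ∧ ∀ (α : ℝ≥0) (f : 𝔼 → ℝ) (N : ℝ), α ≤ 1 → 0 ≤ N →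
        (∀ x ∉ cube c a, f x = 0) → BdOn univ r α f N →
        BdOn univ r α (lineMean ρ c i (T f)) (C * N) ∧
        BdOn univ r α (fun x => T f x - lineMean ρ c i (T f) x) (C * N) ∧
        BdOn univ r α (linePrim i fun x => T f x - lineMean ρ c i (T f) x) (C * N) := by
      intro r hr
      obtain ⟨C, hC, HC⟩ := H2 r hr
      obtain ⟨C', hC', HC'⟩ := exists_bd_lineMean (c := c) hρ0 hρ i r
      obtain ⟨C'', hC'', HC''⟩ := exists_bd_linePrim c a i r
      refine ⟨C' * C + (C + C' * C) + C'' * (C + C' * C), by positivity,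
        fun α f N hα hN hf hfb => ?_⟩
      have hf1 : ContDiff ℝ 1 f := hfb.contDiff_one hr
      have h1 := (HC α f N hα hN hf hfb).2
      have h2 := HC' α _ _ hα (by positivity) (H1 f hf hf1).2.1 h1
      have h3 : BdOn univ r α (fun x => T f x - lineMean ρ c i (T f) x) (C * N + C' * (C * N)) := by
        simpa [sub_eq_add_neg] using h1.add isOpen_univ h2.neg
      have h4 := HC'' α _ _ hα (by positivity) (hg f hf hf1).1 (hg f hf hf1).2 h3
      have hp1 : 0 ≤ C' * C * N := by positivity
      have hp2 : 0 ≤ C * N := by positivity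
      have hp3 : 0 ≤ C'' * (C + C' * C) * N := by positivity
      exact ⟨h2.mono_const (by linarith), h3.mono_const (by linarith), h4.mono_const (by linarith)⟩
    -- The remainder `T f` is replaced by its line mean. The difference has zero integral on the
    -- lines, so its primitive is supported in the cube, and the primitive times the `i`-th basis
    -- vector has this difference as divergence.
    refine ⟨fun f x => V f x + linePrim i (fun x => T f x - lineMean ρ c i (T f) x) x •
      EuclideanSpace.single i (1 : ℝ), fun f => lineMean ρ c i (T f), fun f hf hf1 => ?_,
      fun r hr => ?_⟩
    · obtain ⟨h1, h2, h3, h4⟩ := H1 f hf hf1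
      refine ⟨fun x hx => ?_, lineMean_eq_zero hρ h2, h3.lineMean hi, fun x => ?_⟩
      · simp only
        rw [h1 x hx, linePrim_eq_zero (hg f hf hf1).1 (hg f hf hf1).2 x hx, zero_smul, add_zero]
      · obtain ⟨C, -, HC⟩ := hB 1 le_rfl
        obtain ⟨N, hN, hb⟩ := exists_bdOn_of_hasCompactSupport (r := 1) (by exact_mod_cast hf1)
          (hasCompactSupport_of_cube hf)
        obtain ⟨-, b2, b3⟩ := HC 0 f N zero_le_one hN hf hb
        have c2 : ContDiff ℝ 1 (fun x => T f x - lineMean ρ c i (T f) x) := b2.contDiff_one le_rfl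
        have c3 : Differentiable ℝ (linePrim i fun x => T f x - lineMean ρ c i (T f) x) :=
          ContDiff.differentiable (n := 1) (b3.contDiff_one le_rfl) (by simp)
        have hdV : Differentiable ℝ (V f) := (hT1 f hf hf1).1.differentiable (by simp)
        rw [ediv_add (hdV x) ((c3 x).smul_const _), h4]
        have key : ediv (fun x => linePrim i (fun x => T f x - lineMean ρ c i (T f) x) x •
            EuclideanSpace.single i (1 : ℝ)) x = T f x - lineMean ρ c i (T f) x := by
          rw [ediv, fderiv_smul_const (c3 x)]
          simp only [ContinuousLinearMap.smulRight_apply, PiLp.smul_apply, PiLp.single_apply, smul_eq_mul,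
            mul_ite, mul_one, mul_zero, Finset.sum_ite_eq', Finset.mem_univ, if_true]
          exact fderiv_linePrim_apply c2 (hasCompactSupport_of_cube (hg f hf hf1).1) c3 x
        rw [key]; ring
    · obtain ⟨C, hC, HC⟩ := H2 r hr
      obtain ⟨C', hC', HC'⟩ := hB r hr
      refine ⟨C + C', by positivity, fun α f N hα hN hf hfb => ?_⟩
      obtain ⟨b1, b2, b3⟩ := HC' α f N hα hN hf hfb
      have hp1 : 0 ≤ C * N := by positivity
      have hp2 : 0 ≤ C' * N := by positivity
      refine ⟨?_, b1.mono_const (by linarith)⟩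
      have := b3.clm_comp isOpen_univ ((ContinuousLinearMap.id ℝ ℝ).smulRight
        (EuclideanSpace.single i (1 : ℝ) : 𝔼))
      simp only [ContinuousLinearMap.norm_smulRight_apply, PiLp.norm_single, norm_one, mul_one,
        ContinuousLinearMap.norm_id, one_mul] at this
      refine ((HC α f N hα hN hf hfb).1.add isOpen_univ this).mono_const (by linarith)

/-- The divergence equation in a cube, with bounds in all Hölder spaces without loss of
derivatives. -/
theorem exists_cube_div_operator (c : 𝔼) (ha : 0 < a) :
    ∃ (B : 𝔼 → ℝ) (V : (𝔼 → ℝ) → 𝔼 → 𝔼), ContDiff ℝ ∞ B ∧ (∀ x ∉ cube c a, B x = 0) ∧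
      (∀ f, (∀ x ∉ cube c a, f x = 0) → ContDiff ℝ 1 f → (∀ x ∉ cube c a, V f x = 0) ∧
        ∀ x, ediv (V f) x = f x - (∫ y, f y) * B x) ∧
      ∀ r : ℕ, 1 ≤ r → ∃ C, 0 ≤ C ∧ ∀ (α : ℝ≥0) (f : 𝔼 → ℝ) (N : ℝ), α ≤ 1 → 0 ≤ N →
        (∀ x ∉ cube c a, f x = 0) → BdOn univ r α f N → BdOn univ r α (V f) (C * N) := by
  let ψ : ContDiffBump (0 : ℝ) := ⟨a / 2, a, by positivity, by linarith⟩
  set ρ := ψ.normed MeasureTheory.volume with hρdef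
  have hρ0 : ContDiff ℝ ∞ ρ := ψ.contDiff_normed
  have hρ : ∀ t, a < |t| → ρ t = 0 := fun t ht => by
    have : t ∉ Function.support ρ := by
      rw [hρdef, ψ.support_normed_eq]; simpa [ψ] using ht.le
    simpa using this
  obtain ⟨V, T, H1, H2⟩ := exists_div_operator_separated (c := c) hρ0 hρ ψ.integral_normed Finset.univ
  set B : 𝔼 → ℝ := fun x => ∏ i, ρ (x i - c i) with hBdef
  have hB : ContDiff ℝ ∞ B := contDiff_prod fun i _ => hρ0.comp (by fun_prop)
  have hB0 : ∀ x ∉ cube c a, B x = 0 := fun x hx => by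
    simp only [cube, mem_ofPred_eq, not_forall, not_le] at hx
    obtain ⟨i, hi⟩ := hx
    exact Finset.prod_eq_zero (Finset.mem_univ i) (hρ _ hi)
  have hBi : MeasureTheory.Integrable B :=
    hB.continuous.integrable_of_hasCompactSupport (hasCompactSupport_of_cube hB0)
  -- Separated in all coordinates, the remainder is a multiple `m` of `B`; integrating `ediv (V f) =
  -- f - m B` over the space identifies `m`.
  have key : ∀ f, (∀ x ∉ cube c a, f x = 0) → ContDiff ℝ 1 f →
      ∃ m, (∀ x, T f x = m * B x) ∧ ∫ y, f y = m * ∫ y, B y := by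
    intro f hf hf1
    obtain ⟨h1, h2, h3, h4⟩ := H1 f hf hf1
    obtain ⟨m, hm⟩ := h3.exists_eq_const_mul
    refine ⟨m, hm, ?_⟩
    obtain ⟨C, -, HC⟩ := H2 1 le_rfl
    obtain ⟨N, hN, hb⟩ := exists_bdOn_of_hasCompactSupport (r := 1) (by exact_mod_cast hf1)
      (hasCompactSupport_of_cube hf)
    have hV : ContDiff ℝ 1 (V f) := (HC 0 f N zero_le_one hN hf hb).1.contDiff_one le_rfl
    have h0 := integral_ediv_eq_zero hV (hasCompactSupport_of_cube h1)
    simp only [h4, hm] at h0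
    rw [MeasureTheory.integral_sub
      (hf1.continuous.integrable_of_hasCompactSupport (hasCompactSupport_of_cube hf))
      (hBi.const_mul m), MeasureTheory.integral_const_mul] at h0
    linarith
  -- Applying `key` to a bump of integral one shows `1 = m ∫ B`, so no Fubini computation is needed.
  have hBne : ∫ y, B y ≠ 0 := by
    let φ : ContDiffBump c := ⟨a / 2, a, by positivity, by linarith⟩
    obtain ⟨m, -, hm⟩ := key (φ.normed MeasureTheory.volume) (fun x hx => by
      have : x ∉ Function.support (φ.normed MeasureTheory.volume) := by
        rw [φ.support_normed_eq]
        intro h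
        refine hx fun i => (PiLp.norm_apply_le (x - c) i).trans ?_
        simpa [dist_eq_norm] using (Metric.mem_ball.1 h).le
      simpa using this) (φ.contDiff_normed (n := 1))
    rw [φ.integral_normed] at hm
    intro h
    simp [h] at hm
  refine ⟨fun x => (∫ y, B y)⁻¹ * B x, V, contDiff_const.mul hB, fun x hx => by simp [hB0 x hx],
    fun f hf hf1 => ⟨(H1 f hf hf1).1, fun x => ?_⟩, fun r hr => ?_⟩
  · obtain ⟨m, hm1, hm2⟩ := key f hf hf1
    rw [(H1 f hf hf1).2.2.2, hm1, hm2]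
    field_simp
  · obtain ⟨C, hC, HC⟩ := H2 r hr
    exact ⟨C, hC, fun α f N hα hN hf hb => (HC α f N hα hN hf hb).1⟩

end Cube
-- Divergence-preserving mollification at variable scale.
section Mollify

variable {n : ℕ}

local notation "𝔼" => EuclideanSpace ℝ (Fin n)

/-- The action on vectors of the pull-back, at `x`, of `(n-1)`-forms by `x ↦ x + ε b(x) y`. -/
noncomputable def pullKer (b : EuclideanSpace ℝ (Fin n) → ℝ) (ε : ℝ)
    (x y : EuclideanSpace ℝ (Fin n)) :
    EuclideanSpace ℝ (Fin n) →L[ℝ] EuclideanSpace ℝ (Fin n) :=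
  (1 + ε * fderiv ℝ b x y) • ContinuousLinearMap.id ℝ (EuclideanSpace ℝ (Fin n)) -
    ε • (fderiv ℝ b x).smulRight y

/-- Divergence-preserving mollification at the variable scale `ε b(x)`. -/
noncomputable def mollify (b η : EuclideanSpace ℝ (Fin n) → ℝ)
    (w : EuclideanSpace ℝ (Fin n) → EuclideanSpace ℝ (Fin n)) (ε : ℝ)
    (x : EuclideanSpace ℝ (Fin n)) : EuclideanSpace ℝ (Fin n) :=
  ∫ y, η y • pullKer b ε x y (w (x + (ε * b x) • y))

lemma sum_apply_mul_eq (L : 𝔼 →L[ℝ] ℝ) (z : 𝔼) :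
    ∑ i, L (EuclideanSpace.single i (1 : ℝ)) * z i = L z := by
  have h := (EuclideanSpace.basisFun (Fin n) ℝ).sum_repr z
  conv_rhs => rw [← h]
  simp [mul_comm]

/-- Pulling back `(n-1)`-forms by a map multiplies the divergence by the Jacobian. -/
lemma ediv_pullKer {b : 𝔼 → ℝ} (hb : ContDiff ℝ ∞ b) {w : 𝔼 → 𝔼} {ε : ℝ} {x y : 𝔼}
    (hw : DifferentiableAt ℝ w (x + (ε * b x) • y)) :
    ediv (fun x => pullKer b ε x y (w (x + (ε * b x) • y))) x =
      (1 + ε * fderiv ℝ b x y) * ediv w (x + (ε * b x) • y) := by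
  set p := x + (ε * b x) • y with hp
  set B := fderiv ℝ b x with hB
  set H := fderiv ℝ (fderiv ℝ b) x with hH
  set W := fderiv ℝ w p with hW
  have hb' : ContDiff ℝ ∞ (fderiv ℝ b) := hb.fderiv_right (by simp)
  have d1 : HasFDerivAt b B x := (hb.differentiable (by simp) x).hasFDerivAt
  have d2 : HasFDerivAt (fderiv ℝ b) H x := (hb'.differentiable (by simp) x).hasFDerivAt
  have dσ : HasFDerivAt (fun x => x + (ε * b x) • y)
      (ContinuousLinearMap.id ℝ 𝔼 + (ε • B).smulRight y) x :=
    (hasFDerivAt_id x).add ((d1.const_mul ε).smul_const y)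
  have dw : HasFDerivAt (fun x => w (x + (ε * b x) • y))
      (W.comp (ContinuousLinearMap.id ℝ 𝔼 + (ε • B).smulRight y)) x :=
    HasFDerivAt.comp x (g := w) hw.hasFDerivAt dσ
  have dy : HasFDerivAt (fun x => fderiv ℝ b x y) (H.flip y) x := by
    simpa using d2.clm_apply (hasFDerivAt_const y x)
  have dB := d2.clm_apply dw
  have e : (fun x => pullKer b ε x y (w (x + (ε * b x) • y))) = fun x =>
      (1 + ε * fderiv ℝ b x y) • w (x + (ε * b x) • y) -
        (ε * fderiv ℝ b x (w (x + (ε * b x) • y))) • y := by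
    ext x; simp [pullKer, mul_smul]
  have hd := (((dy.const_mul ε).const_add 1).smul dw).sub ((dB.const_mul ε).smul_const y)
  -- Two terms contain the Hessian of `b`, with opposite signs and exchanged arguments; its symmetry
  -- makes them cancel. This is the coordinate form of `d` commuting with pull-backs.
  have hsymm : ∀ u v, H u v = H v u :=
    (hb.contDiffAt (x := x)).isSymmSndFDerivAt
      (by simp only [minSmoothness_of_isRCLikeNormedField]; exact WithTop.coe_le_coe.2 le_top)
  have hd' : fderiv ℝ (fun x => (1 + ε * fderiv ℝ b x y) • w (x + (ε * b x) • y) -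
        (ε * fderiv ℝ b x (w (x + (ε * b x) • y))) • y) x = _ := hd.fderiv
  rw [ediv, e, hd']
  have t1 := sum_apply_mul_eq B (W y)
  have t2 := sum_apply_mul_eq (H.flip y) (w p)
  have t3 := sum_apply_mul_eq (H.flip (w p)) y
  have t4 := sum_apply_mul_eq (B.comp W) y
  have t5 := sum_apply_mul_eq B y
  simp only [ContinuousLinearMap.flip_apply, ContinuousLinearMap.comp_apply] at t2 t3 t4
  have term : ∀ i, (((1 + ε * fderiv ℝ b x y) • W.comp
        (ContinuousLinearMap.id ℝ 𝔼 + (ε • B).smulRight y) +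
        (ε • H.flip y).smulRight (w (x + (ε * b x) • y)) -
      (ε • ((fderiv ℝ b x).comp (W.comp (ContinuousLinearMap.id ℝ 𝔼 + (ε • B).smulRight y)) +
              H.flip (w (x + (ε * b x) • y)))).smulRight y : 𝔼 →L[ℝ] 𝔼)
              (EuclideanSpace.single i (1 : ℝ))) i =
      (1 + ε * B y) * W (EuclideanSpace.single i (1 : ℝ)) i
      + (1 + ε * B y) * ε * (B (EuclideanSpace.single i (1 : ℝ)) * W y i)
      + ε * (H (EuclideanSpace.single i (1 : ℝ)) y * w p i)
      - ε * (B (W (EuclideanSpace.single i (1 : ℝ))) * y i)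
      - ε * ε * B (W y) * (B (EuclideanSpace.single i (1 : ℝ)) * y i)
      - ε * (H (EuclideanSpace.single i (1 : ℝ)) (w p) * y i) := by
    intro i
    simp only [sub_apply, add_apply, smul_apply, ContinuousLinearMap.smulRight_apply,
      ContinuousLinearMap.comp_apply, ContinuousLinearMap.flip_apply, ContinuousLinearMap.id_apply,
      PiLp.add_apply, PiLp.sub_apply, PiLp.smul_apply, smul_eq_mul, map_add, map_smul, ← hp, ← hB]
    ring
  rw [Finset.sum_congr rfl fun i _ => term i]
  simp only [Finset.sum_add_distrib, Finset.sum_sub_distrib, ← Finset.mul_sum]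
  rw [t1, t2, t3, t4, t5, hsymm (w p) y]
  change (1 + ε * B y) * ediv w p + _ + _ - _ - _ - _ = _
  ring

/-- Continuity in a parameter, uniformly in the other variables, for compactly supported
functions of class `C^m`. -/
lemma eventually_bdOn_sub {P F : Type} [NormedAddCommGroup P] [NormedSpace ℝ P]
    [NormedAddCommGroup F] [NormedSpace ℝ F] {m : ℕ} {H : P × ℝ → F} (hH : ContDiff ℝ m H)
    (hc : HasCompactSupport H) {τ : ℝ} (hτ : 0 < τ) :
    ∀ᶠ ε in 𝓝 (0 : ℝ), BdOn univ m 0 (fun x => H (x, ε) - H (x, 0)) τ := by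
  have base : ∀ {F : Type} [NormedAddCommGroup F] [NormedSpace ℝ F] {H : P × ℝ → F},
      Continuous H → HasCompactSupport H → ∀ τ > 0,
      ∀ᶠ ε in 𝓝 (0 : ℝ), ∀ x, ‖H (x, ε) - H (x, 0)‖ ≤ τ := by
    intro F _ _ H hH hc τ hτ
    obtain ⟨δ, hδ, h⟩ := Metric.uniformContinuous_iff.1
      (hc.uniformContinuous_of_continuous hH) τ hτ
    filter_upwards [Metric.ball_mem_nhds (0 : ℝ) hδ] with ε hε x
    have : dist (x, ε) (x, (0 : ℝ)) < δ := by simpa [Prod.dist_eq, hδ] using hε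
    exact (dist_eq_norm (H (x, ε)) _ ▸ h this).le
  induction m generalizing F τ with
  | zero =>
    filter_upwards [base hH.continuous hc (τ / 2) (by positivity)] with ε hε
    have h1 : ∀ ε : ℝ, Continuous fun x => H (x, ε) := fun ε =>
      hH.continuous.comp (Continuous.prodMk_left ε)
    refine bdOn_zero_iff.2 ⟨((h1 ε).sub (h1 0)).continuousOn,
      fun x _ => (hε x).trans (by linarith), fun x y _ => ?_⟩
    simp only [NNReal.coe_zero, Real.rpow_zero, mul_one]
    exact (norm_sub_le _ _).trans (by linarith [hε x, hε y])
  | succ m ih =>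
    have hd : Differentiable ℝ H := hH.differentiable (by simp)
    let H' : P × ℝ → (P →L[ℝ] F) := fun z => (fderiv ℝ H z).comp (ContinuousLinearMap.inl ℝ P ℝ)
    have hH' : ContDiff ℝ m H' := (hH.fderiv_right (m := m) (by norm_cast)).clm_comp contDiff_const
    have hc' : HasCompactSupport H' := (hc.fderiv ℝ).mono fun x hx hx' => hx (by simp [H', hx'])
    have hs : ∀ x ε, HasFDerivAt (fun x => H (x, ε)) (H' (x, ε)) x := fun x ε =>
      (hd (x, ε)).hasFDerivAt.comp x (hasFDerivAt_prodMk_left x ε)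
    filter_upwards [base hH.continuous hc τ hτ, ih hH' hc' hτ] with ε h1 h2
    refine (bdOn_succ_iff isOpen_univ).2 ⟨fun x _ =>
      ((hs x ε).sub (hs x 0)).differentiableAt.differentiableWithinAt, fun x _ => h1 x, ?_⟩
    have : fderiv ℝ (fun x => H (x, ε) - H (x, 0)) = fun x => H' (x, ε) - H' (x, 0) :=
      funext fun x => ((hs x ε).sub (hs x 0)).fderiv
    rw [this]; exact h2

/-- Interpolation between a Hölder bound and a small uniform bound. -/
lemma exists_bdOn_interpolate {E F : Type} [NormedAddCommGroup E] [NormedSpace ℝ E]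
    [NormedAddCommGroup F] [NormedSpace ℝ F] {α β : ℝ≥0} (hαβ : α < β) (m : ℕ) {N τ : ℝ}
    (hN : 0 ≤ N) (hτ : 0 < τ) : ∃ τ' > 0, ∀ f : E → F, BdOn univ m β f N → BdOn univ m 0 f τ' →
      BdOn univ m α f τ := by
  have hαβ' : (0 : ℝ) < β - α := sub_pos.2 (by exact_mod_cast hαβ)
  -- Below the distance `δ` the surplus factor `‖x - y‖ ^ (β - α)` brings `N` down to `τ`; above it,
  -- the small uniform bound is already at most `τ ‖x - y‖ ^ α`.
  set δ := (τ / (N + 1)) ^ ((β - α : ℝ)⁻¹) with hδdef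
  have hδ : 0 < δ := by positivity
  have hδ' : N * δ ^ (β - α : ℝ) ≤ τ := by
    rw [hδdef, Real.rpow_inv_rpow (by positivity) hαβ'.ne', mul_div_assoc', div_le_iff₀ (by positivity)]
    nlinarith
  refine ⟨min τ (τ * δ ^ (α : ℝ)), by positivity, fun f h1 h2 => ⟨h1.1, fun k hk x hx =>
    (h2.2 k hk x hx).trans (min_le_left _ _), fun x y hxy => ?_⟩⟩
  rcases eq_or_ne x y with rfl | hne
  · simp; positivity
  have hd : 0 < ‖x - y‖ := norm_pos_iff.2 (sub_ne_zero.2 hne)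
  rcases le_total ‖x - y‖ δ with h | h
  · refine (h1.3 x y hxy).trans ?_
    calc N * ‖x - y‖ ^ (β : ℝ) = N * ‖x - y‖ ^ (β - α : ℝ) * ‖x - y‖ ^ (α : ℝ) := by
          rw [mul_assoc, ← Real.rpow_add hd, sub_add_cancel]
      _ ≤ N * δ ^ (β - α : ℝ) * ‖x - y‖ ^ (α : ℝ) := by gcongr
      _ ≤ _ := by gcongr
  · refine (h2.3 x y hxy).trans ?_
    simp only [NNReal.coe_zero, Real.rpow_zero, mul_one]
    exact (min_le_right _ _).trans (by gcongr)

variable {b η χ : EuclideanSpace ℝ (Fin n) → ℝ} {ζ : ℝ → ℝ}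
  {w : EuclideanSpace ℝ (Fin n) → EuclideanSpace ℝ (Fin n)}

lemma contDiff_pullKer (hb : ContDiff ℝ ∞ b) {P : Type} [NormedAddCommGroup P] [NormedSpace ℝ P]
    {e : P → ℝ} {f g : P → 𝔼} (he : ContDiff ℝ ∞ e) (hf : ContDiff ℝ ∞ f) (hg : ContDiff ℝ ∞ g) :
    ContDiff ℝ ∞ fun z => pullKer b (e z) (f z) (g z) := by
  have hb' : ContDiff ℝ ∞ fun z => fderiv ℝ b (f z) := (hb.fderiv_right (by simp)).comp hf
  exact ((contDiff_const.add (he.mul (hb'.clm_apply hg))).smul contDiff_const).sub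
    (he.smul (hb'.smulRight hg))

/-- Joint Hölder bounds for the mollified field, in the point and the scale. -/
lemma exists_bd_mollify (hb : ContDiff ℝ ∞ b) (hη : ContDiff ℝ ∞ η) (hηc : HasCompactSupport η)
    (hζ : ContDiff ℝ ∞ ζ) (hζc : HasCompactSupport ζ) (hχ : ContDiff ℝ ∞ χ)
    (hχc : HasCompactSupport χ) (r : ℕ) :
    ∃ C, 0 ≤ C ∧ ∀ (α : ℝ≥0) (w : 𝔼 → 𝔼) (N : ℝ), α ≤ 1 → 0 ≤ N → BdOn univ r α w N →
      BdOn univ r α (fun p : 𝔼 × ℝ => (ζ p.2 * χ p.1) • mollify b η w p.2 p.1) (C * N) := by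
  -- The scale is treated as one more variable of the function, so that convergence as `ε → 0` will
  -- follow from uniform continuity (`eventually_bdOn_sub`).
  let a : (𝔼 × ℝ) × 𝔼 → (𝔼 →L[ℝ] 𝔼) := fun z =>
    (ζ z.1.2 * χ z.1.1 * η z.2) • pullKer b z.1.2 z.1.1 z.2
  have ha : ContDiff ℝ ∞ a := by
    have h0 : ContDiff ℝ ∞ fun z : (𝔼 × ℝ) × 𝔼 => ζ z.1.2 * χ z.1.1 * η z.2 :=
      ((hζ.comp (by fun_prop)).mul (hχ.comp (by fun_prop))).mul (hη.comp (by fun_prop))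
    exact h0.smul (contDiff_pullKer hb contDiff_fst.snd contDiff_fst.fst contDiff_snd)
  have hac : HasCompactSupport a :=
    HasCompactSupport.intro ((hχc.isCompact.prod hζc.isCompact).prod hηc.isCompact) fun z hz => by
      have : ζ z.1.2 * χ z.1.1 * η z.2 = 0 := by
        by_contra h
        simp only [mul_eq_zero, not_or] at h
        exact hz ⟨⟨subset_tsupport _ h.1.2, subset_tsupport _ h.1.1⟩, subset_tsupport _ h.2⟩
      ext v : 1
      simp [a, this]
  obtain ⟨C, hC, H⟩ := exists_bd_mul_comp (F := 𝔼) (F' := 𝔼) r isOpen_univ ha hac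
    (σ := fun z => z.1.1 + (z.1.2 * b z.1.1) • z.2) isOpen_univ (subset_univ _)
    (ContDiff.contDiffOn (contDiff_fst.fst.add
      ((contDiff_fst.snd.mul (hb.comp contDiff_fst.fst)).smul contDiff_snd)))
    (fun _ _ => trivial)
  have : MeasureTheory.IsFiniteMeasure ((MeasureTheory.volume : MeasureTheory.Measure 𝔼).restrict
    (tsupport η)) := ⟨by simpa using hηc.isCompact.measure_lt_top⟩
  refine ⟨((MeasureTheory.volume : MeasureTheory.Measure 𝔼).restrict (tsupport η)).real univ * C,
    by positivity, fun α w N hα hN hw => ?_⟩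
  rw [mul_assoc]
  refine ((H α w N hα hN hw).integral (MeasureTheory.volume.restrict (tsupport η))
    (by positivity)).congr isOpen_univ fun p _ => ?_
  simp only [mollify, a, smul_apply, mul_smul, ← MeasureTheory.integral_smul]
  refine (MeasureTheory.setIntegral_eq_integral_of_forall_compl_eq_zero fun y hy => ?_).symm
  rw [image_eq_zero_of_notMem_tsupport hy]; simp

/-- A zero of the nonnegative `b` is a minimum, so `db` vanishes there too and the pull-back kernel
is the identity. -/
lemma mollify_eq_of_eq_zero (hb0 : ∀ x, 0 ≤ b x) (hη1 : ∫ y, η y = 1) {ε : ℝ} {x : 𝔼}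
    (hx : b x = 0) : mollify b η w ε x = w x := by
  have hd : fderiv ℝ b x = 0 :=
    IsLocalMin.fderiv_eq_zero (.of_forall fun y => by rw [hx]; exact hb0 y)
  simp only [mollify, pullKer, hx, hd]
  simp [integral_smul_const, hη1]

/-- The trace on endomorphisms of Euclidean space. -/
noncomputable def etrace (n : ℕ) :
    (EuclideanSpace ℝ (Fin n) →L[ℝ] EuclideanSpace ℝ (Fin n)) →L[ℝ] ℝ :=
  ∑ i, (EuclideanSpace.proj (𝕜 := ℝ) i).comp
    (ContinuousLinearMap.apply ℝ (EuclideanSpace ℝ (Fin n)) (EuclideanSpace.single i (1 : ℝ)))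

lemma etrace_apply (L : 𝔼 →L[ℝ] 𝔼) :
    etrace n L = ∑ i, L (EuclideanSpace.single i (1 : ℝ)) i := by
  simp [etrace]

lemma ediv_eq_etrace (f : 𝔼 → 𝔼) (x : 𝔼) : ediv f x = etrace n (fderiv ℝ f x) :=
  (etrace_apply _).symm

/-- Differentiation under the integral reduces to a fixed `y`, where `ediv_pullKer` gives a Jacobian
times the divergence of `w` at the displaced point. The cut-off `χ` near `x` only serves to make the
integrand globally bounded. -/
lemma ediv_mollify (hb : ContDiff ℝ ∞ b) (hη : ContDiff ℝ ∞ η) (hηc : HasCompactSupport η)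
    (hw : ContDiff ℝ 1 w) (hwc : HasCompactSupport w) {ε : ℝ} {x : 𝔼}
    (hdiv : ∀ y ∈ tsupport η, ediv w (x + (ε * b x) • y) = 0) :
    ediv (mollify b η w ε) x = 0 := by
  obtain ⟨χ, hχ, hχc, -, hχ1, -⟩ := exists_cutoff (isCompact_singleton (x := x)) isOpen_univ
    (subset_univ _)
  rw [nhdsSet_singleton] at hχ1
  let a : 𝔼 × 𝔼 → (𝔼 →L[ℝ] 𝔼) := fun z => (χ z.1 * η z.2) • pullKer b ε z.1 z.2
  have ha : ContDiff ℝ ∞ a := by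
    have h0 : ContDiff ℝ ∞ fun z : 𝔼 × 𝔼 => χ z.1 * η z.2 :=
      (hχ.comp (by fun_prop)).mul (hη.comp (by fun_prop))
    exact h0.smul (contDiff_pullKer hb contDiff_const contDiff_fst contDiff_snd)
  have hac : HasCompactSupport a :=
    HasCompactSupport.intro (hχc.isCompact.prod hηc.isCompact) fun z hz => by
      have : χ z.1 * η z.2 = 0 := by
        by_contra h
        simp only [mul_eq_zero, not_or] at h
        exact hz ⟨subset_tsupport _ h.1, subset_tsupport _ h.2⟩
      ext v : 1
      simp [a, this]
  have hσ : ContDiff ℝ ∞ fun z : 𝔼 × 𝔼 => z.1 + (ε * b z.1) • z.2 := contDiff_fst.add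
      ((contDiff_const.mul (hb.comp contDiff_fst)).smul contDiff_snd)
  obtain ⟨C, hC, H⟩ := exists_bd_mul_comp (F := 𝔼) (F' := 𝔼) 1 isOpen_univ ha hac
    (σ := fun z => z.1 + (ε * b z.1) • z.2) isOpen_univ (subset_univ _) hσ.contDiffOn
    (fun _ _ => trivial)
  obtain ⟨N, hN, hbw⟩ := exists_bdOn_of_hasCompactSupport (r := 1) (by exact_mod_cast hw) hwc
  have hB := H 0 w N zero_le_one hN hbw
  have : MeasureTheory.IsFiniteMeasure ((MeasureTheory.volume : MeasureTheory.Measure 𝔼).restrict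
    (tsupport η)) := ⟨by simpa using hηc.isCompact.measure_lt_top⟩
  have hB1 : ContDiff ℝ 1 (fun z : 𝔼 × 𝔼 => a z (w (z.1 + (ε * b z.1) • z.2))) :=
    hB.contDiff_one le_rfl
  have hB' := ((bdOn_succ_iff isOpen_univ).1 hB).2.2
  have hd := hasFDerivAt_integral_prodMk
    ((MeasureTheory.volume : MeasureTheory.Measure 𝔼).restrict (tsupport η)) hB1
    (fun z => hB.norm_le (mem_univ z)) (fun z => hB'.norm_le (mem_univ z)) x
  have hm : mollify b η w ε =ᶠ[𝓝 x] fun p => ∫ y in tsupport η, a (p, y)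
      (w (p + (ε * b p) • y)) := by
    filter_upwards [hχ1] with p hp
    simp only [mollify, a, smul_apply, mul_smul, hp, one_smul]
    refine (MeasureTheory.setIntegral_eq_integral_of_forall_compl_eq_zero fun y hy => ?_).symm
    rw [image_eq_zero_of_notMem_tsupport hy]; simp
  rw [ediv_congr hm, ediv_eq_etrace, hd.fderiv, ← ContinuousLinearMap.integral_comp_comm]
  · refine MeasureTheory.setIntegral_eq_zero_of_forall_eq_zero fun y hy => ?_
    have hs : HasFDerivAt (fun p => a (p, y) (w (p + (ε * b p) • y))) _ x :=
      HasFDerivAt.comp (g := fun z : 𝔼 × 𝔼 => a z (w (z.1 + (ε * b z.1) • z.2)))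
        (f := fun p => (p, y)) x
        ((hB1.differentiable (by simp)) (x, y)).hasFDerivAt (hasFDerivAt_prodMk_left x y)
    rw [← hs.fderiv, ← ediv_eq_etrace]
    have hc : (fun p => a (p, y) (w (p + (ε * b p) • y))) =ᶠ[𝓝 x] fun p =>
        η y • pullKer b ε p y (w (p + (ε * b p) • y)) := by
      filter_upwards [hχ1] with p hp
      simp only [a, smul_apply, hp, one_mul]
    have hdk : DifferentiableAt ℝ (fun p => pullKer b ε p y (w (p + (ε * b p) • y))) x := by
      have h1 := (contDiff_pullKer hb (contDiff_const (c := ε)) contDiff_id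
        (contDiff_const (c := y))).differentiable (by simp) x
      have h2 := (hw.comp ((hσ.of_le (by simp)).comp (contDiff_id.prodMk
        (contDiff_const (c := y))))).differentiable (by simp) x
      exact h1.clm_apply h2
    rw [ediv_congr hc, ediv_eq_etrace, fderiv_fun_const_smul hdk, map_smul, ← ediv_eq_etrace,
      ediv_pullKer hb (hw.differentiable (by simp) _), hdiv y hy, mul_zero, smul_zero]
  · refine MeasureTheory.Integrable.of_bound (C := C * N * 1) ?_ (.of_forall fun y => ?_)
    · exact ((((hB1.continuous_fderiv (by simp)).comp (Continuous.prodMk_right x)).clm_comp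
        continuous_const).aestronglyMeasurable)
    · refine (ContinuousLinearMap.opNorm_comp_le _ _).trans ?_
      gcongr
      · exact hB'.norm_le (mem_univ _)
      · exact ContinuousLinearMap.norm_inl_le_one ℝ _ _

/-- The mollified field is smooth where the scale is positive. -/
lemma contDiffAt_mollify_of_pos (hb : ContDiff ℝ ∞ b) (hbc : HasCompactSupport b)
    (hη : ContDiff ℝ ∞ η) (hηs : ∀ y, 1 < ‖y‖ → η y = 0) (hw : Continuous w) {ε : ℝ} (hε : 0 < ε)
    {x : 𝔼} (hx : 0 < b x) : ContDiffAt ℝ ∞ (mollify b η w ε) x := by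
  obtain ⟨R, hR⟩ := hbc.exists_bound_of_continuous hb.continuous
  let s : Set 𝔼 := {p | 0 < b p}
  have hs : IsOpen s := isOpen_lt continuous_const hb.continuous
  let T : 𝔼 → ℝ := fun p => ε * b p
  have hT : ∀ p ∈ s, 0 < T p := fun p hp => mul_pos hε hp
  have hTd : ContDiff ℝ ∞ T := contDiff_const.mul hb
  -- The substitution `u = -(T p) • y` moves the whole dependence on `p` from `w` into a kernel that
  -- is smooth where `T p > 0`. The result is a parametrised convolution, for which continuity of
  -- `w` is enough.
  let g : 𝔼 → 𝔼 → (𝔼 →L[ℝ] 𝔼) := fun p u =>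
    (((T p) ^ (Module.finrank ℝ 𝔼))⁻¹ * η (-(T p)⁻¹ • u)) • pullKer b ε p (-(T p)⁻¹ • u)
  have hTs : ContDiffOn ℝ ∞ (fun z : 𝔼 × 𝔼 => (T z.1)⁻¹) (s ×ˢ univ) :=
    (hTd.comp contDiff_fst).contDiffOn.inv fun z hz => (hT _ hz.1).ne'
  have hu : ContDiffOn ℝ ∞ (fun z : 𝔼 × 𝔼 => -(T z.1)⁻¹ • z.2) (s ×ˢ univ) :=
    hTs.neg.smul contDiff_snd.contDiffOn
  have hg : ContDiffOn ℝ ∞ (Function.uncurry g) (s ×ˢ univ) := by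
    have h0 : ContDiffOn ℝ ∞ (fun z : 𝔼 × 𝔼 => ((T z.1) ^ (Module.finrank ℝ 𝔼))⁻¹ *
        η (-(T z.1)⁻¹ • z.2)) (s ×ˢ univ) := by
      refine ContDiffOn.mul ?_ (hη.comp_contDiffOn hu)
      simp only [← inv_pow]
      exact hTs.pow _
    have h1 : ContDiff ℝ ∞ fun q : 𝔼 × 𝔼 => pullKer b ε q.1 q.2 :=
      contDiff_pullKer hb contDiff_const contDiff_fst contDiff_snd
    have h2 : ContDiffOn ℝ ∞ (fun z : 𝔼 × 𝔼 => pullKer b ε z.1 (-(T z.1)⁻¹ • z.2)) (s ×ˢ univ) :=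
      h1.comp_contDiffOn (f := fun z : 𝔼 × 𝔼 => (z.1, -(T z.1)⁻¹ • z.2))
        (contDiff_fst.contDiffOn.prodMk hu)
    have h3 : Function.uncurry g = fun z : 𝔼 × 𝔼 => (((T z.1) ^ (Module.finrank ℝ 𝔼))⁻¹ *
        η (-(T z.1)⁻¹ • z.2)) • pullKer b ε z.1 (-(T z.1)⁻¹ • z.2) := rfl
    rw [h3]
    exact h0.smul h2
  have hgs : ∀ p, ∀ u, p ∈ s → u ∉ Metric.closedBall 0 (ε * R) → g p u = 0 := by
    intro p u hp hu
    have h1 : η (-(T p)⁻¹ • u) = 0 := by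
      apply hηs
      rw [norm_smul, norm_neg, norm_inv, Real.norm_of_nonneg (hT p hp).le, inv_mul_eq_div,
        lt_div_iff₀ (hT p hp), one_mul]
      simp only [Metric.mem_closedBall, dist_zero_right, not_le] at hu
      refine lt_of_le_of_lt ?_ hu
      exact mul_le_mul_of_nonneg_left ((le_abs_self _).trans (hR p)) hε.le
    ext v : 1
    simp only [g, h1, mul_zero, smul_apply, zero_smul, zero_apply]
  obtain ⟨L, hL⟩ : ∃ L : 𝔼 →L[ℝ] (𝔼 →L[ℝ] 𝔼) →L[ℝ] 𝔼, ∀ v A, L v A = A v :=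
    ⟨ContinuousLinearMap.apply ℝ 𝔼, fun v A => rfl⟩
  have hv : ContDiffOn ℝ ((⊤ : ℕ∞) : ℕ∞ω) (fun p : 𝔼 => p) s := contDiffOn_id
  have key := MeasureTheory.contDiffOn_convolution_right_with_param_comp (μ := MeasureTheory.volume)
    L hv hs (isCompact_closedBall _ _) hgs hw.locallyIntegrable hg
  refine (key.congr fun p hp => ?_).contDiffAt (hs.mem_nhds hx)
  let k : 𝔼 → 𝔼 := fun z => η ((T p)⁻¹ • (z - p)) • pullKer b ε p ((T p)⁻¹ • (z - p)) (w z)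
  have e1 : mollify b η w ε p = ∫ y, k (p + T p • y) := by
    simp only [mollify, k, add_sub_cancel_left, inv_smul_smul₀ (hT p hp).ne', T]
  rw [e1, MeasureTheory.Measure.integral_comp_smul_of_nonneg MeasureTheory.volume
    (fun z => k (p + z)) (T p) (hR := (hT p hp).le), MeasureTheory.integral_add_left_eq_self k p,
    ← MeasureTheory.integral_smul]
  simp only [MeasureTheory.convolution_def]
  congr 1
  ext1 z
  have e2 : -(T p)⁻¹ • (p - z) = (T p)⁻¹ • (z - p) := by
    rw [neg_smul, ← smul_neg, neg_sub]
  simp only [g, k, hL, smul_apply, e2, mul_smul]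

/-- The mollified field is smooth at the points of zero scale where the field is smooth. -/
lemma contDiffAt_mollify_of_eq_zero (hb : ContDiff ℝ ∞ b)
    (hη : ContDiff ℝ ∞ η) (hηs : ∀ y, 1 < ‖y‖ → η y = 0) {ε : ℝ}
    {x : 𝔼} (hw : ContDiffAt ℝ ∞ w x) (hx : b x = 0) : ContDiffAt ℝ ∞ (mollify b η w ε) x := by
  rw [contDiffAt_infty] at hw ⊢
  intro m
  obtain ⟨u, hu, hwu⟩ := (hw m).contDiffOn le_rfl (by simp)
  obtain ⟨δ, hδ, hδu⟩ := Metric.mem_nhds_iff.1 hu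
  -- For `p` in `s` all points displaced by `‖u‖ < 2` lie where `w` is `C^m`; the kernel vanishes
  -- for `‖u‖ > 1`, so the two regions overlap. Here `w` stays inside the kernel, which is convolved
  -- with the constant 1.
  let s : Set 𝔼 := {p | ‖p - x‖ + 2 * ‖ε * b p‖ < δ}
  have hbcont : Continuous b := hb.continuous
  have hs : IsOpen s := isOpen_lt (by fun_prop) continuous_const
  have hxs : x ∈ s := by simpa [s, hx] using hδ
  let g : 𝔼 → 𝔼 → 𝔼 := fun p u => η (-u) • pullKer b ε p (-u) (w (p + (ε * b p) • (-u)))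
  have hη0 : ∀ u : 𝔼, 1 < ‖u‖ → η (-u) = 0 := fun u hu => hηs _ (by rwa [norm_neg])
  have hg : ContDiffOn ℝ m (Function.uncurry g) (s ×ˢ univ) := by
    rintro ⟨p, u⟩ ⟨hp, -⟩
    refine ContDiffAt.contDiffWithinAt ?_
    rcases lt_or_ge ‖u‖ 2 with h2 | h2
    · have hmem : p + (ε * b p) • (-u) ∈ Metric.ball x δ := by
        rw [Metric.mem_ball, dist_eq_norm, add_sub_right_comm]
        refine lt_of_le_of_lt (norm_add_le _ _) (lt_of_le_of_lt ?_ hp)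
        rw [norm_smul, norm_neg, mul_comm 2]
        gcongr
      have h3 : ContDiffAt ℝ m w (p + (ε * b p) • (-u)) :=
        hwu.contDiffAt (mem_of_superset (Metric.isOpen_ball.mem_nhds hmem) hδu)
      have h4 : ContDiff ℝ m fun z : 𝔼 × 𝔼 => z.1 + (ε * b z.1) • (-z.2) :=
        contDiff_fst.add ((contDiff_const.mul ((hb.of_le (by exact_mod_cast le_top)).comp
          contDiff_fst)).smul contDiff_snd.neg)
      have h5 : ContDiff ℝ m fun z : 𝔼 × 𝔼 => pullKer b ε z.1 (-z.2) :=
        (contDiff_pullKer hb contDiff_const contDiff_fst contDiff_snd.neg).of_le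
          (by exact_mod_cast le_top)
      have h6 : ContDiff ℝ m fun z : 𝔼 × 𝔼 => η (-z.2) :=
        (hη.of_le (by exact_mod_cast le_top)).comp contDiff_snd.neg
      have h7 : ContDiffAt ℝ m (fun z : 𝔼 × 𝔼 => w (z.1 + (ε * b z.1) • (-z.2))) (p, u) :=
        ContDiffAt.comp (p, u) (g := w) h3 h4.contDiffAt
      exact h6.contDiffAt.smul (h5.contDiffAt.clm_apply h7)
    · refine (contDiffAt_const (c := (0 : 𝔼))).congr_of_eventuallyEq ?_
      have : {z : 𝔼 × 𝔼 | 1 < ‖z.2‖} ∈ 𝓝 (p, u) :=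
        (isOpen_lt continuous_const (by fun_prop)).mem_nhds (by
          show 1 < ‖u‖
          linarith)
      filter_upwards [this] with z hz
      simp [Function.uncurry, g, hη0 z.2 hz]
  have hgs : ∀ p, ∀ u, p ∈ s → u ∉ Metric.closedBall 0 1 → g p u = 0 := by
    intro p u _ hu
    simp only [Metric.mem_closedBall, dist_zero_right, not_le] at hu
    simp [g, hη0 u hu]
  have hv : ContDiffOn ℝ (((m : ℕ) : ℕ∞) : ℕ∞ω) (fun _ : 𝔼 => (0 : 𝔼)) s := contDiffOn_const
  have key := MeasureTheory.contDiffOn_convolution_right_with_param_comp (μ := MeasureTheory.volume)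
    (ContinuousLinearMap.lsmul ℝ ℝ : ℝ →L[ℝ] 𝔼 →L[ℝ] 𝔼) hv hs (isCompact_closedBall _ _) hgs
    (f := fun _ => (1 : ℝ)) (MeasureTheory.locallyIntegrable_const _) hg
  refine (key.congr fun p hp => ?_).contDiffAt (hs.mem_nhds hxs)
  simp [mollify, MeasureTheory.convolution_def, g]

lemma contDiffAt_mollify (hb : ContDiff ℝ ∞ b) (hbc : HasCompactSupport b) (hb0 : ∀ x, 0 ≤ b x)
    (hη : ContDiff ℝ ∞ η) (hηs : ∀ y, 1 < ‖y‖ → η y = 0) (hw : Continuous w) {ε : ℝ} (hε : 0 < ε)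
    {x : 𝔼} (hx : 0 < b x ∨ ContDiffAt ℝ ∞ w x) : ContDiffAt ℝ ∞ (mollify b η w ε) x := by
  rcases (hb0 x).eq_or_lt with h | h
  · exact contDiffAt_mollify_of_eq_zero hb hη hηs (hx.resolve_left (by simp [← h])) h.symm
  · exact contDiffAt_mollify_of_pos hb hbc hη hηs hw hε h

/-- Regularization, near the positivity set of `b`, of a field that is divergence-free near the
support of `b`. -/
theorem exists_regularization (hb : ContDiff ℝ ∞ b) (hbc : HasCompactSupport b)
    (hb0 : ∀ x, 0 ≤ b x) (hw : ContDiff ℝ 1 w) (hwc : HasCompactSupport w) {O : Set 𝔼}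
    (hO : IsOpen O) (hbO : tsupport b ⊆ O) (hdiv : ∀ x ∈ O, ediv w x = 0) :
    ∃ d : ℝ → 𝔼 → 𝔼,
      (∀ ε x, b x = 0 → d ε x = 0) ∧
      (∀ᶠ ε in 𝓝[>] (0 : ℝ), (∀ x, ediv (d ε) x = 0) ∧
        (∀ x, 0 < b x ∨ ContDiffAt ℝ ∞ w x → ContDiffAt ℝ ∞ (fun x => w x + d ε x) x)) ∧
      (∀ (m : ℕ) (γ : ℝ≥0) (N : ℝ), γ ≤ 1 → 0 ≤ N → BdOn univ m γ w N →
        ∃ N', 0 ≤ N' ∧ ∀ᶠ ε in 𝓝[>] (0 : ℝ), BdOn univ m γ (d ε) N') ∧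
      (∀ m : ℕ, ContDiff ℝ m w → ∀ τ > 0, ∀ᶠ ε in 𝓝[>] (0 : ℝ), BdOn univ m 0 (d ε) τ) := by
  let φ : ContDiffBump (0 : 𝔼) := ⟨1 / 2, 1, by positivity, by norm_num⟩
  set η := φ.normed MeasureTheory.volume with hηdef
  have hη : ContDiff ℝ ∞ η := φ.contDiff_normed
  have hηt : tsupport η = Metric.closedBall 0 1 := φ.tsupport_normed_eq
  have hηc : HasCompactSupport η := φ.hasCompactSupport_normed
  have hη1 : ∫ y, η y = 1 := φ.integral_normed
  have hηs : ∀ y, 1 < ‖y‖ → η y = 0 := fun y hy =>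
    image_eq_zero_of_notMem_tsupport (by rw [hηt]; simpa using hy)
  obtain ⟨ζ, hζ, hζc, -, hζ1, -⟩ := exists_cutoff (isCompact_Icc (a := (-1 : ℝ)) (b := 1)) isOpen_univ
    (subset_univ _)
  obtain ⟨χ, hχ, hχc, -, hχ1, -⟩ := exists_cutoff hbc.isCompact isOpen_univ (subset_univ _)
  -- A compactly supported version of the mollified field. The perturbation `d ε` is `F (·, ε) - F
  -- (·, 0)` for small `ε`, as nothing changes off the support of `b`.
  let F : (𝔼 → 𝔼) → 𝔼 × ℝ → 𝔼 := fun w p => (ζ p.2 * χ p.1) • mollify b η w p.2 p.1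
  have hF : ∀ ε ∈ Icc (-1 : ℝ) 1, ∀ x, mollify b η w ε x - w x = F w (x, ε) - F w (x, 0) := by
    intro ε hε x
    have h0 : mollify b η w 0 x = w x := by
      simp only [mollify, pullKer]
      simp [integral_smul_const, hη1]
    simp only [F, hζ1.self_of_nhdsSet ε hε, hζ1.self_of_nhdsSet 0 (by simp), one_mul, h0,
      ← smul_sub]
    by_cases hx : x ∈ tsupport b
    · rw [hχ1.self_of_nhdsSet x hx, one_smul]
    · rw [mollify_eq_of_eq_zero hb0 hη1 (image_eq_zero_of_notMem_tsupport hx), sub_self, smul_zero]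
  have hFc : HasCompactSupport (F w) :=
    HasCompactSupport.intro (hχc.isCompact.prod hζc.isCompact) fun p hp => by
      have : ζ p.2 * χ p.1 = 0 := by
        by_contra h
        simp only [mul_eq_zero, not_or] at h
        exact hp ⟨subset_tsupport _ h.2, subset_tsupport _ h.1⟩
      simp [F, this]
  have hIcc : ∀ᶠ ε in 𝓝[>] (0 : ℝ), ε ∈ Icc (-1 : ℝ) 1 :=
    nhdsWithin_le_nhds (Icc_mem_nhds (by norm_num) (by norm_num))
  have hpos : ∀ᶠ ε in 𝓝[>] (0 : ℝ), 0 < ε := self_mem_nhdsWithin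
  have hFm : ∀ m : ℕ, ContDiff ℝ m w → ContDiff ℝ m (F w) := fun m hm => by
    obtain ⟨C, -, H⟩ := exists_bd_mollify hb hη hηc hζ hζc hχ hχc m
    obtain ⟨N, hN, hbw⟩ := exists_bdOn_of_hasCompactSupport hm hwc
    exact (H 0 w N zero_le_one hN hbw).contDiff
  have hsmall : ∀ m : ℕ, ContDiff ℝ m w → ∀ τ > 0,
      ∀ᶠ ε in 𝓝[>] (0 : ℝ), BdOn univ m 0 (fun x => mollify b η w ε x - w x) τ := by
    intro m hm τ hτ
    filter_upwards [nhdsWithin_le_nhds (eventually_bdOn_sub (hFm m hm) hFc hτ), hIcc] with ε h1 h2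
    exact h1.congr isOpen_univ fun x _ => hF ε h2 x
  refine ⟨fun ε x => mollify b η w ε x - w x, fun ε x hx => by
    simp only; rw [mollify_eq_of_eq_zero hb0 hη1 hx, sub_self], ?_, ?_, hsmall⟩
  · obtain ⟨δ, hδ, hδO⟩ := hbc.isCompact.exists_thickening_subset_open hO hbO
    obtain ⟨R, hR⟩ := hbc.exists_bound_of_continuous hb.continuous
    have hR0 : 0 ≤ R := (norm_nonneg _).trans (hR 0)
    -- For such `ε` the displacement of a point of the support of `b` is less than `δ`, so only
    -- values of `w` in `O`, where it is divergence-free, are averaged.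
    have hεR : ∀ᶠ ε in 𝓝[>] (0 : ℝ), ε * (R + 1) < δ := by
      refine nhdsWithin_le_nhds (ContinuousAt.eventually_lt ?_ continuousAt_const (by simpa))
      fun_prop
    filter_upwards [hIcc, hpos, hεR, hsmall 1 (by exact_mod_cast hw) 1 one_pos] with ε h1 h2 h3 h4
    have hd : Differentiable ℝ fun x => mollify b η w ε x - w x :=
      (h4.contDiff_one le_rfl).differentiable (by simp)
    have hdm : Differentiable ℝ (mollify b η w ε) := by
      have := hd.add (hw.differentiable (by simp))
      have e : ((fun x => mollify b η w ε x - w x) + w) = mollify b η w ε := by ext1 x; simp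
      rwa [e] at this
    refine ⟨fun x => ?_, fun x hx => ?_⟩
    · by_cases hx : x ∈ tsupport b
      · have e : ediv (fun x => mollify b η w ε x - w x) x =
            ediv (mollify b η w ε) x - ediv w x := by
          simp only [ediv_eq_etrace]
          rw [fderiv_fun_sub (hdm x) (hw.differentiable (by simp) x), map_sub]
        rw [e, hdiv x (hbO hx), sub_zero]
        refine ediv_mollify hb hη hηc hw hwc fun y hy => hdiv _ (hδO ?_)
        rw [Metric.mem_thickening_iff]
        refine ⟨x, hx, ?_⟩
        rw [hηt] at hy
        rw [dist_eq_norm, add_sub_cancel_left, norm_smul, norm_mul, Real.norm_of_nonneg h2.le]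
        refine lt_of_le_of_lt ?_ h3
        have hy' : ‖y‖ ≤ 1 := by simpa using hy
        calc ε * ‖b x‖ * ‖y‖ ≤ ε * R * 1 := by gcongr; exact hR x
          _ ≤ ε * (R + 1) := by nlinarith
      · rw [ediv_congr (g := fun _ => 0), ediv]
        · simp
        · filter_upwards [(isClosed_tsupport b).isOpen_compl.mem_nhds hx] with z hz
          rw [mollify_eq_of_eq_zero hb0 hη1 (image_eq_zero_of_notMem_tsupport hz), sub_self]
    · simp only [add_sub_cancel]
      exact contDiffAt_mollify hb hbc hb0 hη hηs hw.continuous h2 hx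
  · intro m γ N hγ hN hbw
    obtain ⟨C, hC, H⟩ := exists_bd_mollify hb hη hηc hζ hζc hχ hχc m
    have h := H γ w N hγ hN hbw
    -- The restriction to a slice is the average against a Dirac mass, so `BdOn.integral` applies.
    have hsl : ∀ ε, BdOn univ m γ (fun x => F w (x, ε)) (C * N) := fun ε => by
      have := h.integral (MeasureTheory.Measure.dirac ε) (by positivity)
      simpa using this
    refine ⟨C * N + C * N, by positivity, ?_⟩
    filter_upwards [hIcc] with ε h2
    refine ((hsl ε).add isOpen_univ (hsl 0).neg).congr isOpen_univ fun x _ => ?_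
    rw [hF ε h2 x, sub_eq_add_neg]

end Mollify
-- Jacobi's formula for the derivative of the determinant.
section Jacobi

variable {n : ℕ}

local notation "𝔼" => EuclideanSpace ℝ (Fin n)

lemma det_eq_matrix_det (A : 𝔼 →L[ℝ] 𝔼) :
    A.det = (Matrix.of fun i j => A (EuclideanSpace.single j 1) i).det := by
  rw [ContinuousLinearMap.det, ← LinearMap.det_toMatrix (EuclideanSpace.basisFun (Fin n) ℝ).toBasis]
  congr 1

lemma contDiff_det : ContDiff ℝ ∞ (fun A : 𝔼 →L[ℝ] 𝔼 => A.det) := by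
  simp_rw [det_eq_matrix_det, Matrix.det_apply, Matrix.of_apply]
  refine ContDiff.sum fun σ _ => ContDiff.const_smul _ (contDiff_prod fun i _ => ?_)
  exact ContinuousLinearMap.contDiff ((EuclideanSpace.proj (σ i) : 𝔼 →L[ℝ] ℝ).comp
    (ContinuousLinearMap.apply ℝ 𝔼 (EuclideanSpace.single i (1 : ℝ))))

lemma trace_matrix_eq_etrace (A : 𝔼 →L[ℝ] 𝔼) :
    (Matrix.of fun i j => A (EuclideanSpace.single j 1) i).trace = etrace n A := by
  simp [Matrix.trace, etrace_apply]

lemma etrace_comp_comm (A B : 𝔼 →L[ℝ] 𝔼) : etrace n (A.comp B) = etrace n (B.comp A) := by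
  have key (A B : 𝔼 →L[ℝ] 𝔼) : etrace n (A.comp B) =
      ((Matrix.of fun i j => A (EuclideanSpace.single j 1) i) *
        (Matrix.of fun i j => B (EuclideanSpace.single j 1) i)).trace := by
    rw [etrace_apply, Matrix.trace]
    refine Finset.sum_congr rfl fun i _ => ?_
    have h := sum_apply_mul_eq ((EuclideanSpace.proj i : 𝔼 →L[ℝ] ℝ).comp A)
      (B (EuclideanSpace.single i 1))
    simpa [Matrix.mul_apply] using h.symm
  rw [key, key, Matrix.trace_mul_comm]

lemma hasDerivAt_det_id_add_smul (A : 𝔼 →L[ℝ] 𝔼) :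
    HasDerivAt (fun t : ℝ => (ContinuousLinearMap.id ℝ 𝔼 + t • A).det) (etrace n A) 0 := by
  set B : Matrix (Fin n) (Fin n) ℝ := Matrix.of fun i j => A (EuclideanSpace.single j 1) i
  obtain ⟨p, hp⟩ : ∃ p : Polynomial ℝ, ∀ t : ℝ,
      (1 + t • B).det = 1 + B.trace * t + p.eval t * t ^ 2 :=
    ⟨_, fun t => Matrix.det_one_add_smul t B⟩
  have h : (fun t : ℝ => (ContinuousLinearMap.id ℝ 𝔼 + t • A).det) =
      fun t => 1 + B.trace * t + p.eval t * t ^ 2 := by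
    funext t
    rw [← hp, det_eq_matrix_det]
    congr 1
    ext i j
    simp [B, Matrix.one_apply]
  rw [h, ← trace_matrix_eq_etrace]
  have := ((hasDerivAt_const (0 : ℝ) (1 : ℝ)).add ((hasDerivAt_id (0 : ℝ)).const_mul B.trace)).add
    ((p.hasDerivAt 0).mul
      ((hasDerivAt_id (0 : ℝ)).pow 2))
  exact (this.congr_deriv (by simp [B])).congr_of_eventuallyEq
    (Eventually.of_forall fun t => by simp)

/-- Writing `A + tH = A (1 + t B H)` reduces the derivative to the one at the identity, where it is
the trace. -/
lemma fderiv_det_apply {A B : 𝔼 →L[ℝ] 𝔼} (hBA : A.comp B = ContinuousLinearMap.id ℝ 𝔼) (H : 𝔼 →L[ℝ] 𝔼) :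
    fderiv ℝ (fun A : 𝔼 →L[ℝ] 𝔼 => A.det) A H = A.det * etrace n (B.comp H) := by
  have h1 : HasFDerivAt (fun A : 𝔼 →L[ℝ] 𝔼 => A.det) (fderiv ℝ (fun A : 𝔼 →L[ℝ] 𝔼 => A.det) A)
      ((fun t : ℝ => A + t • H) 0) := by
    have h0 : A + (0 : ℝ) • H = A := by ext v : 1; simp
    simpa only [h0] using (contDiff_det.differentiable (by simp) A).hasFDerivAt
  have h2 : HasDerivAt (fun t : ℝ => A + t • H) H 0 := by
    simpa using ((hasDerivAt_id (0 : ℝ)).smul_const H).const_add A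
  have h3 := h1.comp_hasDerivAt 0 h2
  have h4 := (hasDerivAt_det_id_add_smul (B.comp H)).const_mul A.det
  refine h3.unique (h4.congr_of_eventuallyEq (Eventually.of_forall fun t => ?_))
  have : A + t • H = A.comp (ContinuousLinearMap.id ℝ 𝔼 + t • B.comp H) := by
    rw [ContinuousLinearMap.comp_add, ContinuousLinearMap.comp_smul,
      ← ContinuousLinearMap.comp_assoc, hBA]
    simp
  simp only [Function.comp_apply, this]
  exact LinearMap.det_comp _ _

lemma alternating_apply_comp (f : 𝔼 [⋀^Fin n]→ₗ[ℝ] ℝ) (L : 𝔼 →L[ℝ] 𝔼) :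
    f (fun i => L (EuclideanSpace.single i 1)) =
      L.det * f (fun i => EuclideanSpace.single i 1) := by
  set b := (EuclideanSpace.basisFun (Fin n) ℝ).toBasis
  have hb : ⇑b = fun i => EuclideanSpace.single i (1 : ℝ) := by ext i : 1; simp [b]
  rw [← hb]
  have h1 : (fun i => L (EuclideanSpace.single i 1)) = ⇑(L : 𝔼 →ₗ[ℝ] 𝔼) ∘ ⇑b := by
    ext i : 1; simp [hb]
  rw [h1]
  conv_lhs => rw [AlternatingMap.eq_smul_basis_det b f]
  rw [AlternatingMap.smul_apply, Module.Basis.det_comp, Module.Basis.det_self, smul_eq_mul, mul_one,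
    mul_comm]

end Jacobi

/-! ### Changes of charts: vector fields, volume form, divergence. -/

section Charts

lemma isOpen_transition_source {n : ℕ} {M : Type*} [TopologicalSpace M]
    (e e' : OpenPartialHomeomorph M (EuclideanSpace ℝ (Fin n))) :
    IsOpen (e.target ∩ e.symm ⁻¹' e'.source) :=
  e.symm.isOpen_inter_preimage e'.open_source

variable {n : ℕ} {M : Type*} [TopologicalSpace M] [ChartedSpace (EuclideanSpace ℝ (Fin n)) M]

local notation "𝔼" => EuclideanSpace ℝ (Fin n)

variable {e e' : OpenPartialHomeomorph M (EuclideanSpace ℝ (Fin n))} {x : M}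

lemma contDiffOn_transition [IsManifold (𝓡 n) ∞ M] (he : e ∈ IsManifold.maximalAtlas (𝓡 n) ∞ M)
    (he' : e' ∈ IsManifold.maximalAtlas (𝓡 n) ∞ M) :
    ContDiffOn ℝ ∞ (e' ∘ e.symm) (e.target ∩ e.symm ⁻¹' e'.source) := by
  rw [← contMDiffOn_iff_contDiffOn]
  exact (contMDiffOn_of_mem_maximalAtlas he').comp
    ((contMDiffOn_symm_of_mem_maximalAtlas he).mono inter_subset_left) inter_subset_right

lemma mdifferentiable_of_mem_maximalAtlas [IsManifold (𝓡 n) ∞ M]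
    (he : e ∈ IsManifold.maximalAtlas (𝓡 n) ∞ M) : e.MDifferentiable (𝓡 n) (𝓡 n) :=
  ⟨(contMDiffOn_of_mem_maximalAtlas he).mdifferentiableOn (by simp),
    (contMDiffOn_symm_of_mem_maximalAtlas he).mdifferentiableOn (by simp)⟩

/-- The derivative of a function at a point of the domain of a chart, computed in the chart. -/
lemma mfderiv_eq_fderiv_comp_symm [IsManifold (𝓡 n) ∞ M] {F : Type*} [NormedAddCommGroup F]
    [NormedSpace ℝ F]
    (he : e ∈ IsManifold.maximalAtlas (𝓡 n) ∞ M) {f : M → F} {x : M} (hx : x ∈ e.source)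
    (hf : MDifferentiableAt (𝓡 n) 𝓘(ℝ, F) f x) (v : TangentSpace (𝓡 n) x) :
    (mfderiv (𝓡 n) 𝓘(ℝ, F) f x v : F) =
      fderiv ℝ (f ∘ e.symm) (e x) (mfderiv (𝓡 n) (𝓡 n) e x v : 𝔼) := by
  have h1 := mdifferentiable_of_mem_maximalAtlas he
  have hy : e x ∈ e.target := e.map_source hx
  have hc : mfderiv (𝓡 n) 𝓘(ℝ, F) (f ∘ e.symm) (e x) =
      (mfderiv (𝓡 n) 𝓘(ℝ, F) f (e.symm (e x))).comp (mfderiv (𝓡 n) (𝓡 n) e.symm (e x)) :=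
    mfderiv_comp (I' := 𝓡 n) (e x) (by rwa [e.left_inv hx]) (h1.mdifferentiableAt_symm hy)
  rw [← mfderiv_eq_fderiv]
  have h3 := congrArg (fun L => L v) (h1.symm_comp_deriv hx)
  have h4 := congrArg (fun L => L (mfderiv (𝓡 n) (𝓡 n) e x v)) hc
  simp only [ContinuousLinearMap.comp_apply] at h3 h4
  rw [e.left_inv hx] at h4
  refine Eq.trans ?_ h4.symm
  exact congrArg (mfderiv (𝓡 n) 𝓘(ℝ, F) f x) h3.symm


lemma localRep_apply (hx : x ∈ e.source) (X : ∀ x : M, TangentSpace (𝓡 n) x) :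
    localRep e X (e x) = (mfderiv (𝓡 n) (𝓡 n) e x (X x) : 𝔼) := by
  rw [localRep, e.left_inv hx]

lemma localRep_change [IsManifold (𝓡 n) ∞ M] (he : e ∈ IsManifold.maximalAtlas (𝓡 n) ∞ M)
    (he' : e' ∈ IsManifold.maximalAtlas (𝓡 n) ∞ M) {x : M} (hx : x ∈ e.source) (hx' : x ∈ e'.source)
    (X : ∀ x : M, TangentSpace (𝓡 n) x) :
    localRep e' X (e' x) = fderiv ℝ (e' ∘ e.symm) (e x) (localRep e X (e x)) := by
  rw [localRep_apply hx, localRep_apply hx']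
  exact mfderiv_eq_fderiv_comp_symm he hx
    ((mdifferentiable_of_mem_maximalAtlas he').mdifferentiableAt hx') (X x)

lemma contDiffAt_localRep_change [IsManifold (𝓡 n) ∞ M]
    (he : e ∈ IsManifold.maximalAtlas (𝓡 n) ∞ M) (he' : e' ∈ IsManifold.maximalAtlas (𝓡 n) ∞ M)
    {x : M} (hx : x ∈ e.source) (hx' : x ∈ e'.source) {X : ∀ x : M, TangentSpace (𝓡 n) x}
    {s : ℕ∞} (h : ContDiffAt ℝ s (localRep e X) (e x)) :
    ContDiffAt ℝ s (localRep e' X) (e' x) := by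
  have hs : (s : WithTop ℕ∞) ≤ (∞ : WithTop ℕ∞) := WithTop.coe_le_coe.2 le_top
  have hO := isOpen_transition_source e e'
  have hO' := isOpen_transition_source e' e
  have hm : e' x ∈ e'.target ∩ e'.symm ⁻¹' e.source :=
    ⟨e'.map_source hx', by simpa [e'.left_inv hx'] using hx⟩
  have hm' : e x ∈ e.target ∩ e.symm ⁻¹' e'.source :=
    ⟨e.map_source hx, by simpa [e.left_inv hx] using hx'⟩
  have hσ : ContDiffAt ℝ s (e ∘ e'.symm) (e' x) :=
    ((contDiffOn_transition he' he).contDiffAt (hO'.mem_nhds hm)).of_le hs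
  have hτ : ContDiffAt ℝ s (fderiv ℝ (e' ∘ e.symm)) (e x) :=
    (((contDiffOn_transition he he').fderiv_of_isOpen hO (m := ∞) (by simp)).contDiffAt
      (hO.mem_nhds hm')).of_le hs
  have hσx : (e ∘ e'.symm) (e' x) = e x := by simp [e'.left_inv hx']
  rw [← hσx] at hτ h
  refine ((hτ.comp _ hσ).clm_apply (h.comp _ hσ)).congr_of_eventuallyEq ?_
  filter_upwards [hO'.mem_nhds hm] with y hy
  have := localRep_change he he' hy.2 (e'.map_target hy.1) X
  rw [e'.right_inv hy.1] at this
  exact this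

/-- Smoothness of a section can be tested in any chart: in the preferred chart at `x` the
trivialisation is the derivative of the chart, and `contDiffAt_localRep_change` passes to the
others. -/
lemma contMDiffAt_section_iff [IsManifold (𝓡 n) ∞ M]
    (he : e ∈ IsManifold.maximalAtlas (𝓡 n) ∞ M) {x : M} (hx : x ∈ e.source)
    {X : ∀ x : M, TangentSpace (𝓡 n) x} {s : ℕ∞} :
    ContMDiffAt (𝓡 n) (𝓡 n).tangent s (fun x => (⟨x, X x⟩ : TangentBundle (𝓡 n) M)) x ↔
      ContDiffAt ℝ s (localRep e X) (e x) := by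
  have hs : (s : WithTop ℕ∞) ≤ (∞ : WithTop ℕ∞) := WithTop.coe_le_coe.2 le_top
  have hc : chartAt 𝔼 x ∈ IsManifold.maximalAtlas (𝓡 n) ∞ M := IsManifold.chart_mem_maximalAtlas x
  have hxc := mem_chart_source 𝔼 x
  have hM1 : IsManifold (𝓡 n) 1 M := IsManifold.of_le (n := ∞) (by simp)
  trans ContDiffAt ℝ s (localRep (chartAt 𝔼 x) X) (chartAt 𝔼 x x)
  · rw [Bundle.contMDiffAt_section, ← contMDiffAt_iff_contDiffAt]
    have hE : (fun y => (trivializationAt 𝔼 (TangentSpace (𝓡 n)) x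
        (⟨y, X y⟩ : TangentBundle (𝓡 n) M)).2) =ᶠ[𝓝 x]
        fun y => localRep (chartAt 𝔼 x) X (chartAt 𝔼 x y) := by
      filter_upwards [(chartAt 𝔼 x).open_source.mem_nhds hxc] with y hy
      rw [localRep_apply hy]
      have h := congrArg (fun L => L (X y))
        (TangentBundle.continuousLinearMapAt_trivializationAt (I := 𝓡 n) (x₀ := x) hy)
      refine Eq.trans ?_ h
      rw [Bundle.Trivialization.continuousLinearMapAt_apply,
        Bundle.Trivialization.linearMapAt_apply, if_pos]
      simpa using hy
    rw [hE.contMDiffAt_iff]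
    constructor
    · intro h
      have h2 : ContMDiffAt (𝓡 n) (𝓡 n) s (chartAt 𝔼 x).symm (chartAt 𝔼 x x) :=
        ((contMDiffOn_symm_of_mem_maximalAtlas hc).contMDiffAt
          ((chartAt 𝔼 x).open_target.mem_nhds (mem_chart_target 𝔼 x))).of_le hs
      rw [← (chartAt 𝔼 x).left_inv hxc] at h
      have h3 := ContMDiffAt.comp (chartAt 𝔼 x x) h h2
      refine h3.congr_of_eventuallyEq ?_
      filter_upwards [(chartAt 𝔼 x).open_target.mem_nhds (mem_chart_target 𝔼 x)] with y hy
      simp [(chartAt 𝔼 x).right_inv hy]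
    · intro h
      exact ContMDiffAt.comp x h (((contMDiffOn_of_mem_maximalAtlas hc).contMDiffAt
        ((chartAt 𝔼 x).open_source.mem_nhds hxc)).of_le hs)
  · exact ⟨contDiffAt_localRep_change hc he hxc hx, contDiffAt_localRep_change he hc hx hxc⟩

/-- The pull-back of a form to the model space by the inverse of a chart. -/
noncomputable def chartForm (vol : ∀ x : M, TangentSpace (𝓡 n) x [⋀^Fin n]→L[ℝ] ℝ)
    (e : OpenPartialHomeomorph M (EuclideanSpace ℝ (Fin n))) (y : EuclideanSpace ℝ (Fin n)) :
    EuclideanSpace ℝ (Fin n) [⋀^Fin n]→ₗ[ℝ] ℝ :=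
  (vol (e.symm y)).toAlternatingMap.compLinearMap
    (mfderiv (𝓡 n) (𝓡 n) e.symm y).toLinearMap

lemma form_apply_congr (vol : ∀ x : M, TangentSpace (𝓡 n) x [⋀^Fin n]→L[ℝ] ℝ) {x x' : M}
    (h : x = x') (v : Fin n → 𝔼) :
    (vol x : 𝔼 [⋀^Fin n]→L[ℝ] ℝ) v = (vol x' : 𝔼 [⋀^Fin n]→L[ℝ] ℝ) v := by
  subst h; rfl

lemma mfderiv_symm_change [IsManifold (𝓡 n) ∞ M] (he : e ∈ IsManifold.maximalAtlas (𝓡 n) ∞ M)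
    (he' : e' ∈ IsManifold.maximalAtlas (𝓡 n) ∞ M) {y : 𝔼} (hy : y ∈ e.target)
    (hy' : e.symm y ∈ e'.source) (v : 𝔼) :
    (mfderiv (𝓡 n) (𝓡 n) e.symm y v : 𝔼) =
      (mfderiv (𝓡 n) (𝓡 n) e'.symm (e' (e.symm y)) (fderiv ℝ (e' ∘ e.symm) y v) : 𝔼) := by
  have h1 := mdifferentiable_of_mem_maximalAtlas he
  have h2 := mdifferentiable_of_mem_maximalAtlas he'
  have hc := mfderiv_eq_fderiv_comp_symm he (e.map_target hy)
    (h2.mdifferentiableAt hy') (mfderiv (𝓡 n) (𝓡 n) e.symm y v)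
  have h3 := congrArg (fun L => L v) (h1.comp_symm_deriv hy)
  have h4 := congrArg (fun L => L (mfderiv (𝓡 n) (𝓡 n) e.symm y v)) (h2.symm_comp_deriv hy')
  simp only [ContinuousLinearMap.comp_apply] at h3 h4
  rw [e.right_inv hy] at hc
  refine h4.symm.trans ?_
  refine congrArg (mfderiv (𝓡 n) (𝓡 n) e'.symm (e' (e.symm y))) (hc.trans ?_)
  exact congrArg (fderiv ℝ (e' ∘ e.symm) y) h3

lemma formCoeff_change [IsManifold (𝓡 n) ∞ M] (he : e ∈ IsManifold.maximalAtlas (𝓡 n) ∞ M)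
    (he' : e' ∈ IsManifold.maximalAtlas (𝓡 n) ∞ M)
    (vol : ∀ x : M, TangentSpace (𝓡 n) x [⋀^Fin n]→L[ℝ] ℝ) {y : 𝔼} (hy : y ∈ e.target)
    (hy' : e.symm y ∈ e'.source) :
    formCoeff vol e y = (fderiv ℝ (e' ∘ e.symm) y).det * formCoeff vol e' (e' (e.symm y)) := by
  refine Eq.trans ?_ (alternating_apply_comp (chartForm vol e' (e' (e.symm y))) _)
  refine (form_apply_congr vol (e'.left_inv hy').symm _).trans ?_
  refine congrArg (vol (e'.symm (e' (e.symm y)))) ?_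
  funext i
  exact mfderiv_symm_change he he' hy hy' _

lemma formCoeff_ne_zero [IsManifold (𝓡 n) ∞ M] (he : e ∈ IsManifold.maximalAtlas (𝓡 n) ∞ M)
    (vol : VolumeForm n M) {y : 𝔼} (hy : y ∈ e.target) : formCoeff vol.form e y ≠ 0 := by
  intro h0
  refine vol.ne_zero (e.symm y) ?_
  have hf0 : chartForm vol.form e y = 0 := by
    rw [AlternatingMap.eq_smul_basis_det (EuclideanSpace.basisFun (Fin n) ℝ).toBasis
      (chartForm vol.form e y)]
    have : chartForm vol.form e y ⇑(EuclideanSpace.basisFun (Fin n) ℝ).toBasis = 0 := by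
      rw [← h0]
      have hb : ⇑(EuclideanSpace.basisFun (Fin n) ℝ).toBasis =
        fun i => EuclideanSpace.single i (1 : ℝ) := by ext i : 1; simp
      rw [hb]
      rfl
    rw [this, zero_smul]
  ext v
  have h4 (i : Fin n) := congrArg (fun L => L (v i))
    ((mdifferentiable_of_mem_maximalAtlas he).symm_comp_deriv (e.map_target hy))
  have h5 := congrArg (fun f => f fun i => (mfderiv (𝓡 n) (𝓡 n) e (e.symm y) (v i) : 𝔼)) hf0
  refine Eq.trans ?_ h5
  refine congrArg (vol.form (e.symm y)) ?_
  funext i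
  have := h4 i
  rw [e.right_inv hy] at this
  exact this.symm

/-- A smooth chart in which the volume form is the canonical one. -/
structure IsConservative (vol : VolumeForm n M)
    (e : OpenPartialHomeomorph M (EuclideanSpace ℝ (Fin n))) : Prop where
  mem : e ∈ IsManifold.maximalAtlas (𝓡 n) ∞ M
  canonical : ∀ y ∈ e.target, formCoeff vol.form e y = 1

/-- The divergence does not depend on the chart. With `τ` the transition out of the conservative
chart, `det Dτ · (ρ ∘ τ) = 1`; its derivative along the field, computed by Jacobi's formula, cancels
the second-derivative term produced by the transformation of the field. -/
lemma chartDiv_eq_ediv [IsManifold (𝓡 n) ∞ M] {vol : VolumeForm n M} (he : IsConservative vol e)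
    (he' : e' ∈ IsManifold.maximalAtlas (𝓡 n) ∞ M) {x : M} (hx : x ∈ e.source) (hx' : x ∈ e'.source)
    {X : ∀ x : M, TangentSpace (𝓡 n) x} (hX : DifferentiableAt ℝ (localRep e X) (e x)) :
    chartDiv vol e' X (e' x) = ediv (localRep e X) (e x) := by
  have hO := isOpen_transition_source e e'
  have hO' := isOpen_transition_source e' e
  have hm : e' x ∈ e'.target ∩ e'.symm ⁻¹' e.source :=
    ⟨e'.map_source hx', by simpa [e'.left_inv hx'] using hx⟩
  have hm' : e x ∈ e.target ∩ e.symm ⁻¹' e'.source :=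
    ⟨e.map_source hx, by simpa [e.left_inv hx] using hx'⟩
  set τ : 𝔼 → 𝔼 := e' ∘ e.symm with hτdef
  set σ : 𝔼 → 𝔼 := e ∘ e'.symm with hσdef
  set w := localRep e X
  set w' := localRep e' X
  set ρ := formCoeff vol.form e'
  set y := e x
  set y' := e' x
  have hτy : τ y = y' := by simp [hτdef, y, y', e.left_inv hx]
  have hσy : σ y' = y := by simp [hσdef, y, y', e'.left_inv hx']
  have hτ : ContDiffAt ℝ ∞ τ y := (contDiffOn_transition he.mem he').contDiffAt (hO.mem_nhds hm')
  have hσ : ContDiffAt ℝ ∞ σ y' := (contDiffOn_transition he' he.mem).contDiffAt (hO'.mem_nhds hm)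
  have hDτ : ContDiffAt ℝ ∞ (fderiv ℝ τ) y :=
    ((contDiffOn_transition he.mem he').fderiv_of_isOpen hO (m := ∞) (by simp)).contDiffAt
      (hO.mem_nhds hm')
  have hτd := hτ.differentiableAt (by simp)
  have hσd := hσ.differentiableAt (by simp)
  have hDτd := hDτ.differentiableAt (by simp)
  have hστ : (fderiv ℝ σ y').comp (fderiv ℝ τ y) = ContinuousLinearMap.id ℝ 𝔼 := by
    rw [← hτy, ← fderiv_comp _ (by rwa [hτy]) hτd, ← fderiv_id (x := y)]
    refine Filter.EventuallyEq.fderiv_eq ?_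
    filter_upwards [hO.mem_nhds hm'] with z hz
    simp [hτdef, hσdef, e'.left_inv hz.2, e.right_inv hz.1]
  have hτσ : (fderiv ℝ τ y).comp (fderiv ℝ σ y') = ContinuousLinearMap.id ℝ 𝔼 := by
    rw [← hσy, ← fderiv_comp _ (by rwa [hσy]) hσd, ← fderiv_id (x := y')]
    refine Filter.EventuallyEq.fderiv_eq ?_
    filter_upwards [hO'.mem_nhds hm] with z hz
    simp [hτdef, hσdef, e.left_inv hz.2, e'.right_inv hz.1]
  have hw' : w' =ᶠ[𝓝 y'] fun z => fderiv ℝ τ (σ z) (w (σ z)) := by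
    filter_upwards [hO'.mem_nhds hm] with z hz
    have := localRep_change he.mem he' hz.2 (e'.map_target hz.1) X
    rwa [e'.right_inv hz.1] at this
  have hDw' : HasFDerivAt w' (((fderiv ℝ τ y).comp (fderiv ℝ w y) +
      (fderiv ℝ (fderiv ℝ τ) y).flip (w y)).comp (fderiv ℝ σ y')) y' := by
    have h1 : HasFDerivAt (fun z => fderiv ℝ τ z (w z)) ((fderiv ℝ τ y).comp (fderiv ℝ w y) +
      (fderiv ℝ (fderiv ℝ τ) y).flip (w y)) (σ y') := by
      rw [hσy]; exact hDτd.hasFDerivAt.clm_apply hX.hasFDerivAt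
    exact (h1.comp y' hσd.hasFDerivAt).congr_of_eventuallyEq hw'
  have hρd : DifferentiableAt ℝ ρ y' :=
    ((vol.smooth e' he').contDiffAt (e'.open_target.mem_nhds hm.1)).differentiableAt (by simp)
  have hρ0 : ρ y' ≠ 0 := formCoeff_ne_zero he' vol hm.1
  have hdet : (fun z => (fderiv ℝ τ z).det * ρ (τ z)) =ᶠ[𝓝 y] fun _ => 1 := by
    filter_upwards [hO.mem_nhds hm'] with z hz
    exact (formCoeff_change he.mem he' vol.form hz.1 hz.2).symm.trans (he.canonical z hz.1)
  have hdet1 : (fderiv ℝ τ y).det * ρ y' = 1 := by simpa [hτy] using hdet.self_of_nhds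
  have hd1 : HasFDerivAt (fun z => (fderiv ℝ τ z).det) ((fderiv ℝ (fun A : 𝔼 →L[ℝ] 𝔼 => A.det)
      (fderiv ℝ τ y)).comp (fderiv ℝ (fderiv ℝ τ) y)) y :=
    (contDiff_det.differentiable (by simp) _).hasFDerivAt.comp y hDτd.hasFDerivAt
  have hd2 : HasFDerivAt (fun z => ρ (τ z)) ((fderiv ℝ ρ y').comp (fderiv ℝ τ y)) y := by
    rw [← hτy] at hρd ⊢
    exact hρd.hasFDerivAt.comp y hτd.hasFDerivAt
  have hd3 := (hd1.mul hd2).unique ((hasFDerivAt_const (1 : ℝ) y).congr_of_eventuallyEq hdet)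
  have hd4 := congrArg (fun L => L (w y)) hd3
  simp only [hτy, add_apply, smul_apply, ContinuousLinearMap.comp_apply,
    zero_apply, smul_eq_mul, fderiv_det_apply hτσ] at hd4
  have hw'y : w' y' = fderiv ℝ τ y (w y) := by
    simpa [hσy] using hw'.self_of_nhds
  rw [← hw'y] at hd4
  have hsymm : (fderiv ℝ (fderiv ℝ τ) y).flip (w y) = fderiv ℝ (fderiv ℝ τ) y (w y) := by
    ext v : 1
    exact (hτ.isSymmSndFDerivAt (by rw [minSmoothness_of_isRCLikeNormedField];
                                    exact WithTop.coe_le_coe.2 le_top)).eq v (w y)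
  -- The first summand is invariant under conjugation by `Dτ`, by cyclicity of the trace; the second
  -- contains the trace occurring in Jacobi's formula.
  have htr : etrace n (fderiv ℝ w' y') = etrace n (fderiv ℝ w y) +
      etrace n ((fderiv ℝ σ y').comp (fderiv ℝ (fderiv ℝ τ) y (w y))) := by
    rw [hDw'.fderiv, hsymm, ContinuousLinearMap.add_comp, map_add, ContinuousLinearMap.comp_assoc,
      etrace_comp_comm, ContinuousLinearMap.comp_assoc, hστ, ContinuousLinearMap.comp_id,
      etrace_comp_comm _ (fderiv ℝ σ y')]
  have hsum : ∑ i, fderiv ℝ (fun z => ρ z * w' z i) y' (EuclideanSpace.single i (1 : ℝ)) =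
      ρ y' * etrace n (fderiv ℝ w' y') + fderiv ℝ ρ y' (w' y') := by
    rw [etrace_apply, ← sum_apply_mul_eq (fderiv ℝ ρ y') (w' y'), Finset.mul_sum,
      ← Finset.sum_add_distrib]
    refine Finset.sum_congr rfl fun i _ => ?_
    have hp : HasFDerivAt (fun z => w' z i)
        ((EuclideanSpace.proj i : 𝔼 →L[ℝ] ℝ).comp (fderiv ℝ w' y')) y' :=
      (EuclideanSpace.proj i : 𝔼 →L[ℝ] ℝ).hasFDerivAt.comp y' hDw'.differentiableAt.hasFDerivAt
    have hq : fderiv ℝ (fun z => ρ z * w' z i) y' = _ := (hρd.hasFDerivAt.mul hp).fderiv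
    rw [hq]
    simp [mul_comm]
  rw [chartDiv, ediv_eq_etrace]
  change (ρ y')⁻¹ * ∑ i, fderiv ℝ (fun z => ρ z * w' z i) y' (EuclideanSpace.single i (1 : ℝ)) = _
  rw [hsum, htr]
  field_simp
  have hJ : (fderiv ℝ τ y).det ≠ 0 := left_ne_zero_of_mul_eq_one hdet1
  refine mul_left_cancel₀ hJ ?_
  linear_combination hd4

end Charts
-- Vector fields in charts: local expressions and extension by zero.
/-- Vector fields on `M`, with no regularity. -/
abbrev VField (n : ℕ) (M : Type*) [TopologicalSpace M]
    [ChartedSpace (EuclideanSpace ℝ (Fin n)) M] := ∀ x : M, TangentSpace (𝓡 n) x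

section LocalRep

variable {n : ℕ} {M : Type*} [TopologicalSpace M] [ChartedSpace (EuclideanSpace ℝ (Fin n)) M]
  {e : OpenPartialHomeomorph M (EuclideanSpace ℝ (Fin n))}

local notation "𝔼" => EuclideanSpace ℝ (Fin n)

lemma localRep_add (e : OpenPartialHomeomorph M 𝔼) (X Y : VField n M) :
    localRep e (X + Y) = fun y => localRep e X y + localRep e Y y :=
  funext fun y => (mfderiv (𝓡 n) (𝓡 n) e (e.symm y)).map_add (X _) (Y _)

lemma localRep_sub (e : OpenPartialHomeomorph M 𝔼) (X Y : VField n M) :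
    localRep e (X - Y) = fun y => localRep e X y - localRep e Y y :=
  funext fun y => (mfderiv (𝓡 n) (𝓡 n) e (e.symm y)).map_sub (X _) (Y _)

lemma localRep_smul (e : OpenPartialHomeomorph M 𝔼) (c : M → ℝ) (X : VField n M) :
    localRep e (fun x => c x • X x) = fun y => c (e.symm y) • localRep e X y :=
  funext fun y => (mfderiv (𝓡 n) (𝓡 n) e (e.symm y)).map_smul (c _) (X _)

lemma localRep_const_smul (e : OpenPartialHomeomorph M 𝔼) (c : ℝ) (X : VField n M) :
    localRep e (c • X) = fun y => c • localRep e X y :=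
  localRep_smul e (fun _ => c) X

lemma localRep_zero (e : OpenPartialHomeomorph M 𝔼) : localRep e (0 : VField n M) = fun _ => 0 :=
  funext fun y => (mfderiv (𝓡 n) (𝓡 n) e (e.symm y)).map_zero

/-- Equality of fields near a point passes to the local expressions. -/
lemma localRep_eventuallyEq {x : M} (hx : x ∈ e.source) {X Y : VField n M} (h : ∀ᶠ z in 𝓝 x, X z = Y z) :
    localRep e X =ᶠ[𝓝 (e x)] localRep e Y := by
  have hc : Tendsto e.symm (𝓝 (e x)) (𝓝 x) := by
    simpa [e.left_inv hx] using (e.continuousAt_symm (e.map_source hx)).tendsto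
  filter_upwards [hc.eventually h] with y hy
  rw [localRep, hy, localRep]

lemma localRep_congr_of_eqOn {e e' : OpenPartialHomeomorph M 𝔼} (hs : e.source ⊆ e'.source)
    (h : EqOn e' e e.source) (X : VField n M) : EqOn (localRep e' X) (localRep e X) e.target := by
  intro y hy
  have hx := e.map_target hy
  have h1 : e' (e.symm y) = y := by rw [h hx, e.right_inv hy]
  have h2 := localRep_apply (hs hx) X
  rw [h1] at h2
  rw [h2, localRep]
  have h3 : (e' : M → 𝔼) =ᶠ[𝓝 (e.symm y)] e :=
    Filter.eventuallyEq_of_mem (e.open_source.mem_nhds hx) h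
  exact congrArg (fun L : 𝔼 →L[ℝ] 𝔼 => L (X (e.symm y))) h3.mfderiv_eq

/-- The derivative of the inverse of a chart. -/
noncomputable def symmDeriv (e : OpenPartialHomeomorph M (EuclideanSpace ℝ (Fin n)))
    (y : EuclideanSpace ℝ (Fin n)) : EuclideanSpace ℝ (Fin n) →L[ℝ] EuclideanSpace ℝ (Fin n) :=
  mfderiv (𝓡 n) (𝓡 n) e.symm y

/-- The field with local expression `f` in the chart `e`, extended by zero off the domain of `e`. -/
noncomputable def ofChart (e : OpenPartialHomeomorph M (EuclideanSpace ℝ (Fin n)))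
    (f : EuclideanSpace ℝ (Fin n) → EuclideanSpace ℝ (Fin n)) : VField n M :=
  open Classical in
  fun x => (if x ∈ e.source then symmDeriv e (e x) (f (e x)) else 0 : EuclideanSpace ℝ (Fin n))

lemma ofChart_of_mem (f : 𝔼 → 𝔼) {x : M} (hx : x ∈ e.source) :
    ofChart e f x = symmDeriv e (e x) (f (e x)) := if_pos hx

lemma ofChart_of_notMem (f : 𝔼 → 𝔼) {x : M} (hx : x ∉ e.source) : ofChart e f x = 0 := if_neg hx

lemma ofChart_eq_zero {f : 𝔼 → 𝔼} {x : M} (h : x ∈ e.source → f (e x) = 0) :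
    ofChart e f x = 0 := by
  by_cases hx : x ∈ e.source
  · rw [ofChart_of_mem f hx, h hx, map_zero]
    rfl
  · exact ofChart_of_notMem f hx

lemma ofChart_eventually_eq_zero [T2Space M] {f : 𝔼 → 𝔼} {P : Set 𝔼} (hP : IsCompact P)
    (hPe : P ⊆ e.target) (hf : ∀ y ∉ P, f y = 0) {x : M} (hx : x ∉ e.symm '' P) :
    ∀ᶠ z in 𝓝 x, ofChart e f z = 0 := by
  have hc : IsClosed (e.symm '' P) := (hP.image_of_continuousOn (e.continuousOn_symm.mono hPe)).isClosed
  filter_upwards [hc.isOpen_compl.mem_nhds hx] with z hz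
  refine ofChart_eq_zero fun hz' => hf _ fun hzP => hz ⟨_, hzP, e.left_inv hz'⟩

variable [IsManifold (𝓡 n) ∞ M]

lemma mfderiv_symm_localRep (he : e ∈ IsManifold.maximalAtlas (𝓡 n) ∞ M) {x : M}
    (hx : x ∈ e.source) (X : VField n M) :
    (mfderiv (𝓡 n) (𝓡 n) e.symm (e x) (localRep e X (e x)) : 𝔼) = X x := by
  rw [localRep_apply hx]
  exact congrArg (fun L => L (X x)) ((mdifferentiable_of_mem_maximalAtlas he).symm_comp_deriv hx)

lemma eq_of_localRep_eq (he : e ∈ IsManifold.maximalAtlas (𝓡 n) ∞ M) {x : M}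
    (hx : x ∈ e.source) {X Y : VField n M} (h : localRep e X (e x) = localRep e Y (e x)) : X x = Y x := by
  have h1 := mfderiv_symm_localRep he hx X
  rw [h] at h1
  exact h1.symm.trans (mfderiv_symm_localRep he hx Y)

/-- The section of the tangent bundle given by `X` is of class `C^s` at `x`. -/
abbrev SmoothAt (s : ℕ∞) (X : ∀ x : M, TangentSpace (𝓡 n) x) (x : M) : Prop :=
  ContMDiffAt (𝓡 n) (𝓡 n).tangent s (fun x => (⟨x, X x⟩ : TangentBundle (𝓡 n) M)) x

lemma SmoothAt.contDiffAt (he : e ∈ IsManifold.maximalAtlas (𝓡 n) ∞ M) {x : M}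
    (hx : x ∈ e.source) {X : VField n M} {s : ℕ∞} (h : SmoothAt s X x) :
    ContDiffAt ℝ s (localRep e X) (e x) := (contMDiffAt_section_iff he hx).1 h

lemma SmoothAt.congr {x : M} {X Y : VField n M} {s : ℕ∞} (h : SmoothAt s X x)
    (hXY : ∀ᶠ z in 𝓝 x, Y z = X z) : SmoothAt s Y x := by
  have hc : chartAt 𝔼 x ∈ IsManifold.maximalAtlas (𝓡 n) ∞ M := IsManifold.chart_mem_maximalAtlas x
  have hxc := mem_chart_source 𝔼 x
  exact (contMDiffAt_section_iff hc hxc).2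
    ((h.contDiffAt hc hxc).congr_of_eventuallyEq (localRep_eventuallyEq hxc hXY))

lemma SmoothAt.add {x : M} {X Y : VField n M} {s : ℕ∞} (h : SmoothAt s X x) (h' : SmoothAt s Y x) :
    SmoothAt s (X + Y) x := by
  have hc : chartAt 𝔼 x ∈ IsManifold.maximalAtlas (𝓡 n) ∞ M := IsManifold.chart_mem_maximalAtlas x
  have hxc := mem_chart_source 𝔼 x
  rw [SmoothAt, contMDiffAt_section_iff hc hxc, localRep_add]
  exact (h.contDiffAt hc hxc).add (h'.contDiffAt hc hxc)

lemma SmoothAt.sub {x : M} {X Y : VField n M} {s : ℕ∞} (h : SmoothAt s X x) (h' : SmoothAt s Y x) :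
    SmoothAt s (X - Y) x := by
  have hc : chartAt 𝔼 x ∈ IsManifold.maximalAtlas (𝓡 n) ∞ M := IsManifold.chart_mem_maximalAtlas x
  have hxc := mem_chart_source 𝔼 x
  rw [SmoothAt, contMDiffAt_section_iff hc hxc, localRep_sub]
  exact (h.contDiffAt hc hxc).sub (h'.contDiffAt hc hxc)

lemma smoothAt_zero (s : ℕ∞) (x : M) : SmoothAt s (0 : VField n M) x := by
  have hc : chartAt 𝔼 x ∈ IsManifold.maximalAtlas (𝓡 n) ∞ M := IsManifold.chart_mem_maximalAtlas x
  rw [SmoothAt, contMDiffAt_section_iff hc (mem_chart_source 𝔼 x), localRep_zero]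
  exact contDiffAt_const

lemma SmoothAt.const_smul {x : M} {X : VField n M} {s : ℕ∞} (h : SmoothAt s X x) (c : ℝ) :
    SmoothAt s (c • X) x := by
  have hc : chartAt 𝔼 x ∈ IsManifold.maximalAtlas (𝓡 n) ∞ M := IsManifold.chart_mem_maximalAtlas x
  have hxc := mem_chart_source 𝔼 x
  rw [SmoothAt, contMDiffAt_section_iff hc hxc, localRep_const_smul]
  exact (h.contDiffAt hc hxc).const_smul c

lemma SmoothAt.sum {ι : Type*} {x : M} {X : ι → VField n M} {s : ℕ∞} {t : Finset ι}
    (h : ∀ i ∈ t, SmoothAt s (X i) x) : SmoothAt s (∑ i ∈ t, X i) x := by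
  classical
  induction t using Finset.induction_on with
  | empty => simpa using smoothAt_zero s x
  | insert a t ha ih =>
    rw [Finset.sum_insert ha]
    exact (h a (by simp)).add (ih fun i hi => h i (by simp [hi]))

lemma localRep_ofChart (he : e ∈ IsManifold.maximalAtlas (𝓡 n) ∞ M) (f : 𝔼 → 𝔼) {y : 𝔼}
    (hy : y ∈ e.target) : localRep e (ofChart e f) y = f y := by
  have h := congrArg (fun L => L (f y)) ((mdifferentiable_of_mem_maximalAtlas he).comp_symm_deriv hy)
  refine Eq.trans ?_ h
  rw [localRep, ofChart_of_mem f (e.map_target hy), e.right_inv hy]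
  rfl

lemma ofChart_eq (he : e ∈ IsManifold.maximalAtlas (𝓡 n) ∞ M) {f : 𝔼 → 𝔼} {x : M}
    (hx : x ∈ e.source) {X : VField n M} (h : f (e x) = localRep e X (e x)) : ofChart e f x = X x :=
  eq_of_localRep_eq he hx (by rw [localRep_ofChart he f (e.map_source hx), h])

lemma smoothAt_ofChart_iff (he : e ∈ IsManifold.maximalAtlas (𝓡 n) ∞ M) {f : 𝔼 → 𝔼} {x : M}
    (hx : x ∈ e.source) {s : ℕ∞} : SmoothAt s (ofChart e f) x ↔ ContDiffAt ℝ s f (e x) := by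
  rw [SmoothAt, contMDiffAt_section_iff he hx]
  have h : localRep e (ofChart e f) =ᶠ[𝓝 (e x)] f := by
    filter_upwards [e.open_target.mem_nhds (e.map_source hx)] with y hy
    exact localRep_ofChart he f hy
  exact ⟨fun h' => h'.congr_of_eventuallyEq h.symm, fun h' => h'.congr_of_eventuallyEq h⟩

lemma smoothAt_ofChart [T2Space M] (he : e ∈ IsManifold.maximalAtlas (𝓡 n) ∞ M) {f : 𝔼 → 𝔼}
    {P : Set 𝔼} (hP : IsCompact P) (hPe : P ⊆ e.target) (hf : ∀ y ∉ P, f y = 0) {s : ℕ∞}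
    (hfs : ContDiff ℝ s f) (x : M) : SmoothAt s (ofChart e f) x := by
  by_cases hx : x ∈ e.source
  · exact (smoothAt_ofChart_iff he hx).2 hfs.contDiffAt
  · refine (smoothAt_zero s x).congr (ofChart_eventually_eq_zero hP hPe hf ?_)
    rintro ⟨y, hy, rfl⟩
    exact hx (e.map_target (hPe hy))

end LocalRep

/-! ### The divergence as a function on the manifold. -/

section Divergence

variable {n : ℕ} {M : Type*} [TopologicalSpace M] [ChartedSpace (EuclideanSpace ℝ (Fin n)) M]
  {e : OpenPartialHomeomorph M (EuclideanSpace ℝ (Fin n))} {vol : VolumeForm n M}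

local notation "𝔼" => EuclideanSpace ℝ (Fin n)

lemma RegularConservativeAtlas.isConservative (A : RegularConservativeAtlas vol) (j : Fin A.m) :
    IsConservative vol (A.chart j) :=
  ⟨A.conservative.mem j, A.conservative.canonical j⟩

lemma RegularConservativeAtlas.exists_mem_source (A : RegularConservativeAtlas vol) (x : M) :
    ∃ j, x ∈ (A.chart j).source := by
  have : x ∈ ⋃ j, (A.chart j).source := A.conservative.cover ▸ mem_univ x
  simpa using this

/-- The index of a chart of the atlas around `x`. -/
noncomputable def RegularConservativeAtlas.idx (A : RegularConservativeAtlas vol) (x : M) :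
    Fin A.m := (A.exists_mem_source x).choose

lemma RegularConservativeAtlas.mem_source_idx (A : RegularConservativeAtlas vol) (x : M) :
    x ∈ (A.chart (A.idx x)).source := (A.exists_mem_source x).choose_spec

/-- The divergence of a vector field, computed in a chart of a conservative atlas. -/
noncomputable def mdiv (A : RegularConservativeAtlas vol) (X : ∀ x : M, TangentSpace (𝓡 n) x)
    (x : M) : ℝ :=
  ediv (localRep (A.chart (A.idx x)) X) (A.chart (A.idx x) x)

/-- The derivative of a function along a vector field. -/
noncomputable def dirDeriv (f : M → ℝ) (X : ∀ x : M, TangentSpace (𝓡 n) x) (x : M) : ℝ :=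
  mfderiv (𝓡 n) 𝓘(ℝ, ℝ) f x (X x)

lemma contDiffOn_comp_symm (he : e ∈ IsManifold.maximalAtlas (𝓡 n) ∞ M) {f : M → ℝ}
    (hf : ContMDiff (𝓡 n) 𝓘(ℝ, ℝ) ∞ f) : ContDiffOn ℝ ∞ (f ∘ e.symm) e.target := by
  rw [← contMDiffOn_iff_contDiffOn]
  exact hf.comp_contMDiffOn (contMDiffOn_symm_of_mem_maximalAtlas he)

variable (A : RegularConservativeAtlas vol)

lemma mdiv_congr {X Y : VField n M} {x : M} (h : ∀ᶠ z in 𝓝 x, X z = Y z) : mdiv A X x = mdiv A Y x :=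
  ediv_congr (localRep_eventuallyEq (A.mem_source_idx x) h)

lemma mdiv_eq_zero_of_eventually {X : VField n M} {x : M} (h : ∀ᶠ z in 𝓝 x, X z = 0) : mdiv A X x = 0 := by
  rw [mdiv_congr A (Y := 0) h, mdiv, localRep_zero]
  simp [ediv]

variable [IsManifold (𝓡 n) ∞ M]

lemma mdiv_eq (he : IsConservative vol e) {X : VField n M} {x : M} (hx : x ∈ e.source)
    (hX : SmoothAt 1 X x) : mdiv A X x = ediv (localRep e X) (e x) := by
  have hc := A.isConservative (A.idx x)
  have hxc := A.mem_source_idx x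
  rw [← chartDiv_eq_ediv he hc.mem hx hxc
      ((hX.contDiffAt he.mem hx).differentiableAt (by simp)),
    chartDiv_eq_ediv hc hc.mem hxc hxc ((hX.contDiffAt hc.mem hxc).differentiableAt (by simp)), mdiv]

/-- Replaces the condition over all charts by one scalar equation per point; by `chartDiv_eq_ediv`
every chart gives the same value. -/
lemma isDivFreeOn_iff {X : VField n M} {U : Set M} (hX : ∀ x ∈ U, SmoothAt 1 X x) :
    IsDivFreeOn vol X U ↔ ∀ x ∈ U, mdiv A X x = 0 := by
  have key {x : M} (hxU : x ∈ U) (e : OpenPartialHomeomorph M 𝔼)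
      (he : e ∈ IsManifold.maximalAtlas (𝓡 n) ∞ M) (hx : x ∈ e.source) :
      chartDiv vol e X (e x) = mdiv A X x := by
    have hc := A.isConservative (A.idx x)
    have hxc := A.mem_source_idx x
    rw [chartDiv_eq_ediv hc he hxc hx
      (((hX x hxU).contDiffAt hc.mem hxc).differentiableAt (by simp)), mdiv]
  refine ⟨fun h x hx => ?_, fun h e he y hy hyU => ?_⟩
  · have hxc := A.mem_source_idx x
    rw [← key hx _ (A.isConservative (A.idx x)).mem hxc]
    exact h _ (A.isConservative (A.idx x)).mem _ ((A.chart _).map_source hxc)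
      (by rwa [(A.chart _).left_inv hxc])
  · have := key hyU e he (e.map_target hy)
    rw [e.right_inv hy] at this
    rw [this, h _ hyU]

lemma mdiv_add {X Y : VField n M} {x : M} (hX : SmoothAt 1 X x) (hY : SmoothAt 1 Y x) :
    mdiv A (X + Y) x = mdiv A X x + mdiv A Y x := by
  have hc := (A.isConservative (A.idx x)).mem
  have hxc := A.mem_source_idx x
  simp only [mdiv, localRep_add, ediv_eq_etrace]
  rw [fderiv_fun_add ((hX.contDiffAt hc hxc).differentiableAt (by simp))
    ((hY.contDiffAt hc hxc).differentiableAt (by simp)), map_add]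

lemma mdiv_const_smul {X : VField n M} {x : M} (hX : SmoothAt 1 X x) (c : ℝ) :
    mdiv A (c • X) x = c * mdiv A X x := by
  have hc := (A.isConservative (A.idx x)).mem
  have hxc := A.mem_source_idx x
  simp only [mdiv, localRep_const_smul, ediv_eq_etrace]
  rw [fderiv_fun_const_smul ((hX.contDiffAt hc hxc).differentiableAt (by simp)), map_smul,
    smul_eq_mul]

lemma mdiv_sub {X Y : VField n M} {x : M} (hX : SmoothAt 1 X x) (hY : SmoothAt 1 Y x) :
    mdiv A (X - Y) x = mdiv A X x - mdiv A Y x := by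
  have h := mdiv_add A hX (hY.const_smul (-1))
  rw [mdiv_const_smul A hY] at h
  have e : X - Y = X + (-1 : ℝ) • Y := by
    rw [neg_one_smul, sub_eq_add_neg]
  rw [e, h]
  ring

lemma mdiv_sum {ι : Type*} {t : Finset ι} {X : ι → VField n M} {x : M} (hX : ∀ i ∈ t, SmoothAt 1 (X i) x) :
    mdiv A (∑ i ∈ t, X i) x = ∑ i ∈ t, mdiv A (X i) x := by
  classical
  induction t using Finset.induction_on with
  | empty => simpa using mdiv_eq_zero_of_eventually A (X := 0) (x := x) (by simp)
  | insert a t ha ih =>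
    rw [Finset.sum_insert ha, Finset.sum_insert ha, mdiv_add A (hX a (by simp))
      (SmoothAt.sum fun i hi => hX i (by simp [hi])), ih fun i hi => hX i (by simp [hi])]

lemma dirDeriv_eq (he : e ∈ IsManifold.maximalAtlas (𝓡 n) ∞ M) {f : M → ℝ}
    (hf : ContMDiff (𝓡 n) 𝓘(ℝ, ℝ) ∞ f) {x : M} (hx : x ∈ e.source) (X : VField n M) :
    dirDeriv f X x = fderiv ℝ (f ∘ e.symm) (e x) (localRep e X (e x)) := by
  rw [localRep_apply hx]
  exact mfderiv_eq_fderiv_comp_symm he hx (hf.mdifferentiable (by simp) x) (X x)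

lemma mdiv_smul {f : M → ℝ} {X : VField n M} {x : M} (hf : ContMDiff (𝓡 n) 𝓘(ℝ, ℝ) ∞ f)
    (hX : SmoothAt 1 X x) :
    mdiv A (fun z => f z • X z) x =
      dirDeriv f X x + f x * mdiv A X x := by
  have hc := (A.isConservative (A.idx x)).mem
  have hxc := A.mem_source_idx x
  set e := A.chart (A.idx x)
  have hfc : DifferentiableAt ℝ (f ∘ e.symm) (e x) := ((contDiffOn_comp_symm hc hf).contDiffAt
    (e.open_target.mem_nhds (e.map_source hxc))).differentiableAt (by simp)
  have hw := (hX.contDiffAt hc hxc).differentiableAt (by simp)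
  rw [dirDeriv_eq hc hf hxc]
  simp only [mdiv, localRep_smul]
  have h : HasFDerivAt (fun y => f (e.symm y) • localRep e X y) _ (e x) :=
    hfc.hasFDerivAt.smul hw.hasFDerivAt
  rw [ediv_eq_etrace, ediv_eq_etrace, h.fderiv, map_add, map_smul, smul_eq_mul]
  simp only [Function.comp_apply, e.left_inv hxc]
  rw [add_comm]
  congr 1
  rw [etrace_apply, ← sum_apply_mul_eq]
  simp

/-- The function `g` read through the chart `e`, extended by zero off the domain of `e`. -/
noncomputable def ofChartFun (e : OpenPartialHomeomorph M (EuclideanSpace ℝ (Fin n)))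
    (g : EuclideanSpace ℝ (Fin n) → ℝ) : M → ℝ :=
  e.source.indicator (g ∘ e)

lemma mdiv_ofChart [T2Space M] (he : IsConservative vol e) {f : 𝔼 → 𝔼}
    {P : Set 𝔼} (hP : IsCompact P) (hPe : P ⊆ e.target) (hf : ∀ y ∉ P, f y = 0)
    (hfs : ContDiff ℝ 1 f) (x : M) : mdiv A (ofChart e f) x = ofChartFun e (ediv f) x := by
  by_cases hx : x ∈ e.source
  · rw [mdiv_eq A he hx (smoothAt_ofChart he.mem hP hPe hf hfs x), ofChartFun, indicator_of_mem hx,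
      Function.comp_apply]
    refine ediv_congr ?_
    filter_upwards [e.open_target.mem_nhds (e.map_source hx)] with y hy
    exact localRep_ofChart he.mem f hy
  · rw [ofChartFun, indicator_of_notMem hx]
    refine mdiv_eq_zero_of_eventually A (ofChart_eventually_eq_zero hP hPe hf ?_)
    rintro ⟨y, hy, rfl⟩
    exact hx (e.map_target (hPe hy))

end Divergence
-- Functions read in charts, and extension by zero.
section Functions

variable {n : ℕ} {M : Type*} [TopologicalSpace M]
  {e : OpenPartialHomeomorph M (EuclideanSpace ℝ (Fin n))}

local notation "𝔼" => EuclideanSpace ℝ (Fin n)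

/-- The local expression of a function in a chart, extended by zero. -/
noncomputable def funRep (e : OpenPartialHomeomorph M (EuclideanSpace ℝ (Fin n))) (f : M → ℝ) :
    EuclideanSpace ℝ (Fin n) → ℝ := e.target.indicator (f ∘ e.symm)

lemma funRep_apply {f : M → ℝ} {y : 𝔼} (hy : y ∈ e.target) : funRep e f y = f (e.symm y) :=
  indicator_of_mem hy _

lemma isCompact_image_tsupport [CompactSpace M] {f : M → ℝ} (hfe : tsupport f ⊆ e.source) :
    IsCompact (e '' tsupport f) :=
  (isClosed_tsupport f).isCompact.image_of_continuousOn (e.continuousOn.mono hfe)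

lemma image_tsupport_subset {f : M → ℝ} (hfe : tsupport f ⊆ e.source) :
    e '' tsupport f ⊆ e.target := by
  rintro _ ⟨x, hx, rfl⟩
  exact e.map_source (hfe hx)

lemma funRep_eq_zero {f : M → ℝ} {y : 𝔼} (hy : y ∉ e '' tsupport f) : funRep e f y = 0 := by
  by_cases hyt : y ∈ e.target
  · rw [funRep_apply hyt]
    by_contra h
    exact hy ⟨e.symm y, subset_tsupport f h, e.right_inv hyt⟩
  · exact indicator_of_notMem hyt _

lemma tsupport_funRep_subset [CompactSpace M] {f : M → ℝ} (hfe : tsupport f ⊆ e.source) :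
    tsupport (funRep e f) ⊆ e '' tsupport f :=
  closure_minimal (fun _ hy => by_contra fun h => hy (funRep_eq_zero h))
    (isCompact_image_tsupport hfe).isClosed

lemma hasCompactSupport_funRep [CompactSpace M] {f : M → ℝ} (hfe : tsupport f ⊆ e.source) :
    HasCompactSupport (funRep e f) :=
  (isCompact_image_tsupport hfe).of_isClosed_subset (isClosed_tsupport _)
    (tsupport_funRep_subset hfe)

lemma continuous_funRep [CompactSpace M] {f : M → ℝ} (hf : Continuous f)
    (hfe : tsupport f ⊆ e.source) : Continuous (funRep e f) := by
  rw [continuous_iff_continuousAt]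
  intro y
  by_cases hy : y ∈ e.target
  · have : ContinuousAt (f ∘ e.symm) y := hf.continuousAt.comp (e.continuousAt_symm hy)
    exact this.congr (by
      filter_upwards [e.open_target.mem_nhds hy] with z hz using (funRep_apply hz).symm)
  · have hy' : y ∉ e '' tsupport f := fun h => hy (image_tsupport_subset hfe h)
    refine (continuousAt_const (y := (0 : ℝ))).congr ?_
    filter_upwards [(isCompact_image_tsupport hfe).isClosed.isOpen_compl.mem_nhds hy'] with z hz
    exact (funRep_eq_zero hz).symm

lemma ofChartFun_of_mem {g : 𝔼 → ℝ} {x : M} (hx : x ∈ e.source) : ofChartFun e g x = g (e x) :=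
  indicator_of_mem hx _

lemma ofChartFun_of_notMem {g : 𝔼 → ℝ} {x : M} (hx : x ∉ e.source) : ofChartFun e g x = 0 :=
  indicator_of_notMem hx _

lemma symm_image_subset_source {P : Set 𝔼} (hPe : P ⊆ e.target) : e.symm '' P ⊆ e.source := by
  rintro _ ⟨y, hy, rfl⟩
  exact e.map_target (hPe hy)

lemma funRep_ofChartFun {g : 𝔼 → ℝ} {P : Set 𝔼} (hPe : P ⊆ e.target)
    (hg : ∀ y ∉ P, g y = 0) : funRep e (ofChartFun e g) = g := by
  funext y
  by_cases hy : y ∈ e.target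
  · rw [funRep_apply hy, ofChartFun_of_mem (e.map_target hy), e.right_inv hy]
  · rw [hg y fun h => hy (hPe h)]
    exact indicator_of_notMem hy _

lemma contDiff_funRep [CompactSpace M] [ChartedSpace 𝔼 M] (he : e ∈ IsManifold.maximalAtlas (𝓡 n) ∞ M)
    {f : M → ℝ} (hf : ContMDiff (𝓡 n) 𝓘(ℝ, ℝ) ∞ f) (hfe : tsupport f ⊆ e.source) :
    ContDiff ℝ ∞ (funRep e f) := by
  rw [contDiff_iff_contDiffAt]
  intro y
  by_cases hy : y ∈ e.target
  · refine ((contDiffOn_comp_symm he hf).contDiffAt (e.open_target.mem_nhds hy)).congr_of_eventuallyEq ?_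
    filter_upwards [e.open_target.mem_nhds hy] with z hz using funRep_apply hz
  · have hy' : y ∉ e '' tsupport f := fun h => hy (image_tsupport_subset hfe h)
    refine (contDiffAt_const (c := (0 : ℝ))).congr_of_eventuallyEq ?_
    filter_upwards [(isCompact_image_tsupport hfe).isClosed.isOpen_compl.mem_nhds hy'] with z hz
    exact funRep_eq_zero hz

variable [T2Space M]

lemma isClosed_symm_image {P : Set 𝔼} (hP : IsCompact P) (hPe : P ⊆ e.target) :
    IsClosed (e.symm '' P) :=
  (hP.image_of_continuousOn (e.continuousOn_symm.mono hPe)).isClosed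

lemma tsupport_ofChartFun_subset {g : 𝔼 → ℝ} {P : Set 𝔼} (hP : IsCompact P) (hPe : P ⊆ e.target)
    (hg : ∀ y ∉ P, g y = 0) : tsupport (ofChartFun e g) ⊆ e.symm '' P := by
  refine closure_minimal (fun x hx => ?_) (isClosed_symm_image hP hPe)
  by_cases hxs : x ∈ e.source
  · refine ⟨e x, by_contra fun h => hx ?_, e.left_inv hxs⟩
    rw [ofChartFun_of_mem hxs, hg _ h]
  · exact absurd (ofChartFun_of_notMem hxs) hx

lemma continuous_ofChartFun {g : 𝔼 → ℝ} {P : Set 𝔼} (hP : IsCompact P) (hPe : P ⊆ e.target)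
    (hg : ∀ y ∉ P, g y = 0) (hgc : Continuous g) : Continuous (ofChartFun e g) := by
  rw [continuous_iff_continuousAt]
  intro x
  by_cases hx : x ∈ e.source
  · have : ContinuousAt (g ∘ e) x := hgc.continuousAt.comp (e.continuousAt hx)
    exact this.congr (by
      filter_upwards [e.open_source.mem_nhds hx] with z hz using (ofChartFun_of_mem hz).symm)
  · have hx' : x ∉ tsupport (ofChartFun e g) := fun h =>
      hx (symm_image_subset_source hPe (tsupport_ofChartFun_subset hP hPe hg h))
    exact (continuousAt_const (y := (0 : ℝ))).congr
      (notMem_tsupport_iff_eventuallyEq.1 hx').symm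

variable [ChartedSpace (EuclideanSpace ℝ (Fin n)) M]

lemma contMDiff_ofChartFun (he : e ∈ IsManifold.maximalAtlas (𝓡 n) ∞ M) {g : 𝔼 → ℝ} {P : Set 𝔼}
    (hP : IsCompact P) (hPe : P ⊆ e.target) (hg : ∀ y ∉ P, g y = 0) (hgc : ContDiff ℝ ∞ g) :
    ContMDiff (𝓡 n) 𝓘(ℝ, ℝ) ∞ (ofChartFun e g) := by
  intro x
  by_cases hx : x ∈ e.source
  · refine ContMDiffAt.congr_of_eventuallyEq (f := g ∘ e)
      (ContMDiffAt.comp x (hgc.contMDiff.contMDiffAt) ((contMDiffOn_of_mem_maximalAtlas he).contMDiffAt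
        (e.open_source.mem_nhds hx))) ?_
    filter_upwards [e.open_source.mem_nhds hx] with z hz using ofChartFun_of_mem hz
  · have hx' : x ∉ tsupport (ofChartFun e g) := fun h =>
      hx (symm_image_subset_source hPe (tsupport_ofChartFun_subset hP hPe hg h))
    exact (contMDiffAt_const (c := (0 : ℝ))).congr_of_eventuallyEq
      (notMem_tsupport_iff_eventuallyEq.1 hx')

end Functions

/-! ### Integration of continuous functions over the manifold. -/

section Integral

open MeasureTheory

variable {n : ℕ} {M : Type*} [TopologicalSpace M] [ChartedSpace (EuclideanSpace ℝ (Fin n)) M]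
  {vol : VolumeForm n M} {e e' : OpenPartialHomeomorph M (EuclideanSpace ℝ (Fin n))}

local notation "𝔼" => EuclideanSpace ℝ (Fin n)

/-- A functional on continuous functions that is additive, homogeneous, and which in every
conservative chart is the integral. -/
structure IsChartIntegral (vol : VolumeForm n M) (I : (M → ℝ) → ℝ) : Prop where
  add : ∀ f g, Continuous f → Continuous g → I (f + g) = I f + I g
  const_mul : ∀ c f, Continuous f → I (fun x => c * f x) = c * I f
  chart : ∀ e, IsConservative vol e → ∀ f, Continuous f → tsupport f ⊆ e.source →
    I f = ∫ y, funRep e f y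

variable [IsManifold (𝓡 n) ∞ M]

/-- Change of variables: transitions between conservative charts have Jacobian determinant one by
`formCoeff_change`. -/
lemma setIntegral_transition (he : IsConservative vol e) (he' : IsConservative vol e') {f : M → ℝ}
    (hf : ∀ x, x ∈ e.source ∩ e'.source ∨ f x = 0) :
    ∫ y in e.target, f (e.symm y) = ∫ y in e'.target, f (e'.symm y) := by
  have hO := isOpen_transition_source e e'
  have hO' := isOpen_transition_source e' e
  have h1 : ∫ y in e.target, f (e.symm y) = ∫ y in e.target ∩ e.symm ⁻¹' e'.source, f (e.symm y) := by
    refine (setIntegral_eq_of_subset_of_forall_sdiff_eq_zero e.open_target.measurableSet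
      inter_subset_left fun y hy => ?_)
    exact (hf (e.symm y)).resolve_left fun h => hy.2 ⟨hy.1, h.2⟩
  have h2 : ∫ y in e'.target, f (e'.symm y) =
      ∫ y in e'.target ∩ e'.symm ⁻¹' e.source, f (e'.symm y) := by
    refine (setIntegral_eq_of_subset_of_forall_sdiff_eq_zero e'.open_target.measurableSet
      inter_subset_left fun y hy => ?_)
    exact (hf (e'.symm y)).resolve_left fun h => hy.2 ⟨hy.1, h.1⟩
  have himg : (e' ∘ e.symm) '' (e.target ∩ e.symm ⁻¹' e'.source) =
      e'.target ∩ e'.symm ⁻¹' e.source := by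
    ext y
    constructor
    · rintro ⟨z, hz, rfl⟩
      refine ⟨e'.map_source hz.2, ?_⟩
      simpa [e'.left_inv hz.2] using e.map_target hz.1
    · rintro ⟨hy, hy'⟩
      refine ⟨e (e'.symm y), ⟨e.map_source hy', ?_⟩, ?_⟩
      · simpa [e.left_inv hy'] using e'.map_target hy
      · simp [e.left_inv hy', e'.right_inv hy]
  have hinj : InjOn (e' ∘ e.symm) (e.target ∩ e.symm ⁻¹' e'.source) :=
    e'.injOn.comp (e.symm.injOn.mono inter_subset_left) fun z hz => hz.2
  rw [h1, h2, ← himg, integral_image_eq_integral_abs_det_fderiv_smul volume hO.measurableSet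
    (fun y hy => (((contDiffOn_transition he.mem he'.mem).contDiffAt (hO.mem_nhds hy)).differentiableAt
      (by simp)).hasFDerivAt.hasFDerivWithinAt) hinj]
  refine setIntegral_congr_fun hO.measurableSet fun y hy => ?_
  have hdet := formCoeff_change he.mem he'.mem vol.form hy.1 hy.2
  rw [he.canonical y hy.1, he'.canonical _ (e'.map_source hy.2), mul_one] at hdet
  simp [← hdet, e'.left_inv hy.2]

/-- Sum of the chart integrals of the pieces cut out by a partition of unity; on functions supported
in a single chart `setIntegral_transition` moves all pieces to that chart. -/
lemma exists_isChartIntegral [T2Space M] [CompactSpace M] (A : RegularConservativeAtlas vol) :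
    ∃ I : (M → ℝ) → ℝ, IsChartIntegral vol I := by
  obtain ⟨χ, hχ⟩ := SmoothPartitionOfUnity.exists_isSubordinate (𝓡 n) (s := (univ : Set M))
    isClosed_univ (fun j => (A.chart j).source) (fun j => (A.chart j).open_source)
    (by rw [A.conservative.cover])
  have hts (j) (f : M → ℝ) : tsupport (fun x => χ j x * f x) ⊆ (A.chart j).source :=
    (tsupport_mul_subset_left).trans (hχ j)
  have hInt (e : OpenPartialHomeomorph M 𝔼) (f : M → ℝ) (hf : Continuous f)
      (hfe : tsupport f ⊆ e.source) : Integrable (funRep e f) :=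
    (continuous_funRep hf hfe).integrable_of_hasCompactSupport (hasCompactSupport_funRep hfe)
  have hcont (j) (f : M → ℝ) (hf : Continuous f) : Continuous fun x => χ j x * f x :=
    (χ j).contMDiff.continuous.mul hf
  refine ⟨fun f => ∑ j, ∫ y, funRep (A.chart j) (fun x => χ j x * f x) y, ?_, ?_, ?_⟩
  · intro f g hf hg
    rw [← Finset.sum_add_distrib]
    refine Finset.sum_congr rfl fun j _ => ?_
    rw [← integral_add (hInt _ _ (hcont j f hf) (hts j f)) (hInt _ _ (hcont j g hg) (hts j g))]
    refine integral_congr_ae (.of_forall fun y => ?_)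
    by_cases hy : y ∈ (A.chart j).target
    · simp [funRep, hy, mul_add]
    · simp [funRep, hy]
  · intro c f hf
    rw [Finset.mul_sum]
    refine Finset.sum_congr rfl fun j _ => ?_
    rw [← integral_const_mul]
    refine integral_congr_ae (.of_forall fun y => ?_)
    by_cases hy : y ∈ (A.chart j).target
    · simp [funRep, hy]; ring
    · simp [funRep, hy]
  · intro e he f hf hfe
    have hte (j) : tsupport (fun x => χ j x * f x) ⊆ e.source :=
      (tsupport_mul_subset_right).trans hfe
    have h1 (j) : ∫ y, funRep (A.chart j) (fun x => χ j x * f x) y =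
        ∫ y, funRep e (fun x => χ j x * f x) y := by
      simp only [funRep]
      rw [integral_indicator (A.chart j).open_target.measurableSet,
        integral_indicator e.open_target.measurableSet]
      refine setIntegral_transition (A.isConservative j) he (f := fun x => χ j x * f x) fun x => ?_
      by_cases hx : χ j x * f x = 0
      · exact Or.inr hx
      · exact Or.inl ⟨hts j f (subset_tsupport _ hx), hte j (subset_tsupport _ hx)⟩
    simp_rw [h1]
    rw [← integral_finsetSum _ fun j _ => hInt e _ (hcont j f hf) (hte j)]
    refine integral_congr_ae (.of_forall fun y => ?_)
    by_cases hy : y ∈ e.target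
    · simp only [funRep, indicator_of_mem hy, Function.comp_apply]
      rw [← Finset.sum_mul]
      have := χ.sum_eq_one (mem_univ (e.symm y))
      rw [finsum_eq_sum_of_fintype] at this
      rw [this, one_mul]
    · simp [funRep, hy]

end Integral
-- Hölder bounds for vector fields on the manifold, and Whitney-Hölder norms.
lemma contDiff_smul_of_tsupport_subset {E F : Type*} [NormedAddCommGroup E] [NormedSpace ℝ E]
    [NormedAddCommGroup F] [NormedSpace ℝ F] {χ : E → ℝ} (hχ : ContDiff ℝ ∞ χ) {S : Set E}
    (hS : IsOpen S) (hχS : tsupport χ ⊆ S) {g : E → F} (hg : ContDiffOn ℝ ∞ g S) :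
    ContDiff ℝ ∞ fun y => χ y • g y := by
  rw [contDiff_iff_contDiffAt]
  intro y
  by_cases hy : y ∈ tsupport χ
  · exact hχ.contDiffAt.smul (hg.contDiffAt (hS.mem_nhds (hχS hy)))
  · refine (contDiffAt_const (c := (0 : F))).congr_of_eventuallyEq ?_
    filter_upwards [notMem_tsupport_iff_eventuallyEq.1 hy] with z hz
    simp [hz]

section GlobalBounds

variable {n : ℕ} {M : Type*} [TopologicalSpace M] [ChartedSpace (EuclideanSpace ℝ (Fin n)) M]
  {vol : VolumeForm n M} {A : RegularConservativeAtlas vol}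

local notation "𝔼" => EuclideanSpace ℝ (Fin n)

/-- All local expressions of `D` in the charts of the atlas are bounded by `N` in `C^{r,α}`. -/
def GBd (A : RegularConservativeAtlas vol) (r : ℕ) (α : ℝ≥0) (D : ∀ x : M, TangentSpace (𝓡 n) x)
    (N : ℝ) : Prop :=
  ∀ j, BdOn (A.chart j).target r α (localRep (A.chart j) D) N

variable {r : ℕ} {α : ℝ≥0} {D D' : ∀ x : M, TangentSpace (𝓡 n) x} {N N' : ℝ}

lemma GBd.mono_const (h : GBd A r α D N) (hN : N ≤ N') : GBd A r α D N' :=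
  fun j => (h j).mono_const hN

lemma GBd.add (h : GBd A r α D N) (h' : GBd A r α D' N') : GBd A r α (D + D') (N + N') := by
  intro j
  rw [localRep_add]
  exact (h j).add (A.chart j).open_target (h' j)

lemma GBd.const_smul (h : GBd A r α D N) (c : ℝ) : GBd A r α (c • D) (|c| * N) := by
  intro j
  rw [localRep_const_smul]
  exact (h j).const_smul (A.chart j).open_target c

lemma GBd.sub (h : GBd A r α D N) (h' : GBd A r α D' N') : GBd A r α (D - D') (N + N') := by
  have := h.add (h'.const_smul (-1))
  rw [neg_one_smul, ← sub_eq_add_neg] at this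
  simpa using this

lemma gBd_zero (A : RegularConservativeAtlas vol) (r : ℕ) (α : ℝ≥0) :
    GBd A r α (0 : VField n M) 0 := by
  intro j
  rw [localRep_zero]
  refine ⟨contDiffOn_const, fun k _ x _ => ?_, fun x y _ => ?_⟩
  · rw [show (fun _ : 𝔼 => (0 : 𝔼)) = 0 from rfl, iteratedFDeriv_zero]; simp
  · rw [show (fun _ : 𝔼 => (0 : 𝔼)) = 0 from rfl, iteratedFDeriv_zero]; simp

lemma GBd.sum {ι : Type*} {t : Finset ι} {D : ι → ∀ x : M, TangentSpace (𝓡 n) x} {N : ι → ℝ}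
    (h : ∀ i ∈ t, GBd A r α (D i) (N i)) : GBd A r α (∑ i ∈ t, D i) (∑ i ∈ t, N i) := by
  classical
  induction t using Finset.induction_on with
  | empty => simpa using gBd_zero A r α
  | insert a t ha ih =>
    rw [Finset.sum_insert ha, Finset.sum_insert ha]
    exact (h a (by simp)).add (ih fun i hi => h i (by simp [hi]))

lemma GBd.of_succ {γ : ℝ≥0} (hα : α ≤ 1) (hN : 0 ≤ N) (h : GBd A (r + 1) γ D N) :
    GBd A r α D (2 * N) := fun j => (h j).of_succ (A.chart j).open_target hα hN

lemma GBd.smoothAt [IsManifold (𝓡 n) ∞ M] (h : GBd A r α D N) (x : M) : SmoothAt r D x := by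
  have hx := A.mem_source_idx x
  have h1 : ContDiffAt ℝ r (localRep (A.chart (A.idx x)) D) (A.chart (A.idx x) x) :=
    (h (A.idx x)).contDiffOn.contDiffAt ((A.chart _).open_target.mem_nhds ((A.chart _).map_source hx))
  exact (contMDiffAt_section_iff (s := (r : ℕ∞)) (A.isConservative _).mem hx).2 h1

lemma dom_eq (A : RegularConservativeAtlas vol) (U : Set M) (j : Fin A.m) :
    A.dom U j = (A.chart j).target ∩ (A.chart j).symm ⁻¹' U :=
  (A.chart j).image_source_inter_eq' U

lemma isOpen_dom (A : RegularConservativeAtlas vol) {U : Set M} (hU : IsOpen U) (j : Fin A.m) :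
    IsOpen (A.dom U j) := by
  rw [dom_eq]
  exact (A.chart j).symm.isOpen_inter_preimage hU

lemma dom_univ (A : RegularConservativeAtlas vol) (j : Fin A.m) :
    A.dom univ j = (A.chart j).target := by
  rw [dom_eq, preimage_univ, inter_univ]

lemma holderOnWith_iff_norm {E F : Type*} [NormedAddCommGroup E] [NormedAddCommGroup F] {C α : ℝ≥0}
    {f : E → F} {S : Set E} :
    HolderOnWith C α f S ↔ ∀ x ∈ S, ∀ y ∈ S, ‖f x - f y‖ ≤ C * ‖x - y‖ ^ (α : ℝ) := by
  refine forall₂_congr fun x _ => forall₂_congr fun y _ => ?_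
  rw [edist_dist, edist_dist, dist_eq_norm, dist_eq_norm,
    ENNReal.ofReal_rpow_of_nonneg (norm_nonneg _) α.coe_nonneg, ← ENNReal.ofReal_coe_nnreal,
    ← ENNReal.ofReal_mul C.coe_nonneg, ENNReal.ofReal_le_ofReal_iff (by positivity)]

lemma convex_target (A : RegularConservativeAtlas vol) (j : Fin A.m) :
    Convex ℝ (A.chart j).target := by
  obtain ⟨l, -, h⟩ := A.conservative.image
  rw [h j]
  exact convex_ball _ _

/-- The images of the charts are balls, so the Hölder condition along segments is the full one. -/
lemma GBd.holderOnWith (h : GBd A r α D N) (hN : 0 ≤ N) (j : Fin A.m) :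
    HolderOnWith N.toNNReal α (A.derivRep r D j) (A.dom univ j) := by
  rw [holderOnWith_iff_norm, dom_univ]
  intro x hx y hy
  rw [Real.coe_toNNReal _ hN]
  exact (h j).holder x y ((convex_target A j).segment_subset hx hy)

lemma GBd.normCH_le (h : GBd A r α D N) (hN : 0 ≤ N) : A.normCH r α D univ ≤ ENNReal.ofReal N := by
  have h1 : A.normC r D univ ≤ ENNReal.ofReal N := by
    refine iSup_le fun j => iSup₂_le fun k hk => iSup₂_le fun y hy => ?_
    rw [dom_univ] at hy
    exact ENNReal.ofReal_le_ofReal ((h j).bound k hk y hy)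
  rw [RegularConservativeAtlas.normCH]
  split_ifs
  · exact h1
  · refine max_le h1 (iSup_le fun j => ?_)
    exact (HolderWith.restrict_iff.2 (h.holderOnWith hN j)).eHolderNorm_le

/-- A field with finite Whitney-Hölder norm is bounded in `BdOn`. -/
lemma bdOn_of_normCH_le [IsManifold (𝓡 n) ∞ M] {U : Set M} (hN : 0 ≤ N)
    (hD : ∀ x ∈ U, SmoothAt r D x) (h : A.normCH r α D U ≤ ENNReal.ofReal N) (j : Fin A.m) :
    BdOn (A.dom U j) r α (localRep (A.chart j) D) (2 * N) := by
  have hC : A.normC r D U ≤ ENNReal.ofReal N := by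
    refine le_trans ?_ h
    rw [RegularConservativeAtlas.normCH]
    split_ifs
    · exact le_rfl
    · exact le_max_left _ _
  have hb : ∀ k ≤ r, ∀ y ∈ A.dom U j, ‖iteratedFDeriv ℝ k (localRep (A.chart j) D) y‖ ≤ N := by
    intro k hk y hy
    rw [← ENNReal.ofReal_le_ofReal_iff hN]
    refine le_trans ?_ hC
    exact le_iSup_of_le j (le_iSup₂_of_le k hk (le_iSup₂_of_le (f := fun y _ => ENNReal.ofReal
      ‖A.derivRep k D j y‖) y hy le_rfl))
  refine ⟨fun y hy => ?_, fun k hk y hy => (hb k hk y hy).trans (by linarith), fun x y hxy => ?_⟩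
  · rw [dom_eq] at hy
    have h1 := (hD _ hy.2).contDiffAt (A.isConservative j).mem ((A.chart j).map_target hy.1)
    rw [(A.chart j).right_inv hy.1] at h1
    exact h1.contDiffWithinAt
  · have hx := hxy (left_mem_segment ℝ x y)
    have hy := hxy (right_mem_segment ℝ x y)
    -- Only here is the factor 2 needed: `normCH` with exponent 0 has no Hölder part, while `BdOn`
    -- asks for a bound on the oscillation.
    by_cases hα : α = 0
    · subst hα
      simp only [NNReal.coe_zero, Real.rpow_zero, mul_one]
      exact (norm_sub_le _ _).trans (by linarith [hb r le_rfl x hx, hb r le_rfl y hy])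
    · rw [RegularConservativeAtlas.normCH, if_neg hα] at h
      have h2 : eHolderNorm α ((A.dom U j).domRestrict (A.derivRep r D j)) ≤ ENNReal.ofReal N :=
        (le_iSup (fun j => eHolderNorm α ((A.dom U j).domRestrict (A.derivRep r D j))) j).trans
          ((le_max_right _ _).trans h)
      have h3 : MemHolder α ((A.dom U j).domRestrict (A.derivRep r D j)) :=
        eHolderNorm_ne_top.1 (ne_top_of_le_ne_top ENNReal.ofReal_ne_top h2)
      rw [← h3.coe_nnHolderNorm_eq_eHolderNorm, ENNReal.ofReal, ENNReal.coe_le_coe] at h2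
      have h4 := holderOnWith_iff_norm.1 (HolderWith.restrict_iff.1 h3.holderWith) x hx y hy
      refine h4.trans ?_
      have h5 : (nnHolderNorm α ((A.dom U j).domRestrict (A.derivRep r D j)) : ℝ) ≤ N := by
        have := NNReal.coe_le_coe.2 h2
        rwa [Real.coe_toNNReal _ hN] at this
      gcongr
      linarith

/-- Push-forward by a chart is bounded, on fields supported in a fixed compact set. -/
lemma exists_gBd_ofChart [IsManifold (𝓡 n) ∞ M] [T2Space M] [CompactSpace M]
    (A : RegularConservativeAtlas vol) {e : OpenPartialHomeomorph M (EuclideanSpace ℝ (Fin n))}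
    (he : e ∈ IsManifold.maximalAtlas (𝓡 n) ∞ M) {P : Set (EuclideanSpace ℝ (Fin n))}
    (hP : IsCompact P) (hPe : P ⊆ e.target) (r : ℕ) :
    ∃ C, 0 ≤ C ∧ ∀ (α : ℝ≥0) (f : EuclideanSpace ℝ (Fin n) → EuclideanSpace ℝ (Fin n)) (N : ℝ),
      α ≤ 1 → 0 ≤ N → (∀ y ∉ P, f y = 0) → BdOn univ r α f N → GBd A r α (ofChart e f) (C * N) := by
  obtain ⟨Φ, hΦ, hreg⟩ := A.regular
  suffices h : ∀ j, ∃ C, 0 ≤ C ∧ ∀ (α : ℝ≥0) (f : 𝔼 → 𝔼) (N : ℝ),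
      α ≤ 1 → 0 ≤ N → (∀ y ∉ P, f y = 0) → BdOn univ r α f N →
        BdOn (A.chart j).target r α (localRep (A.chart j) (ofChart e f)) (C * N) by
    choose C hC0 hC using h
    refine ⟨∑ j, C j, Finset.sum_nonneg fun j _ => hC0 j, fun α f N hα hN hf hb j => ?_⟩
    refine (hC j α f N hα hN hf hb).mono_const ?_
    gcongr
    exact Finset.single_le_sum (fun j _ => hC0 j) (Finset.mem_univ j)
  intro j
  have hΦm := hΦ.mem j
  have hsub : (A.chart j).source ⊆ (Φ j).source := subset_closure.trans (hreg j).1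
  set S : Set 𝔼 := (Φ j).target ∩ (Φ j).symm ⁻¹' e.source with hSdef
  have hS : IsOpen S := isOpen_transition_source (Φ j) e
  -- Regularity of the atlas enters here. The transition from `e` to the `j`-th chart is read in the
  -- larger chart `Φ j`, where the relevant points form a compact set inside the domain of the
  -- transition, so its derivatives stay bounded up to the boundary of the smaller chart.
  set Q : Set 𝔼 := Φ j '' (closure (A.chart j).source ∩ e.symm '' P) with hQdef
  have hQ : IsCompact Q := by
    refine IsCompact.image_of_continuousOn ?_ ((Φ j).continuousOn.mono (inter_subset_left.trans (hreg j).1))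
    exact (isClosed_closure.inter (isClosed_symm_image hP hPe)).isCompact
  have hQS : Q ⊆ S := by
    rintro _ ⟨x, ⟨hx, hx'⟩, rfl⟩
    refine ⟨(Φ j).map_source ((hreg j).1 hx), ?_⟩
    rw [mem_preimage, (Φ j).left_inv ((hreg j).1 hx)]
    exact symm_image_subset_source hPe hx'
  obtain ⟨χ, hχ, hχc, hχS, hχ1, -⟩ := exists_cutoff hQ hS hQS
  have hσ : ContDiffOn ℝ ∞ (e ∘ (Φ j).symm) S := contDiffOn_transition hΦm he
  have hS' := isOpen_transition_source e (Φ j)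
  have hg : ContDiffOn ℝ ∞ (fun y => fderiv ℝ (Φ j ∘ e.symm) ((e ∘ (Φ j).symm) y)) S := by
    refine ((contDiffOn_transition he hΦm).fderiv_of_isOpen hS' (m := ∞) (by simp)).comp hσ ?_
    intro y hy
    refine ⟨e.map_source hy.2, ?_⟩
    simpa [e.left_inv hy.2] using (Φ j).map_target hy.1
  obtain ⟨a, hadef⟩ : ∃ a : 𝔼 → 𝔼 →L[ℝ] 𝔼, a = fun y => χ y • fderiv ℝ (Φ j ∘ e.symm)
    ((e ∘ (Φ j).symm) y) := ⟨_, rfl⟩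
  have ha : ContDiff ℝ ∞ a := hadef ▸ contDiff_smul_of_tsupport_subset hχ hS hχS hg
  have hat : tsupport a ⊆ tsupport χ := by
    refine closure_mono fun y hy => ?_
    contrapose! hy
    rw [Function.notMem_support] at hy ⊢
    rw [hadef]
    ext v : 1
    simp [hy]
  obtain ⟨C, hC0, hC⟩ := exists_bd_mul_comp (O := univ) (a := a) r isOpen_univ ha
    (hχc.of_isClosed_subset (isClosed_tsupport _) hat) hS (hat.trans hχS) hσ (mapsTo_univ _ _)
  refine ⟨C, hC0, fun α f N hα hN hf hb => ?_⟩
  refine ((hC α f N hα hN hb).mono_set (subset_univ _)).congr (A.chart j).open_target fun y hy => ?_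
  rw [← localRep_congr_of_eqOn hsub (hreg j).2 _ hy]
  set x := (A.chart j).symm y
  have hxc : x ∈ (A.chart j).source := (A.chart j).map_target hy
  have hxΦ := hsub hxc
  have hΦx : Φ j x = y := by rw [(hreg j).2 hxc, (A.chart j).right_inv hy]
  have hyx : (Φ j).symm y = x := by rw [← hΦx, (Φ j).left_inv hxΦ]
  have hyt : y ∈ (Φ j).target := hΦx ▸ (Φ j).map_source hxΦ
  by_cases hxe : x ∈ e.source
  · have h1 := localRep_change he hΦm hxe hxΦ (ofChart e f)
    rw [hΦx, localRep_ofChart he f (e.map_source hxe)] at h1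
    rw [h1, hadef]
    simp only [smul_apply, Function.comp_apply, hyx]
    by_cases hxP : e x ∈ P
    · have : y ∈ Q := ⟨x, ⟨subset_closure hxc, ⟨e x, hxP, e.left_inv hxe⟩⟩, hΦx⟩
      rw [hχ1.self_of_nhdsSet y this, one_smul]
    · rw [hf _ hxP]; simp
  · have h0 : χ y = 0 := by
      by_contra h0
      have := (hχS (subset_tsupport χ h0)).2
      rw [mem_preimage, hyx] at this
      exact hxe this
    simp only [hadef, smul_apply, h0, zero_smul]
    rw [localRep, ofChart_of_notMem f (by rwa [hyx])]
    exact (mfderiv (𝓡 n) (𝓡 n) (Φ j) _).map_zero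

end GlobalBounds
-- Membership in the class of divergence-free fields.
/-- The Hölder classes `C^{m,γ}` that contain `C^{s,β}` and generate it. -/
def Adm (s : ℕ∞) (β : ℝ≥0) (m : ℕ) (γ : ℝ≥0) : Prop := ((m : ℕ∞) ≤ s ∧ γ = 0) ∨ (s = m ∧ γ = β)

lemma Adm.le {s : ℕ∞} {β : ℝ≥0} {m : ℕ} {γ : ℝ≥0} (h : Adm s β m γ) : (m : ℕ∞) ≤ s := by
  rcases h with h | h
  · exact h.1
  · exact h.1.ge

lemma Adm.le_one {s : ℕ∞} {β : ℝ≥0} {m : ℕ} {γ : ℝ≥0} (h : Adm s β m γ) (hβ : β ≤ 1) : γ ≤ 1 := by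
  rcases h with h | h
  · rw [h.2]; exact zero_le_one
  · rwa [h.2]

section Membership

variable {n : ℕ} {M : Type*} [TopologicalSpace M] [ChartedSpace (EuclideanSpace ℝ (Fin n)) M]
  [IsManifold (𝓡 n) ∞ M] {vol : VolumeForm n M} {A : RegularConservativeAtlas vol}
  {s : ℕ∞} {β : ℝ≥0} {X D : ∀ x : M, TangentSpace (𝓡 n) x} {U : Set M}

local notation "𝔼" => EuclideanSpace ℝ (Fin n)

lemma smoothAt_of_memDivFree (hU : IsOpen U) (hX : A.MemDivFree s β X U) {x : M} (hx : x ∈ U) :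
    SmoothAt s X x :=
  hX.contMDiffOn.contMDiffAt (hU.mem_nhds hx)

lemma SmoothAt.of_le {s t : ℕ∞} {x : M} (h : SmoothAt s X x) (hts : t ≤ s) : SmoothAt t X x :=
  ContMDiffAt.of_le h (WithTop.coe_le_coe.2 hts)

lemma smoothAt_of_forall_nat {x : M} (h : ∀ m : ℕ, (m : ℕ∞) ≤ s → SmoothAt m X x) :
    SmoothAt s X x := by
  have hx := mem_chart_source 𝔼 x
  have hc : chartAt 𝔼 x ∈ IsManifold.maximalAtlas (𝓡 n) ∞ M := IsManifold.chart_mem_maximalAtlas x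
  cases s with
  | top =>
    refine (contMDiffAt_section_iff hc hx).2 ?_
    exact contDiffAt_infty.2 fun m => (h m le_top).contDiffAt hc hx
  | coe m => exact h m le_rfl

/-- A field of class `C^{s,β}` on `U` is bounded on relatively compact parts of `U`. -/
lemma exists_bdOn_of_memDivFree (hU : IsOpen U) (hX : A.MemDivFree s β X U) {m : ℕ} {γ : ℝ≥0}
    (hm : Adm s β m γ) {j : Fin A.m} {O Q : Set (EuclideanSpace ℝ (Fin n))} (hOQ : O ⊆ Q)
    (hQ : IsCompact Q) (hQU : Q ⊆ A.dom U j) :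
    ∃ N, 0 ≤ N ∧ BdOn O m γ (localRep (A.chart j) X) N := by
  have hdom := isOpen_dom A hU j
  have hcd : ContDiffOn ℝ m (localRep (A.chart j) X) (A.dom U j) := by
    intro y hy
    rw [dom_eq] at hy
    have h1 := ((smoothAt_of_memDivFree hU hX hy.2).of_le hm.le).contDiffAt
      (A.isConservative j).mem ((A.chart j).map_target hy.1)
    rw [(A.chart j).right_inv hy.1] at h1
    exact h1.contDiffWithinAt
  have hb : ∀ k, ∃ C, k ≤ m → ∀ y ∈ Q, ‖iteratedFDeriv ℝ k (localRep (A.chart j) X) y‖ ≤ C := by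
    intro k
    by_cases hk : k ≤ m
    · have hc : ContinuousOn (iteratedFDeriv ℝ k (localRep (A.chart j) X)) Q := by
        intro y hy
        exact (((hcd.contDiffAt (hdom.mem_nhds (hQU hy))).continuousAt_iteratedFDeriv
          (by exact_mod_cast hk))).continuousWithinAt
      obtain ⟨C, hC⟩ := hQ.exists_bound_of_continuousOn hc
      exact ⟨C, fun _ => hC⟩
    · exact ⟨0, fun h => absurd h hk⟩
  choose C hC using hb
  set N : ℝ := ∑ k ∈ Finset.range (m + 1), |C k|
  have hN0 : 0 ≤ N := Finset.sum_nonneg fun _ _ => abs_nonneg _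
  have hN : ∀ k ≤ m, ∀ y ∈ Q, ‖iteratedFDeriv ℝ k (localRep (A.chart j) X) y‖ ≤ N :=
    fun k hk y hy => (hC k hk y hy).trans ((le_abs_self _).trans
      (Finset.single_le_sum (f := fun k => |C k|) (fun _ _ => abs_nonneg _)
        (Finset.mem_range.2 (by omega))))
  by_cases hγ : γ = 0
  · subst hγ
    refine ⟨2 * N, by positivity, hcd.mono (hOQ.trans hQU),
      fun k hk y hy => (hN k hk y (hOQ hy)).trans (by linarith), fun x y hxy => ?_⟩
    simp only [NNReal.coe_zero, Real.rpow_zero, mul_one]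
    have hx := hOQ (hxy (left_mem_segment ℝ x y))
    have hy := hOQ (hxy (right_mem_segment ℝ x y))
    exact (norm_sub_le _ _).trans (by linarith [hN m le_rfl x hx, hN m le_rfl y hy])
  -- A positive exponent is admissible only at the top order, where the Hölder bound is part of the
  -- hypothesis on `X` and holds on the whole of `A.dom U j`; compactness is needed just for the sup
  -- norms.
  · obtain ⟨hs, rfl⟩ := hm.resolve_left fun h => hγ h.2
    obtain ⟨K, hK⟩ := hX.holder hγ m hs j
    have hK' := holderOnWith_iff_norm.1 (HolderWith.restrict_iff.1 hK)
    refine ⟨N + K, by positivity, hcd.mono (hOQ.trans hQU),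
      fun k hk y hy => (hN k hk y (hOQ hy)).trans (by linarith [K.coe_nonneg]), fun x y hxy => ?_⟩
    have hx := hQU (hOQ (hxy (left_mem_segment ℝ x y)))
    have hy := hQU (hOQ (hxy (right_mem_segment ℝ x y)))
    refine (hK' x hx y hy).trans ?_
    gcongr
    linarith

/-- Adding to a field of class `C^{s,β}` a divergence-free field with bounds in all the
admissible classes. -/
lemma memDivFree_add (hs : 1 ≤ s) (hX : A.MemDivFree s β X univ)
    (hD : ∀ m γ, Adm s β m γ → ∃ N, 0 ≤ N ∧ GBd A m γ D N) (hdiv : ∀ x, mdiv A D x = 0) :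
    A.MemDivFree s β (X + D) univ := by
  have hDs (x : M) : SmoothAt s D x := by
    refine smoothAt_of_forall_nat fun m hm => ?_
    obtain ⟨N, -, hN⟩ := hD m 0 (Or.inl ⟨hm, rfl⟩)
    exact hN.smoothAt x
  have hXs (x : M) : SmoothAt s X x := smoothAt_of_memDivFree isOpen_univ hX (mem_univ x)
  have hsm (x : M) : SmoothAt s (X + D) x := (hXs x).add (hDs x)
  refine ⟨fun x _ => (hsm x).contMDiffWithinAt, fun hβ k hk j => ?_, ?_⟩
  · obtain ⟨N, hN0, hN⟩ := hD k β (Or.inr ⟨hk, rfl⟩)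
    have h1 := hX.holder hβ k hk j
    have h2 := (HolderWith.restrict_iff.2 (hN.holderOnWith hN0 j)).memHolder
    have h3 : (A.dom univ j).domRestrict (A.derivRep k (X + D) j) =
        (A.dom univ j).domRestrict (A.derivRep k X j) +
          (A.dom univ j).domRestrict (A.derivRep k D j) := ?_
    · rw [h3]
      exact h1.add h2
    funext ⟨y, hy⟩
    rw [dom_univ] at hy
    simp only [domRestrict_apply, Pi.add_apply, RegularConservativeAtlas.derivRep, localRep_add]
    have hc {Y : VField n M} (hY : ∀ x, SmoothAt s Y x) :
        ContDiffAt ℝ k (localRep (A.chart j) Y) y := by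
      have := ((hY ((A.chart j).symm y)).of_le hk.ge).contDiffAt (A.isConservative j).mem
        ((A.chart j).map_target hy)
      rwa [(A.chart j).right_inv hy] at this
    exact iteratedFDeriv_add_apply (hc hXs) (hc hDs)
  · have h1 {Y : VField n M} (hY : ∀ x, SmoothAt s Y x) (x : M) : SmoothAt 1 Y x := (hY x).of_le hs
    rw [isDivFreeOn_iff A fun x _ => h1 hsm x]
    intro x _
    rw [mdiv_add A (h1 hXs x) (h1 hDs x), hdiv x,
      (isDivFreeOn_iff A fun x _ => h1 hXs x).1 hX.divFree x (mem_univ x), add_zero]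

end Membership
-- Small cubes, bumps, and the normalisation of the cube operator.
section Cube

variable {n : ℕ}

local notation "𝔼" => EuclideanSpace ℝ (Fin n)

lemma cube_mem_nhds (c : 𝔼) {a : ℝ} (ha : 0 < a) : cube c a ∈ 𝓝 c := by
  refine Filter.mem_of_superset (Metric.closedBall_mem_nhds c ha) fun x hx i => ?_
  have := (PiLp.norm_apply_le (x - c) i).trans (mem_closedBall_iff_norm.1 hx)
  simpa using this

lemma exists_cube_subset {O : Set 𝔼} (hO : IsOpen O) {c : 𝔼} (hc : c ∈ O) :
    ∃ a, 0 < a ∧ cube c a ⊆ O := by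
  obtain ⟨ε, hε, hεO⟩ := Metric.isOpen_iff.1 hO c hc
  refine ⟨ε / (n + 1), by positivity, fun x hx => hεO ?_⟩
  rw [mem_ball_iff_norm]
  have h1 : ‖x - c‖ ≤ ∑ i, ‖(x - c) i‖ := by
    have h2 : x - c = ∑ i, ((x - c) i) • EuclideanSpace.single i (1 : ℝ) := by
      simpa using ((EuclideanSpace.basisFun (Fin n) ℝ).sum_repr (x - c)).symm
    conv_lhs => rw [h2]
    refine (norm_sum_le _ _).trans (Finset.sum_le_sum fun i _ => ?_)
    rw [norm_smul]
    simp
  calc ‖x - c‖ ≤ ∑ i, ‖(x - c) i‖ := h1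
    _ ≤ ∑ _i : Fin n, ε / (n + 1) := Finset.sum_le_sum fun i _ => by simpa using hx i
    _ = n * (ε / (n + 1)) := by simp
    _ < ε := by
      rw [mul_div_assoc', div_lt_iff₀ (by positivity)]
      nlinarith

lemma exists_bump {O : Set 𝔼} (hO : IsOpen O) {c : 𝔼} (hc : c ∈ O) :
    ∃ g : 𝔼 → ℝ, ContDiff ℝ ∞ g ∧ HasCompactSupport g ∧ tsupport g ⊆ O ∧ 0 < ∫ y, g y ∧ 0 < g c ∧
      ∀ y, 0 ≤ g y := by
  obtain ⟨g, hg, hgc, hgO, hg1, hg01⟩ := exists_cutoff (isCompact_singleton (x := c)) hO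
    (singleton_subset_iff.2 hc)
  have h1 : g c = 1 := hg1.self_of_nhdsSet c rfl
  refine ⟨g, hg, hgc, hgO, ?_, by rw [h1]; exact one_pos, fun y => (hg01 y).1⟩
  exact hg.continuous.integral_pos_of_hasCompactSupport_nonneg_nonzero hgc (fun y => (hg01 y).1)
    (x := c) (by rw [h1]; exact one_ne_zero)

/-- The normalisation is forced by the divergence identity: integrated for a bump `g` with positive
integral, it reads `0 = ∫ g - (∫ g) (∫ B)`. -/
lemma integral_eq_one_of_cube_div_operator {c : 𝔼} {a : ℝ} (ha : 0 < a) {B : 𝔼 → ℝ}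
    {V : (𝔼 → ℝ) → 𝔼 → 𝔼} (hB : ContDiff ℝ ∞ B) (hB0 : ∀ x ∉ cube c a, B x = 0)
    (hV : ∀ f, (∀ x ∉ cube c a, f x = 0) → ContDiff ℝ 1 f → (∀ x ∉ cube c a, V f x = 0) ∧
      ∀ x, ediv (V f) x = f x - (∫ y, f y) * B x)
    (hVb : ∃ C, 0 ≤ C ∧ ∀ (α : ℝ≥0) (f : 𝔼 → ℝ) (N : ℝ), α ≤ 1 → 0 ≤ N →
      (∀ x ∉ cube c a, f x = 0) → BdOn univ 1 α f N → BdOn univ 1 α (V f) (C * N)) :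
    ∫ y, B y = 1 := by
  obtain ⟨g, hg, hgc, hgO, hgI, -, -⟩ := exists_bump (isOpen_interior (s := cube c a))
    (mem_interior_iff_mem_nhds.2 (cube_mem_nhds c ha))
  have hg0 : ∀ x ∉ cube c a, g x = 0 := fun x hx => by
    by_contra h
    exact hx (interior_subset (hgO (subset_tsupport g h)))
  obtain ⟨N, hN, hbd⟩ := exists_bdOn_of_hasCompactSupport (r := 1) (hg.of_le (by simp)) hgc
  obtain ⟨C, -, hC⟩ := hVb
  have hVg := (hC 0 g N zero_le_one hN hg0 hbd).contDiff
  obtain ⟨hV0, hVd⟩ := hV g hg0 (hg.of_le (by simp))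
  have h := integral_ediv_eq_zero hVg (hasCompactSupport_of_cube hV0)
  simp_rw [hVd] at h
  rw [MeasureTheory.integral_sub (hg.continuous.integrable_of_hasCompactSupport hgc)
    ((hB.continuous.integrable_of_hasCompactSupport (hasCompactSupport_of_cube hB0)).const_mul _),
    MeasureTheory.integral_const_mul] at h
  have h2 : (∫ y, g y) * (∫ y, B y) = (∫ y, g y) * 1 := by linarith
  exact mul_left_cancel₀ hgI.ne' h2

end Cube

/-! ### Divergences of compactly supported fields in a connected open set. -/

section Exact

variable {n : ℕ} {M : Type*} [TopologicalSpace M] [ChartedSpace (EuclideanSpace ℝ (Fin n)) M]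
  {vol : VolumeForm n M}

local notation "𝔼" => EuclideanSpace ℝ (Fin n)

/-- Smooth vector fields with compact support in `R`. -/
structure IsTestField (A : RegularConservativeAtlas vol) (R : Set M)
    (h : ∀ x : M, TangentSpace (𝓡 n) x) : Prop where
  bound : ∀ m, ∃ N, 0 ≤ N ∧ GBd A m 0 h N
  support : ∃ P, IsCompact P ∧ P ⊆ R ∧ ∀ x ∉ P, h x = 0

/-- `f` is the divergence of a smooth field with compact support in `R`. -/
def IsExact (A : RegularConservativeAtlas vol) (R : Set M) (f : M → ℝ) : Prop :=
  ∃ h, IsTestField A R h ∧ ∀ x, mdiv A h x = f x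

variable {A : RegularConservativeAtlas vol} {R : Set M} {f g : M → ℝ}

lemma IsTestField.add {h h' : ∀ x : M, TangentSpace (𝓡 n) x} (hh : IsTestField A R h)
    (hh' : IsTestField A R h') : IsTestField A R (h + h') := by
  refine ⟨fun m => ?_, ?_⟩
  · obtain ⟨N, hN, hb⟩ := hh.bound m
    obtain ⟨N', hN', hb'⟩ := hh'.bound m
    exact ⟨N + N', add_nonneg hN hN', hb.add hb'⟩
  · obtain ⟨P, hP, hPR, h0⟩ := hh.support
    obtain ⟨P', hP', hPR', h0'⟩ := hh'.support
    refine ⟨P ∪ P', hP.union hP', union_subset hPR hPR', fun x hx => ?_⟩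
    rw [mem_union, not_or] at hx
    rw [Pi.add_apply, h0 x hx.1, h0' x hx.2, add_zero]

lemma IsTestField.const_smul {h : ∀ x : M, TangentSpace (𝓡 n) x} (hh : IsTestField A R h)
    (c : ℝ) : IsTestField A R (c • h) := by
  refine ⟨fun m => ?_, ?_⟩
  · obtain ⟨N, hN, hb⟩ := hh.bound m
    exact ⟨|c| * N, by positivity, hb.const_smul c⟩
  · obtain ⟨P, hP, hPR, h0⟩ := hh.support
    exact ⟨P, hP, hPR, fun x hx => by rw [Pi.smul_apply, h0 x hx, smul_zero]⟩

variable [IsManifold (𝓡 n) ∞ M]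

lemma IsTestField.smoothAt_one {h : ∀ x : M, TangentSpace (𝓡 n) x} (hh : IsTestField A R h) (x : M) :
    SmoothAt 1 h x := by
  obtain ⟨N, -, hb⟩ := hh.bound 1
  exact hb.smoothAt x

lemma IsExact.add (hf : IsExact A R f) (hg : IsExact A R g) : IsExact A R fun x => f x + g x := by
  obtain ⟨h, hh, hd⟩ := hf
  obtain ⟨h', hh', hd'⟩ := hg
  refine ⟨h + h', hh.add hh', fun x => ?_⟩
  rw [mdiv_add A (hh.smoothAt_one x) (hh'.smoothAt_one x), hd, hd']

lemma IsExact.const_mul (hf : IsExact A R f) (c : ℝ) : IsExact A R fun x => c * f x := by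
  obtain ⟨h, hh, hd⟩ := hf
  refine ⟨c • h, hh.const_smul c, fun x => ?_⟩
  rw [mdiv_const_smul A (hh.smoothAt_one x), hd]

variable [T2Space M] [CompactSpace M]

/-- Every point has a neighbourhood on which all functions are exact up to multiples of one
function. -/
lemma exists_nhd_isExact_sub {I : (M → ℝ) → ℝ} (hI : IsChartIntegral vol I) (hR : IsOpen R) {x : M}
    (hx : x ∈ R) : ∃ O, IsOpen O ∧ x ∈ O ∧ ∃ ρ : M → ℝ, ∀ f, ContMDiff (𝓡 n) 𝓘(ℝ, ℝ) ∞ f →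
      tsupport f ⊆ O → IsExact A R fun z => f z - I f * ρ z := by
  set e := A.chart (A.idx x)
  have he : IsConservative vol e := A.isConservative _
  have hxe : x ∈ e.source := A.mem_source_idx x
  have hO : IsOpen (e.target ∩ e.symm ⁻¹' R) := e.symm.isOpen_inter_preimage hR
  obtain ⟨a, ha, hcO⟩ := exists_cube_subset hO (c := e x)
    ⟨e.map_source hxe, by rwa [mem_preimage, e.left_inv hxe]⟩
  have hct : cube (e x) a ⊆ e.target := hcO.trans inter_subset_left
  have hcc : IsCompact (cube (e x) a) := isCompact_cube _ _
  -- In a small cube the reference function is `B` transported by the chart, and the field is `V`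
  -- applied to the local expression of `f`.
  obtain ⟨B, V, hB, hB0, hV, hVb⟩ := exists_cube_div_operator (e x) ha
  refine ⟨e.source ∩ e ⁻¹' interior (cube (e x) a), e.isOpen_inter_preimage isOpen_interior,
    ⟨hxe, mem_interior_iff_mem_nhds.2 (cube_mem_nhds _ ha)⟩, ofChartFun e B, fun f hf hfO => ?_⟩
  have hfe : tsupport f ⊆ e.source := hfO.trans inter_subset_left
  set g := funRep e f
  have hg : ContDiff ℝ ∞ g := contDiff_funRep he.mem hf hfe
  have hgc : HasCompactSupport g := hasCompactSupport_funRep hfe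
  have hg0 : ∀ y ∉ cube (e x) a, g y = 0 := fun y hy => funRep_eq_zero fun hy' => by
    obtain ⟨z, hz, rfl⟩ := hy'
    exact hy (interior_subset (hfO hz).2)
  have hVg : ∀ m : ℕ, ∃ N, 0 ≤ N ∧ BdOn univ (m + 1) 0 (V g) N := by
    intro m
    obtain ⟨N, hN, hbd⟩ := exists_bdOn_of_hasCompactSupport (r := m + 1)
      (hg.of_le (by exact_mod_cast le_top)) hgc
    obtain ⟨C, hC0, hC⟩ := hVb (m + 1) (by omega)
    exact ⟨C * N, by positivity, hC 0 g N zero_le_one hN hg0 hbd⟩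
  obtain ⟨hV0, hVd⟩ := hV g hg0 (hg.of_le (by simp))
  refine ⟨ofChart e (V g), ⟨fun m => ?_, e.symm '' cube (e x) a,
    hcc.image_of_continuousOn (e.continuousOn_symm.mono hct), ?_, fun z hz => ?_⟩, fun z => ?_⟩
  · obtain ⟨N, hN, hb⟩ := hVg m
    obtain ⟨C, hC0, hC⟩ := exists_gBd_ofChart A he.mem hcc hct m
    exact ⟨C * (2 * N), by positivity, hC 0 _ _ zero_le_one (by positivity) hV0
      (hb.of_succ isOpen_univ zero_le_one hN)⟩
  · rintro _ ⟨y, hy, rfl⟩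
    exact (hcO hy).2
  · exact (ofChart_eventually_eq_zero hcc hct hV0 hz).self_of_nhds
  · obtain ⟨N, -, hb⟩ := hVg 0
    rw [mdiv_ofChart A he hcc hct hV0 hb.contDiff z, hI.chart e he f hf.continuous hfe]
    beta_reduce
    by_cases hz : z ∈ e.source
    · have hgz : g (e z) = f z := by
        rw [← e.left_inv hz, e.right_inv (e.map_source hz)]
        exact funRep_apply (e.map_source hz)
      rw [ofChartFun_of_mem hz, ofChartFun_of_mem hz, hVd, hgz]
    · rw [ofChartFun_of_notMem hz, ofChartFun_of_notMem hz, mul_zero, sub_zero]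
      by_contra h
      exact hz (hfe (subset_tsupport f (Ne.symm h)))

/-- On a connected open set, functions with small support are exact up to multiples of one fixed
function. -/
lemma exists_isExact_sub {I : (M → ℝ) → ℝ} (hI : IsChartIntegral vol I) (hR : IsOpen R)
    (hRc : IsConnected R) : ∃ ρ : M → ℝ, ∀ x ∈ R, ∃ O, IsOpen O ∧ x ∈ O ∧
      ∀ f, ContMDiff (𝓡 n) 𝓘(ℝ, ℝ) ∞ f → tsupport f ⊆ O → IsExact A R fun z => f z - I f * ρ z := by
  obtain ⟨x₀, hx₀⟩ := hRc.nonempty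
  obtain ⟨O₀, hO₀, hxO₀, ρ, hρ⟩ := exists_nhd_isExact_sub (A := A) hI hR hx₀
  refine ⟨ρ, ?_⟩
  -- The points where `ρ` serves as reference function form an open set; it remains to see that it
  -- is closed in `R`, and connectedness concludes.
  set u : Set M := {x | ∃ O, IsOpen O ∧ x ∈ O ∧
    ∀ f, ContMDiff (𝓡 n) 𝓘(ℝ, ℝ) ∞ f → tsupport f ⊆ O → IsExact A R fun z => f z - I f * ρ z}
    with hu
  have huo : IsOpen u := by
    rw [isOpen_iff_mem_nhds]
    rintro x ⟨O, hO, hxO, h⟩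
    filter_upwards [hO.mem_nhds hxO] with y hy using ⟨O, hO, hy, h⟩
  refine hRc.isPreconnected.subset_of_closure_inter_subset huo ⟨x₀, hx₀, O₀, hO₀, hxO₀, hρ⟩ ?_
  rintro x ⟨hxu, hxR⟩
  obtain ⟨O, hO, hxO, ρ', hρ'⟩ := exists_nhd_isExact_sub (A := A) hI hR hxR
  obtain ⟨y, hyO, O', hO', hyO', hyρ⟩ := mem_closure_iff.1 hxu O hO hxO
  refine ⟨O, hO, hxO, fun f hf hfO => ?_⟩
  set e := A.chart (A.idx y)
  have he : IsConservative vol e := A.isConservative _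
  have hye : y ∈ e.source := A.mem_source_idx y
  obtain ⟨g, hg, hgc, hgO, hgI, -, -⟩ := exists_bump
    (e.symm.isOpen_inter_preimage (hO.inter hO')) (c := e y)
    ⟨e.map_source hye, by simpa [e.left_inv hye] using ⟨hyO, hyO'⟩⟩
  have hgt : tsupport g ⊆ e.target := hgO.trans inter_subset_left
  have hg0 : ∀ z ∉ tsupport g, g z = 0 := fun z hz => image_eq_zero_of_notMem_tsupport hz
  set b := ofChartFun e g
  have hb : ContMDiff (𝓡 n) 𝓘(ℝ, ℝ) ∞ b := contMDiff_ofChartFun he.mem hgc hgt hg0 hg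
  have hbt : tsupport b ⊆ e.symm '' tsupport g := tsupport_ofChartFun_subset hgc hgt hg0
  have hbO : tsupport b ⊆ O ∩ O' := hbt.trans (by rintro _ ⟨z, hz, rfl⟩; exact (hgO hz).2)
  have hbI : I b = ∫ z, g z := by
    rw [hI.chart e he b hb.continuous (hbt.trans (symm_image_subset_source hgt)),
      funRep_ofChartFun hgt hg0]
  have h1 := hρ' b hb (hbO.trans inter_subset_left)
  have h2 := hyρ b hb (hbO.trans inter_subset_right)
  -- The bump `b`, supported where both references are valid, is equivalent to `I b` times either of
  -- them. Subtracting shows that `ρ' - ρ` is exact after scaling by `I b ≠ 0`, and `ρ'` is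
  -- exchanged for `ρ`.
  have h3 := (hρ' f hf hfO).add ((h2.add (h1.const_mul (-1))).const_mul (I f / I b))
  convert h3 using 2 with z
  have : I b ≠ 0 := by rw [hbI]; exact hgI.ne'
  field_simp
  ring

end Exact
-- The linear operator correcting the divergence of the cut-off field.
section Correction

lemma exists_bd_coeff {n : ℕ} {F : Type} [NormedAddCommGroup F] [NormedSpace ℝ F]
    {O : Set (EuclideanSpace ℝ (Fin n))} (hO : IsOpen O)
    {a : EuclideanSpace ℝ (Fin n) → (EuclideanSpace ℝ (Fin n) →L[ℝ] F)} (ha : ContDiff ℝ ∞ a)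
    (hac : HasCompactSupport a) (haO : tsupport a ⊆ O) (r : ℕ) :
    ∃ C, 0 ≤ C ∧ ∀ (α : ℝ≥0) (w : EuclideanSpace ℝ (Fin n) → EuclideanSpace ℝ (Fin n)) (N : ℝ),
      α ≤ 1 → 0 ≤ N → BdOn O r α w N →
      BdOn univ r α (fun x => a x (w x)) (C * N) :=
  exists_bd_mul_comp r hO ha hac isOpen_univ (subset_univ _) contDiffOn_id fun _ hx => haO hx

variable {n : ℕ} {M : Type*} [TopologicalSpace M] [ChartedSpace (EuclideanSpace ℝ (Fin n)) M]
  {vol : VolumeForm n M}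

local notation "𝔼" => EuclideanSpace ℝ (Fin n)

lemma IsChartIntegral.sum {I : (M → ℝ) → ℝ} (hI : IsChartIntegral vol I) {ι : Type*} (t : Finset ι)
    {f : ι → M → ℝ} (hf : ∀ i, Continuous (f i)) :
    I (fun x => ∑ i ∈ t, f i x) = ∑ i ∈ t, I (f i) := by
  classical
  induction t using Finset.induction_on with
  | empty => simpa using hI.const_mul 0 (fun _ => 0) continuous_const
  | insert a t ha ih =>
    rw [Finset.sum_insert ha, ← ih, ← hI.add _ _ (hf a) (continuous_finsetSum t fun i _ => hf i)]
    congr 1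
    funext x
    simp [Finset.sum_insert ha]

lemma dirDeriv_eq_zero {ξ : M → ℝ} {x : M} {c : ℝ} (h : ∀ᶠ z in 𝓝 x, ξ z = c) (W : VField n M) :
    dirDeriv ξ W x = 0 := by
  have h1 : mfderiv (𝓡 n) 𝓘(ℝ, ℝ) ξ x = mfderiv (𝓡 n) 𝓘(ℝ, ℝ) (fun _ => c) x :=
    Filter.EventuallyEq.mfderiv_eq h
  rw [dirDeriv, h1, mfderiv_const]
  rfl

variable [IsManifold (𝓡 n) ∞ M] [T2Space M] [CompactSpace M]
  {A : RegularConservativeAtlas vol} {R : Set M}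

/-- Local solutions of the equation `div v = θ dξ(W)`, up to a multiple of a fixed function. -/
lemma exists_local_solution {I : (M → ℝ) → ℝ} (hI : IsChartIntegral vol I) (hR : IsOpen R)
    {ρ : M → ℝ} {x : M} (hx : x ∈ R)
    (hρ : ∃ O, IsOpen O ∧ x ∈ O ∧ ∀ f, ContMDiff (𝓡 n) 𝓘(ℝ, ℝ) ∞ f → tsupport f ⊆ O →
      IsExact A R fun z => f z - I f * ρ z)
    {j : Fin A.m} (hxj : x ∈ (A.chart j).source) {O : Set (EuclideanSpace ℝ (Fin n))}
    (hO : IsOpen O) (hxO : A.chart j x ∈ O) :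
    ∃ N P : Set M, IsOpen N ∧ x ∈ N ∧ IsCompact P ∧ P ⊆ R ∧
      ∀ θ ξ : M → ℝ, ContMDiff (𝓡 n) 𝓘(ℝ, ℝ) ∞ θ → ContMDiff (𝓡 n) 𝓘(ℝ, ℝ) ∞ ξ → tsupport θ ⊆ N →
      ∃ T : VField n M → VField n M,
        (∀ W c, 0 ≤ c → BdOn O 1 0 (localRep (A.chart j) W) c → (∀ z ∉ P, T W z = 0) ∧
          (∀ z, mdiv A (T W) z = θ z * dirDeriv ξ W z - I (fun z => θ z * dirDeriv ξ W z) * ρ z) ∧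
          Continuous fun z => θ z * dirDeriv ξ W z) ∧
        ∀ r, 1 ≤ r → ∃ C, 0 ≤ C ∧ ∀ (α : ℝ≥0) W c, α ≤ 1 → 0 ≤ c →
          BdOn O r α (localRep (A.chart j) W) c → GBd A r α (T W) (C * c) := by
  obtain ⟨Ox, hOx, hxOx, hex⟩ := hρ
  set e := A.chart j
  have he : IsConservative vol e := A.isConservative _
  obtain ⟨a, ha, hcO⟩ := exists_cube_subset
    ((e.symm.isOpen_inter_preimage (hOx.inter hR)).inter hO) (c := e x)
    ⟨⟨e.map_source hxj, by simpa [e.left_inv hxj] using ⟨hxOx, hx⟩⟩, hxO⟩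
  have hct : cube (e x) a ⊆ e.target := fun y hy => (hcO hy).1.1
  have hcc : IsCompact (cube (e x) a) := isCompact_cube _ _
  obtain ⟨B, V, hB, hB0, hV, hVb⟩ := exists_cube_div_operator (e x) ha
  have hBI := integral_eq_one_of_cube_div_operator ha hB hB0 hV (hVb 1 le_rfl)
  have hBM := contMDiff_ofChartFun he.mem hcc hct hB0 hB
  have hBt := tsupport_ofChartFun_subset hcc hct hB0
  -- The fixed smooth field `h` trades the local bump for the global reference: since the bump has
  -- integral one, `div h` is the bump minus `ρ`.
  obtain ⟨h, hh, hhd⟩ := hex _ hBM (hBt.trans (by rintro _ ⟨y, hy, rfl⟩; exact (hcO hy).1.2.1))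
  have hIB : I (ofChartFun e B) = 1 := by
    rw [hI.chart e he _ hBM.continuous (hBt.trans (symm_image_subset_source hct)),
      funRep_ofChartFun hct hB0, hBI]
  obtain ⟨Ph, hPh, hPhR, hh0⟩ := hh.support
  refine ⟨e.source ∩ e ⁻¹' interior (cube (e x) a), e.symm '' cube (e x) a ∪ Ph,
    e.isOpen_inter_preimage isOpen_interior,
    ⟨hxj, mem_interior_iff_mem_nhds.2 (cube_mem_nhds _ ha)⟩,
    (hcc.image_of_continuousOn (e.continuousOn_symm.mono hct)).union hPh,
    union_subset (by rintro _ ⟨y, hy, rfl⟩; exact (hcO hy).1.2.2) hPhR, fun θ ξ hθ hξ hθN => ?_⟩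
  have hθe : tsupport θ ⊆ e.source := hθN.trans inter_subset_left
  -- `θ dξ` as a smooth, compactly supported covector field. The right-hand side `b · w` is
  -- algebraic in the local expression `w` of `W`, so no derivative is lost.
  obtain ⟨b, hbdef⟩ : ∃ b : 𝔼 → (𝔼 →L[ℝ] ℝ), b = fun y => funRep e θ y • fderiv ℝ (ξ ∘ e.symm) y :=
    ⟨_, rfl⟩
  have hθt := tsupport_funRep_subset hθe
  have hb : ContDiff ℝ ∞ b := by
    rw [hbdef]
    exact contDiff_smul_of_tsupport_subset (contDiff_funRep he.mem hθ hθe) e.open_target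
      (hθt.trans (image_tsupport_subset hθe))
      ((contDiffOn_comp_symm he.mem hξ).fderiv_of_isOpen e.open_target (m := ∞) (by simp))
  have hbs : ∀ y, funRep e θ y = 0 → b y = 0 := fun y hy => by
    rw [hbdef]; ext v : 1; simp [hy]
  have hbt : tsupport b ⊆ tsupport (funRep e θ) :=
    closure_mono fun y hy => fun h0 => hy (hbs y h0)
  have hbcube : tsupport b ⊆ cube (e x) a := by
    refine (hbt.trans hθt).trans ?_
    rintro _ ⟨z, hz, rfl⟩
    exact interior_subset (hθN hz).2
  have hbc : HasCompactSupport b := hcc.of_isClosed_subset (isClosed_tsupport _) hbcube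
  have hbO : tsupport b ⊆ O := hbcube.trans fun y hy => (hcO hy).2
  have hg0 (W : VField n M) : ∀ y ∉ cube (e x) a, b y (localRep e W y) = 0 := fun y hy => by
    rw [image_eq_zero_of_notMem_tsupport fun h => hy (hbcube h)]; simp
  have hgθ (W : VField n M) : (fun z => θ z * dirDeriv ξ W z) =
      ofChartFun e fun y => b y (localRep e W y) := by
    funext z
    by_cases hz : z ∈ e.source
    · rw [ofChartFun_of_mem hz, dirDeriv_eq he.mem hξ hz, hbdef]
      simp [funRep_apply (e.map_source hz), e.left_inv hz]
    · rw [ofChartFun_of_notMem hz,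
        image_eq_zero_of_notMem_tsupport fun h => hz (hθe h), zero_mul]
  -- With `g = b · w` the divergence is `g - (∫ g) B + (∫ g) (B - ρ) = g - (∫ g) ρ`.
  refine ⟨fun W => ofChart e (V fun y => b y (localRep e W y)) +
    (∫ y, b y (localRep e W y)) • h, fun W c hc hW => ?_, fun r hr => ?_⟩
  · obtain ⟨g, hgdef⟩ : ∃ g : 𝔼 → ℝ, g = fun y => b y (localRep e W y) := ⟨_, rfl⟩
    have hg0' : ∀ y ∉ cube (e x) a, g y = 0 := hgdef ▸ hg0 W
    have hgθ' := hgθ W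
    simp only [← hgdef] at hgθ' ⊢
    obtain ⟨C, hC0, hC⟩ := exists_bd_coeff hO hb hbc hbO 1
    have hgb : BdOn univ 1 0 g (C * c) := hgdef ▸ hC 0 _ c zero_le_one hc hW
    have hg1 : ContDiff ℝ 1 g := hgb.contDiff_one le_rfl
    obtain ⟨hV0, hVd⟩ := hV g hg0' hg1
    obtain ⟨C', hC'0, hC'⟩ := hVb 1 le_rfl
    have hVg : ContDiff ℝ 1 (V g) :=
      (hC' 0 g _ zero_le_one (by positivity) hg0' hgb).contDiff_one le_rfl
    have hgc := continuous_ofChartFun hcc hct hg0' hg1.continuous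
    have hgI : I (ofChartFun e g) = ∫ y, g y := by
      rw [hI.chart e he _ hgc ((tsupport_ofChartFun_subset hcc hct hg0').trans
        (symm_image_subset_source hct)), funRep_ofChartFun hct hg0']
    refine ⟨fun z hz => ?_, fun z => ?_, by rwa [hgθ']⟩
    · rw [mem_union, not_or] at hz
      rw [Pi.add_apply, Pi.smul_apply, hh0 z hz.2, smul_zero, add_zero]
      exact (ofChart_eventually_eq_zero hcc hct hV0 hz.1).self_of_nhds
    · have hz := congrFun hgθ' z
      beta_reduce at hz
      rw [mdiv_add A (smoothAt_ofChart (s := 1) he.mem hcc hct hV0 hVg z)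
        ((hh.smoothAt_one z).const_smul _), mdiv_const_smul A (hh.smoothAt_one z),
        mdiv_ofChart A he hcc hct hV0 hVg, hhd, hIB, hz, hgθ', hgI]
      beta_reduce
      by_cases hz : z ∈ e.source
      · rw [ofChartFun_of_mem hz, ofChartFun_of_mem hz, ofChartFun_of_mem hz, hVd]
        ring
      · rw [ofChartFun_of_notMem hz, ofChartFun_of_notMem hz, ofChartFun_of_notMem hz]
        ring
  · obtain ⟨C, hC0, hC⟩ := exists_bd_coeff hO hb hbc hbO r
    obtain ⟨C', hC'0, hC'⟩ := hVb r hr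
    obtain ⟨C'', hC''0, hC''⟩ := exists_gBd_ofChart A he.mem hcc hct r
    obtain ⟨Nh, hNh, hhb⟩ := hh.bound (r + 1)
    set v : ℝ := MeasureTheory.volume.real (cube (e x) a)
    have hv : 0 ≤ v := MeasureTheory.measureReal_nonneg
    refine ⟨C'' * (C' * C) + C * v * (2 * Nh), by positivity, fun α W c hα hc hW => ?_⟩
    have hgb := hC α _ c hα hc hW
    have hg1 := hgb.contDiff_one hr
    have h1 := hC'' α _ _ hα (by positivity) (hV _ (hg0 W) hg1).1
      (hC' α _ _ hα (by positivity) (hg0 W) hgb)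
    have h2 := ((hhb.of_succ hα hNh).const_smul (∫ y, b y (localRep e W y)))
    refine (h1.add h2).mono_const ?_
    have h3 : |∫ y, b y (localRep e W y)| ≤ C * c * v := by
      rw [← MeasureTheory.setIntegral_eq_integral_of_forall_compl_eq_zero (hg0 W)]
      exact MeasureTheory.norm_setIntegral_le_of_norm_le_const hcc.measure_lt_top
        fun y _ => hgb.norm_le (mem_univ y)
    calc C'' * (C' * (C * c)) + |∫ y, b y (localRep e W y)| * (2 * Nh)
        ≤ C'' * (C' * (C * c)) + C * c * v * (2 * Nh) := by gcongr
      _ = (C'' * (C' * C) + C * v * (2 * Nh)) * c := by ring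

/-- The linear operator that corrects the divergence of `ξ W`, for a cut-off function `ξ`. -/
lemma exists_correction (A : RegularConservativeAtlas vol) {K U : Set M} (hK : IsCompact K)
    (hU : IsOpen U) (hKU : K ⊆ U) (hconn : IsConnected (U \ K)) :
    ∃ (O Q : Fin A.m → Set (EuclideanSpace ℝ (Fin n))) (S V : Set M) (L : VField n M → VField n M),
      (∀ j, IsOpen (O j) ∧ IsCompact (Q j) ∧ O j ⊆ Q j ∧ Q j ⊆ A.dom U j) ∧
      IsCompact S ∧ S ⊆ U ∧ IsOpen V ∧ K ⊆ V ∧ V ⊆ U ∧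
      (∀ W c, 0 ≤ c → (∀ j, BdOn (O j) 1 0 (localRep (A.chart j) W) c) →
        (∀ x ∈ U, SmoothAt 1 W x) → (∀ x ∈ U, mdiv A W x = 0) →
        (∀ x ∉ S, L W x = 0) ∧ (∀ x ∈ V, L W x = W x) ∧ ∀ x, mdiv A (L W) x = 0) ∧
      ∀ r, 1 ≤ r → ∃ C, 0 ≤ C ∧ ∀ (α : ℝ≥0) W c, α ≤ 1 → 0 ≤ c →
        (∀ j, BdOn (O j) r α (localRep (A.chart j) W) c) → GBd A r α (L W) (C * c) := by
  have hR : IsOpen (U \ K) := hU.sdiff hK.isClosed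
  obtain ⟨I, hI⟩ := exists_isChartIntegral A
  obtain ⟨ρ, hρ⟩ := exists_isExact_sub (A := A) hI hR hconn
  obtain ⟨K', hK', hKK', hK'U⟩ := exists_compact_between hK hU hKU
  obtain ⟨ξ, hξ1, hξ0, -⟩ := exists_contMDiffMap_one_nhds_of_subset_interior (𝓡 n) (n := (⊤ : ℕ∞))
    hK.isClosed hKK'
  have hξ : ContMDiff (𝓡 n) 𝓘(ℝ, ℝ) ∞ ξ := ξ.contMDiff
  obtain ⟨χ, hχ⟩ := SmoothPartitionOfUnity.exists_isSubordinate (𝓡 n) (s := (univ : Set M))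
    isClosed_univ (fun j => (A.chart j).source) (fun j => (A.chart j).open_source)
    (by rw [A.conservative.cover])
  have hχ1 (x : M) : ∑ j, χ j x = 1 := by
    rw [← finsum_eq_sum_of_fintype]; exact χ.sum_eq_one (mem_univ x)
  set Vξ : Set M := interior {x | ξ x = 1}
  have hKV : K ⊆ Vξ := subset_interior_iff_mem_nhdsSet.2 hξ1
  have hVK' : Vξ ⊆ K' := fun x hx => by
    by_contra h
    have h1 : ξ x = 1 := (interior_subset hx : x ∈ {x | ξ x = 1})
    rw [hξ0 x h] at h1
    exact zero_ne_one h1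
  have hξ0' : ∀ x ∉ K', ∀ᶠ z in 𝓝 x, ξ z = 0 := fun x hx => by
    filter_upwards [hK'.isClosed.isOpen_compl.mem_nhds hx] with z hz using hξ0 z hz
  -- The compact shell outside of which `dξ` vanishes; it is contained in `U \ K`.
  have hT : IsCompact (K' \ Vξ) := hK'.diff isOpen_interior
  have hdξ : ∀ x ∉ K' \ Vξ, ∀ W : VField n M, dirDeriv ξ W x = 0 := fun x hx W => by
    by_cases hxK : x ∈ K'
    · have hxV : x ∈ Vξ := by_contra fun h => hx ⟨hxK, h⟩
      exact dirDeriv_eq_zero (c := 1) (mem_interior_iff_mem_nhds.1 hxV) W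
    · exact dirDeriv_eq_zero (hξ0' x hxK) W
  -- The operator sees `W` only on the interiors of these compact sets, so it applies to fields
  -- defined on `U` with no control near its boundary.
  have hOQ : ∀ j, ∃ Q : Set 𝔼, IsCompact Q ∧ A.chart j '' (tsupport (χ j) ∩ K') ⊆ interior Q ∧
      Q ⊆ A.dom U j := fun j => by
    refine exists_compact_between ?_ (isOpen_dom A hU j) ?_
    · exact ((isClosed_tsupport _).inter hK'.isClosed).isCompact.image_of_continuousOn
        ((A.chart j).continuousOn.mono (inter_subset_left.trans (hχ j)))
    · exact image_mono fun x hx => ⟨hχ j hx.1, hK'U hx.2⟩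
  choose Q hQ hQi hQU using hOQ
  have hloc : ∀ x : ↥(K' \ Vξ), ∃ (j : Fin A.m) (N P : Set M), IsOpen N ∧ (x : M) ∈ N ∧
      IsCompact P ∧ P ⊆ U \ K ∧
      ∀ θ ξ : M → ℝ, ContMDiff (𝓡 n) 𝓘(ℝ, ℝ) ∞ θ → ContMDiff (𝓡 n) 𝓘(ℝ, ℝ) ∞ ξ → tsupport θ ⊆ N →
      ∃ T : VField n M → VField n M,
        (∀ W c, 0 ≤ c → BdOn (interior (Q j)) 1 0 (localRep (A.chart j) W) c → (∀ z ∉ P, T W z = 0) ∧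
          (∀ z, mdiv A (T W) z = θ z * dirDeriv ξ W z - I (fun z => θ z * dirDeriv ξ W z) * ρ z) ∧
          Continuous fun z => θ z * dirDeriv ξ W z) ∧
        ∀ r, 1 ≤ r → ∃ C, 0 ≤ C ∧ ∀ (α : ℝ≥0) W c, α ≤ 1 → 0 ≤ c →
          BdOn (interior (Q j)) r α (localRep (A.chart j) W) c → GBd A r α (T W) (C * c) := by
    rintro ⟨x, hxK', hxV⟩
    -- The chart is chosen with `x` in the support of `χ j`, which puts the image of `x` in the
    -- interior of `Q j`.
    obtain ⟨j, hj⟩ : ∃ j, χ j x ≠ 0 := by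
      by_contra! h
      have := hχ1 x
      simp [h] at this
    have hxj := subset_tsupport _ hj
    have hxR : x ∈ U \ K := ⟨hK'U hxK', fun h => hxV (hKV h)⟩
    exact ⟨j, exists_local_solution hI hR hxR (hρ x hxR) (hχ j hxj) isOpen_interior
      (hQi j ⟨x, ⟨hxj, hxK'⟩, rfl⟩)⟩
  choose jx N P hN hxN hP hPR hsol using hloc
  obtain ⟨t, ht⟩ := hT.elim_finite_subcover N hN fun x hx => mem_iUnion.2 ⟨⟨x, hx⟩, hxN ⟨x, hx⟩⟩
  obtain ⟨θ, hθ⟩ := SmoothPartitionOfUnity.exists_isSubordinate (𝓡 n) hT.isClosed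
    (fun i : t => N i) (fun i => hN i) (by
      refine ht.trans ?_
      intro x hx
      simp only [mem_iUnion] at hx ⊢
      obtain ⟨i, hi, hx⟩ := hx
      exact ⟨⟨i, hi⟩, hx⟩)
  have hθ1 (x : M) (hx : x ∈ K' \ Vξ) : ∑ i, θ i x = 1 := by
    rw [← finsum_eq_sum_of_fintype]; exact θ.sum_eq_one hx
  choose T hT1 hT2 using fun i : t => hsol i (θ i) ξ (θ i).contMDiff hξ (hθ i)
  -- the pieces of the field `ξ W`
  have hχξ (j) : tsupport (fun x => χ j x * ξ x) ⊆ (A.chart j).source :=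
    tsupport_mul_subset_left.trans (hχ j)
  have hχξK (j) : tsupport (fun x => χ j x * ξ x) ⊆ tsupport (χ j) ∩ K' :=
    subset_inter tsupport_mul_subset_left (tsupport_mul_subset_right.trans
      (closure_minimal (fun x hx => by_contra fun h => hx (hξ0 x h)) hK'.isClosed))
  obtain ⟨a, hadef⟩ : ∃ a : Fin A.m → 𝔼 → (𝔼 →L[ℝ] 𝔼), a = fun j y =>
      funRep (A.chart j) (fun x => χ j x * ξ x) y • ContinuousLinearMap.id ℝ 𝔼 := ⟨_, rfl⟩
  have ha (j) : ContDiff ℝ ∞ (a j) := by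
    rw [hadef]
    exact (contDiff_funRep (A.isConservative j).mem ((χ j).contMDiff.mul hξ) (hχξ j)).smul
      contDiff_const
  have hat (j) : tsupport (a j) ⊆ A.chart j '' tsupport (fun x => χ j x * ξ x) := by
    refine subset_trans (closure_mono fun y hy => ?_) (tsupport_funRep_subset (hχξ j))
    intro h0
    refine hy ?_
    rw [hadef]
    ext v : 1
    simp [h0]
  have hac (j) : HasCompactSupport (a j) :=
    (isCompact_image_tsupport (hχξ j)).of_isClosed_subset (isClosed_tsupport _) (hat j)
  have haO (j) : tsupport (a j) ⊆ interior (Q j) :=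
    ((hat j).trans (image_mono (hχξK j))).trans (hQi j)
  have hf0 (W : VField n M) (j) : ∀ y ∉ A.chart j '' tsupport (fun x => χ j x * ξ x),
      a j y (localRep (A.chart j) W y) = 0 := fun y hy => by
    rw [image_eq_zero_of_notMem_tsupport fun h => hy (hat j h)]; simp
  -- Splitting `ξ W` into pieces supported in single charts makes the Hölder bounds and the
  -- vanishing of the total integral accessible chart by chart.
  have hF (W : VField n M) : (fun x => ξ x • W x) =
      ∑ j, ofChart (A.chart j) fun y => a j y (localRep (A.chart j) W y) := by
    funext x
    rw [Finset.sum_apply]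
    have : ∀ j, ofChart (A.chart j) (fun y => a j y (localRep (A.chart j) W y)) x =
        (χ j x * ξ x) • W x := fun j => by
      by_cases hx : x ∈ (A.chart j).source
      · refine ofChart_eq (A.isConservative j).mem hx (X := fun x => (χ j x * ξ x) • W x) ?_
        rw [localRep_smul, hadef]
        simp [funRep_apply ((A.chart j).map_source hx), (A.chart j).left_inv hx]
      · rw [ofChart_of_notMem _ hx, image_eq_zero_of_notMem_tsupport fun h => hx (hχ j h), zero_mul,
          zero_smul]
    simp_rw [this]
    rw [← Finset.sum_smul, ← Finset.sum_mul, hχ1, one_mul]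
  -- The corrections live in the compact sets `P i ⊆ U \ K`; removing these from the set where `ξ =
  -- 1` near the point leaves a neighbourhood of `K` on which `L W = W`.
  refine ⟨fun j => interior (Q j), Q, K' ∪ ⋃ i : t, P i, Vξ ∩ (⋃ i : t, P i)ᶜ,
    fun W => (fun x => ξ x • W x) - ∑ i, T i W,
    fun j => ⟨isOpen_interior, hQ j, interior_subset, hQU j⟩,
    hK'.union (isCompact_iUnion fun i => hP i),
    union_subset hK'U (iUnion_subset fun i => (hPR i).trans sdiff_subset),
    isOpen_interior.inter (isCompact_iUnion fun i : t => hP i).isClosed.isOpen_compl,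
    subset_inter hKV fun x hx hx' => ?_,
    inter_subset_left.trans (hVK'.trans hK'U), fun W c hc hW hW1 hWd => ?_, fun r hr => ?_⟩
  · obtain ⟨i, hi⟩ := mem_iUnion.1 hx'
    exact (hPR i hi).2 hx
  · have hTi (i : t) := hT1 i W c hc (hW _)
    have hT0 (x : M) (hx : x ∉ ⋃ i : t, P i) : (∑ i, T i W) x = 0 := by
      rw [Finset.sum_apply]
      exact Finset.sum_eq_zero fun i _ => (hTi i).1 x fun h => hx (mem_iUnion.2 ⟨i, h⟩)
    beta_reduce
    refine ⟨fun x hx => ?_, fun x hx => ?_, fun x => ?_⟩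
    · rw [mem_union, not_or] at hx
      rw [Pi.sub_apply, hT0 x hx.2, hξ0 x hx.1, zero_smul, sub_zero]
    · have h1 : ξ x = 1 := (interior_subset hx.1 : x ∈ {x | ξ x = 1})
      rw [Pi.sub_apply, hT0 x hx.2, h1, one_smul, sub_zero]
    · have hf1 (j) : ContDiff ℝ 1 fun y => a j y (localRep (A.chart j) W y) := by
        obtain ⟨C, -, hC⟩ := exists_bd_coeff isOpen_interior (ha j) (hac j) (haO j) 1
        exact (hC 0 _ c zero_le_one hc (hW j)).contDiff_one le_rfl
      have hPt (j) := isCompact_image_tsupport (hχξ j)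
      have hPs (j) := image_tsupport_subset (hχξ j)
      have hFs (x : M) (j) : SmoothAt 1
          (ofChart (A.chart j) fun y => a j y (localRep (A.chart j) W y)) x :=
        smoothAt_ofChart (s := 1) (A.isConservative j).mem (hPt j) (hPs j) (hf0 W j) (hf1 j) x
      have hξW (x : M) : SmoothAt 1 (fun x => ξ x • W x) x := by
        rw [hF]; exact SmoothAt.sum fun j _ => hFs x j
      have hmξ (x : M) : mdiv A (fun x => ξ x • W x) x = dirDeriv ξ W x := by
        by_cases hx : x ∈ U
        · rw [mdiv_smul A hξ (hW1 x hx), hWd x hx, mul_zero, add_zero]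
        · have hx' : x ∉ K' := fun h => hx (hK'U h)
          rw [dirDeriv_eq_zero (hξ0' x hx'), mdiv_eq_zero_of_eventually A]
          filter_upwards [hξ0' x hx'] with z hz
          rw [hz, zero_smul]
      have hediv (j) : ∀ y ∉ A.chart j '' tsupport (fun x => χ j x * ξ x),
          ediv (fun y => a j y (localRep (A.chart j) W y)) y = 0 := fun y hy => by
        have h0 : (fun y => a j y (localRep (A.chart j) W y)) =ᶠ[𝓝 y] fun _ => 0 := by
          filter_upwards [(hPt j).isClosed.isOpen_compl.mem_nhds hy] with z hz using hf0 W j z hz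
        rw [ediv_congr h0]
        simp [ediv]
      have hedc (j) : Continuous (ediv fun y => a j y (localRep (A.chart j) W y)) := by
        simp_rw [funext fun y => ediv_eq_etrace (fun y => a j y (localRep (A.chart j) W y)) y]
        exact (etrace n).continuous.comp ((hf1 j).continuous_fderiv (by simp))
      -- Stokes: `dξ(W)` is the divergence of `ξ W`, and each chart piece of this field has a
      -- divergence of integral zero.
      have hIξ : I (dirDeriv ξ W) = 0 := by
        have h1 : dirDeriv ξ W = fun x => ∑ j, ofChartFun (A.chart j)
            (ediv fun y => a j y (localRep (A.chart j) W y)) x := by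
          funext x
          rw [← hmξ x, hF, mdiv_sum A fun j _ => hFs x j]
          exact Finset.sum_congr rfl fun j _ =>
            mdiv_ofChart A (A.isConservative j) (hPt j) (hPs j) (hf0 W j) (hf1 j) x
        have hcf (j) := continuous_ofChartFun (hPt j) (hPs j) (hediv j) (hedc j)
        rw [h1, hI.sum _ hcf]
        refine Finset.sum_eq_zero fun j _ => ?_
        rw [hI.chart _ (A.isConservative j) _ (hcf j)
          ((tsupport_ofChartFun_subset (hPt j) (hPs j) (hediv j)).trans
            (symm_image_subset_source (hPs j))), funRep_ofChartFun (hPs j) (hediv j)]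
        exact integral_ediv_eq_zero (hf1 j) (HasCompactSupport.intro (hPt j) (hf0 W j))
      have hTs (x : M) (i : t) : SmoothAt 1 (T i W) x := by
        obtain ⟨C, -, hC⟩ := hT2 i 1 le_rfl
        exact (hC 0 W c zero_le_one hc (hW _)).smoothAt x
      have hsumθ (x : M) : ∑ i, θ i x * dirDeriv ξ W x = dirDeriv ξ W x := by
        by_cases hx : x ∈ K' \ Vξ
        · rw [← Finset.sum_mul, hθ1 x hx, one_mul]
        · simp [hdξ x hx W]
      -- The multiples of `ρ` left over by the local solutions add up to the total integral of
      -- `dξ(W)`, so they disappear. The functions `θ i` sum to one only on the shell, but elsewhere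
      -- `dξ` is zero.
      have hIsum : ∑ i : t, I (fun z => θ i z * dirDeriv ξ W z) = 0 := by
        rw [← hI.sum _ fun i => (hTi i).2.2]
        rw [← hIξ]
        exact congrArg I (funext hsumθ)
      rw [mdiv_sub A (hξW x) (SmoothAt.sum fun i _ => hTs x i), mdiv_sum A fun i _ => hTs x i, hmξ]
      simp_rw [fun i => (hTi i).2.1 x]
      rw [Finset.sum_sub_distrib, hsumθ, ← Finset.sum_mul, hIsum]
      ring
  · have h1 (j) : ∃ C, 0 ≤ C ∧ ∀ (α : ℝ≥0) W c, α ≤ 1 → 0 ≤ c →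
        BdOn (interior (Q j)) r α (localRep (A.chart j) W) c →
        GBd A r α (ofChart (A.chart j) fun y => a j y (localRep (A.chart j) W y)) (C * c) := by
      obtain ⟨C, hC0, hC⟩ := exists_bd_coeff isOpen_interior (ha j) (hac j) (haO j) r
      obtain ⟨C', hC'0, hC'⟩ := exists_gBd_ofChart A (A.isConservative j).mem
        (isCompact_image_tsupport (hχξ j)) (image_tsupport_subset (hχξ j)) r
      refine ⟨C' * C, by positivity, fun α W c hα hc hW => ?_⟩
      rw [mul_assoc]
      exact hC' α _ _ hα (by positivity) (hf0 W j) (hC α _ c hα hc hW)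
    choose C hC0 hC using h1
    choose C' hC'0 hC' using fun i => hT2 i r hr
    refine ⟨∑ j, C j + ∑ i, C' i, add_nonneg (Finset.sum_nonneg fun j _ => hC0 j)
      (Finset.sum_nonneg fun i _ => hC'0 i), fun α W c hα hc hW => ?_⟩
    beta_reduce
    rw [hF, add_mul, Finset.sum_mul, Finset.sum_mul]
    exact (GBd.sum fun j _ => hC j α W c hα hc (hW j)).sub
      (GBd.sum fun i _ => hC' i α W c hα hc (hW _))

end Correction
-- Smoothing on the manifold by small divergence-free perturbations.
section Smoothing

variable {n : ℕ} {M : Type*} [TopologicalSpace M] [ChartedSpace (EuclideanSpace ℝ (Fin n)) M]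
  [IsManifold (𝓡 n) ∞ M] [T2Space M] [CompactSpace M] {vol : VolumeForm n M}
  {A : RegularConservativeAtlas vol} {s : ℕ∞} {β : ℝ≥0} {r : ℕ} {α : ℝ≥0}

local notation "𝔼" => EuclideanSpace ℝ (Fin n)

/-- One step of the smoothing: a small divergence-free perturbation makes `Z` smooth where a bump
function read in a chart is positive, keeping it smooth where it was so. -/
lemma exists_smoothing_step (hs : 1 ≤ s) (hβ : β ≤ 1) (hα : α ≤ 1)
    (hcl : (r : ℕ∞) < s ∨ (r : ℕ∞) = s ∧ (α = 0 ∨ α < β)) {j : Fin A.m}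
    {b : EuclideanSpace ℝ (Fin n) → ℝ} (hb : ContDiff ℝ ∞ b) (hbc : HasCompactSupport b)
    (hb0 : ∀ y, 0 ≤ b y) (hbt : tsupport b ⊆ (A.chart j).target) {Z : VField n M}
    (hZ : A.MemDivFree s β Z univ) {τ : ℝ} (hτ : 0 < τ) :
    ∃ D : VField n M, (∀ m γ, Adm s β m γ → ∃ N, 0 ≤ N ∧ GBd A m γ D N) ∧ (∀ x, mdiv A D x = 0) ∧
      (∀ x, (x ∈ (A.chart j).source → b (A.chart j x) = 0) → D x = 0) ∧
      (∀ x, SmoothAt ⊤ Z x ∨ x ∈ (A.chart j).source ∧ 0 < b (A.chart j x) → SmoothAt ⊤ (Z + D) x) ∧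
      GBd A r α D τ := by
  set e := A.chart j
  have he : IsConservative vol e := A.isConservative j
  have hZs (x : M) : SmoothAt s Z x := smoothAt_of_memDivFree isOpen_univ hZ (mem_univ x)
  have hZ1 (x : M) : SmoothAt 1 Z x := (hZs x).of_le hs
  obtain ⟨κ, hκ, hκc, hκt, hκ1, -⟩ := exists_cutoff hbc e.open_target hbt
  obtain ⟨Q, hQ, hκQ, hQt⟩ := exists_compact_between hκc e.open_target hκt
  obtain ⟨a, hadef⟩ : ∃ a : 𝔼 → (𝔼 →L[ℝ] 𝔼), a = fun y => κ y • ContinuousLinearMap.id ℝ 𝔼 :=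
    ⟨_, rfl⟩
  have ha : ContDiff ℝ ∞ a := by rw [hadef]; exact hκ.smul contDiff_const
  have hat : tsupport a ⊆ tsupport κ := closure_mono fun y hy h0 => hy (by
    rw [hadef]; ext v : 1; simp [show κ y = 0 from h0])
  have hac : HasCompactSupport a := hκc.of_isClosed_subset (isClosed_tsupport _) hat
  obtain ⟨w, hwdef⟩ : ∃ w : 𝔼 → 𝔼, w = fun y => a y (localRep e Z y) := ⟨_, rfl⟩
  -- `w` is a compactly supported field on the Euclidean space that agrees with `Z` near the support
  -- of `b`, so it is divergence-free there, as required by `exists_regularization`.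
  have hwκ (y : 𝔼) : w y = κ y • localRep e Z y := by rw [hwdef, hadef]; simp
  have hwb (m : ℕ) (γ : ℝ≥0) (h : Adm s β m γ) : ∃ N, 0 ≤ N ∧ BdOn univ m γ w N := by
    obtain ⟨N, hN, hbd⟩ := exists_bdOn_of_memDivFree isOpen_univ hZ h (j := j)
      (interior_subset (s := Q)) hQ (by rwa [dom_univ])
    obtain ⟨C, hC0, hC⟩ := exists_bd_coeff isOpen_interior ha hac (hat.trans hκQ) m
    exact ⟨C * N, by positivity, hwdef ▸ hC γ _ N (h.le_one hβ) hN hbd⟩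
  have hwm (m : ℕ) (h : (m : ℕ∞) ≤ s) : ContDiff ℝ m w := by
    obtain ⟨N, -, hN⟩ := hwb m 0 (Or.inl ⟨h, rfl⟩)
    exact hN.contDiff
  have hwc : HasCompactSupport w := hac.mono fun y hy h0 => hy (by
    rw [hwdef]; simp [show a y = 0 from h0])
  set O : Set 𝔼 := interior {y | κ y = 1}
  have hbO : tsupport b ⊆ O := subset_interior_iff_mem_nhdsSet.2 hκ1
  have hO1 : ∀ y ∈ O, κ y = 1 := fun y hy => (interior_subset hy : y ∈ {y | κ y = 1})
  have hOt : O ⊆ e.target := fun y hy => hκt (subset_tsupport κ (by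
    rw [Function.mem_support, hO1 y hy]; exact one_ne_zero))
  have hwO : ∀ y ∈ O, w =ᶠ[𝓝 y] localRep e Z := fun y hy => by
    filter_upwards [isOpen_interior.mem_nhds hy] with z hz
    rw [hwκ, hO1 z hz, one_smul]
  have hdiv : ∀ y ∈ O, ediv w y = 0 := fun y hy => by
    have h1 := mdiv_eq A he (e.map_target (hOt hy)) (hZ1 _)
    rw [e.right_inv (hOt hy)] at h1
    rw [ediv_congr (hwO y hy), ← h1]
    exact (isDivFreeOn_iff A fun x _ => hZ1 x).1 hZ.divFree _ (mem_univ _)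
  obtain ⟨d, hd0, hdε, hdb, hdτ⟩ := exists_regularization hb hbc hb0 (by exact_mod_cast hwm 1 hs) hwc
    isOpen_interior hbO hdiv
  obtain ⟨C, hC0, hC⟩ := exists_gBd_ofChart A he.mem hbc hbt
    r
  have hsmall : ∀ᶠ ε in 𝓝[>] (0 : ℝ), BdOn univ r α (d ε) (τ / (C + 1)) := by
    have hτ' : 0 < τ / (C + 1) := by positivity
    -- With a spare derivative, smallness in `C^{r+1}` controls every exponent at order `r`, up to
    -- the factor 2 absorbed by `half_pos`. For `r = s` either `α = 0`, and smallness in `C^r`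
    -- suffices, or `α < β` and it is interpolated with the bound in `C^{r,β}` uniform in `ε`.
    rcases hcl with hcl | ⟨hrs, hcl⟩
    · have h1 : ((r + 1 : ℕ) : ℕ∞) ≤ s := by
        push_cast
        exact Order.add_one_le_of_lt hcl
      filter_upwards [hdτ (r + 1) (hwm _ h1) _ (half_pos hτ')] with ε hε
      have := hε.of_succ isOpen_univ hα (half_pos hτ').le
      rwa [mul_div_cancel₀ _ (two_ne_zero)] at this
    · by_cases hα0 : α = 0
      · subst hα0
        exact hdτ r (hwm _ hrs.le) _ hτ'
      · have hαβ := hcl.resolve_left hα0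
        obtain ⟨N, hN, hbd⟩ := hwb r β (Or.inr ⟨hrs.symm, rfl⟩)
        obtain ⟨N', hN', hbd'⟩ := hdb r β N hβ hN hbd
        obtain ⟨τ₂, hτ₂, hInt⟩ := exists_bdOn_interpolate (E := 𝔼) (F := 𝔼) hαβ r hN' hτ'
        filter_upwards [hbd', hdτ r (hwm _ hrs.le) _ hτ₂] with ε h1 h2 using hInt _ h1 h2
  have hreg : ∃ N, ∀ᶠ ε in 𝓝[>] (0 : ℝ), ∀ k : ℕ, s = k → BdOn univ k β (d ε) N ∧ 0 ≤ N := by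
    by_cases hk : ∃ k : ℕ, s = k
    · obtain ⟨k, hk⟩ := hk
      obtain ⟨N, hN, hbd⟩ := hwb k β (Or.inr ⟨hk, rfl⟩)
      obtain ⟨N', hN', hbd'⟩ := hdb k β N hβ hN hbd
      refine ⟨N', ?_⟩
      filter_upwards [hbd'] with ε hε k' hk'
      obtain rfl : k = k' := by exact_mod_cast hk.symm.trans hk'
      exact ⟨hε, hN'⟩
    · exact ⟨0, Eventually.of_forall fun ε k h => absurd ⟨k, h⟩ hk⟩
  obtain ⟨N, hreg⟩ := hreg
  obtain ⟨ε, hsm, hrg, hεd, hεs⟩ := (hsmall.and (hreg.and hdε)).exists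
  have hd0' : ∀ y ∉ tsupport b, d ε y = 0 := fun y hy =>
    hd0 ε y (image_eq_zero_of_notMem_tsupport hy)
  have hdc : HasCompactSupport (d ε) := HasCompactSupport.intro hbc hd0'
  -- One `ε` must serve all orders. For `s = ∞` the smallness statements cover one order at a time,
  -- so smoothness comes instead from `w` and `w + d ε` being smooth; for finite `s` the bound at
  -- order `s` is enough.
  have hds (m : ℕ) (hm : (m : ℕ∞) ≤ s) : ContDiff ℝ m (d ε) := by
    cases s with
    | top =>
      have hw : ContDiff ℝ ∞ w := contDiff_infty.2 fun m => hwm m le_top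
      have h1 : ContDiff ℝ ∞ fun y => w y + d ε y := contDiff_iff_contDiffAt.2 fun y =>
        hεs y (Or.inr hw.contDiffAt)
      have h2 := (h1.sub hw).of_le (m := m) (by exact_mod_cast le_top)
      simpa using h2
    | coe k => exact (hrg k rfl).1.contDiff.of_le (by exact_mod_cast hm)
  have hd1 : ContDiff ℝ 1 (d ε) := by exact_mod_cast hds 1 hs
  have hDn (x : M) (hx : x ∉ e.symm '' tsupport b) : ∀ᶠ z in 𝓝 x, ofChart e (d ε) z = 0 :=
    ofChart_eventually_eq_zero hbc hbt hd0' hx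
  refine ⟨ofChart e (d ε), fun m γ h => ?_, fun x => ?_, fun x hx => ?_, fun x hx => ?_, ?_⟩
  · obtain ⟨C', hC'0, hC'⟩ := exists_gBd_ofChart A he.mem hbc hbt m
    rcases h with ⟨hm, rfl⟩ | ⟨hm, rfl⟩
    · obtain ⟨N', hN', hbd⟩ := exists_bdOn_of_hasCompactSupport (hds m hm) hdc
      exact ⟨C' * N', by positivity, hC' 0 _ _ zero_le_one hN' hd0' hbd⟩
    · obtain ⟨h1, h2⟩ := hrg m hm
      exact ⟨C' * N, by positivity, hC' _ _ _ hβ h2 hd0' h1⟩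
  · rw [mdiv_ofChart A he hbc hbt hd0' hd1]
    by_cases hx : x ∈ e.source
    · rw [ofChartFun_of_mem hx, hεd]
    · rw [ofChartFun_of_notMem hx]
  · exact ofChart_eq_zero fun h => hd0 ε _ (hx h)
  · by_cases hxb : x ∈ e.symm '' tsupport b
    · obtain ⟨y, hy, rfl⟩ := hxb
      have hyt := hbt hy
      refine (contMDiffAt_section_iff (s := ⊤) he.mem (e.map_target hyt)).2 ?_
      rw [e.right_inv hyt, localRep_add]
      rw [e.right_inv hyt] at hx
      have h1 : (fun y => w y + d ε y) =ᶠ[𝓝 y]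
          fun y => localRep e Z y + localRep e (ofChart e (d ε)) y := by
        filter_upwards [hwO y (hbO hy), e.open_target.mem_nhds hyt] with z hz hzt
        rw [hz, localRep_ofChart he.mem _ hzt]
      refine (hεs y ?_).congr_of_eventuallyEq h1.symm
      rcases hx with hx | hx
      · right
        have := hx.contDiffAt he.mem (e.map_target hyt)
        rw [e.right_inv hyt] at this
        exact this.congr_of_eventuallyEq (hwO y (hbO hy))
      · exact Or.inl hx.2
    · have hZx : SmoothAt ⊤ Z x := hx.resolve_right fun h => hxb
        ⟨e x, subset_tsupport b h.2.ne', e.left_inv h.1⟩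
      refine hZx.congr ?_
      filter_upwards [hDn x hxb] with z hz
      rw [Pi.add_apply, hz, add_zero]
  · refine (hC α _ _ hα (by positivity) hd0' hsm).mono_const ?_
    rw [mul_div_assoc', div_le_iff₀ (by positivity)]
    nlinarith

/-- Smoothing with finitely many bump functions. -/
lemma exists_smoothing (hs : 1 ≤ s) (hβ : β ≤ 1) (hα : α ≤ 1)
    (hcl : (r : ℕ∞) < s ∨ (r : ℕ∞) = s ∧ (α = 0 ∨ α < β)) {ι : Type*} (t : Finset ι)
    {j : ι → Fin A.m} {b : ι → EuclideanSpace ℝ (Fin n) → ℝ} (hb : ∀ i, ContDiff ℝ ∞ (b i))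
    (hbc : ∀ i, HasCompactSupport (b i)) (hb0 : ∀ i y, 0 ≤ b i y)
    (hbt : ∀ i, tsupport (b i) ⊆ (A.chart (j i)).target) {Z : VField n M}
    (hZ : A.MemDivFree s β Z univ) {τ : ℝ} (hτ : 0 < τ) :
    ∃ D : VField n M, (∀ m γ, Adm s β m γ → ∃ N, 0 ≤ N ∧ GBd A m γ D N) ∧ (∀ x, mdiv A D x = 0) ∧
      (∀ x, (∀ i ∈ t, x ∈ (A.chart (j i)).source → b i (A.chart (j i) x) = 0) → D x = 0) ∧
      (∀ x, (∃ i ∈ t, x ∈ (A.chart (j i)).source ∧ 0 < b i (A.chart (j i) x)) →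
        SmoothAt ⊤ (Z + D) x) ∧
      GBd A r α D τ := by
  classical
  induction t using Finset.induction_on generalizing τ with
  | empty =>
    refine ⟨0, fun m γ _ => ⟨0, le_rfl, gBd_zero A m γ⟩,
      fun x => mdiv_eq_zero_of_eventually A (by simp), fun x _ => rfl, fun x hx => by simp at hx,
      (gBd_zero A r α).mono_const hτ.le⟩
  | insert i t hi ih =>
    -- Each step keeps the smoothness already gained, so the bumps may overlap and be used one after
    -- the other; the tolerance is split in two.
    obtain ⟨D, hD, hDd, hD0, hDs, hDτ⟩ := ih (half_pos hτ)
    obtain ⟨D', hD', hDd', hD0', hDs', hDτ'⟩ := exists_smoothing_step hs hβ hα hcl (hb i) (hbc i)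
      (hb0 i) (hbt i) (memDivFree_add hs hZ hD hDd) (half_pos hτ)
    have hs1 {D : VField n M} (hD : ∀ m γ, Adm s β m γ → ∃ N, 0 ≤ N ∧ GBd A m γ D N) (x : M) :
        SmoothAt 1 D x := by
      obtain ⟨N, -, hN⟩ := hD 1 0 (Or.inl ⟨by exact_mod_cast hs, rfl⟩)
      exact hN.smoothAt x
    refine ⟨D + D', fun m γ h => ?_, fun x => ?_, fun x hx => ?_, fun x hx => ?_, ?_⟩
    · obtain ⟨N, hN, hbd⟩ := hD m γ h
      obtain ⟨N', hN', hbd'⟩ := hD' m γ h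
      exact ⟨N + N', by positivity, hbd.add hbd'⟩
    · rw [mdiv_add A (hs1 hD x) (hs1 hD' x), hDd, hDd', add_zero]
    · rw [Pi.add_apply, hD0 x fun k hk => hx k (Finset.mem_insert_of_mem hk),
        hD0' x (hx i (Finset.mem_insert_self i t)), add_zero]
    · rw [← add_assoc]
      refine hDs' x ?_
      obtain ⟨k, hk, hkx⟩ := hx
      rcases Finset.mem_insert.1 hk with rfl | hk
      · exact Or.inr hkx
      · exact Or.inl (hDs x ⟨k, hk, hkx⟩)
    · simpa using hDτ.add hDτ'

end Smoothing
-- Preparations for the pasting theorem.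
section Pasting

variable {n : ℕ} {M : Type*} [TopologicalSpace M] [ChartedSpace (EuclideanSpace ℝ (Fin n)) M]
  {vol : VolumeForm n M}

local notation "𝔼" => EuclideanSpace ℝ (Fin n)

/-- A compact set is covered by the positivity sets of finitely many bump functions, read in the
charts of the atlas and supported in a given neighbourhood. -/
lemma exists_bump_cover (A : RegularConservativeAtlas vol) {T G : Set M} (hT : IsCompact T)
    (hG : IsOpen G) (hTG : T ⊆ G) :
    ∃ (t : Finset T) (j : T → Fin A.m) (b : T → EuclideanSpace ℝ (Fin n) → ℝ),
      (∀ i, ContDiff ℝ ∞ (b i)) ∧ (∀ i, HasCompactSupport (b i)) ∧ (∀ i y, 0 ≤ b i y) ∧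
      (∀ i, tsupport (b i) ⊆ (A.chart (j i)).target) ∧
      (∀ i, (A.chart (j i)).symm '' tsupport (b i) ⊆ G) ∧
      ∀ x ∈ T, ∃ i ∈ t, x ∈ (A.chart (j i)).source ∧ 0 < b i (A.chart (j i) x) := by
  have h1 (i : T) : ∃ b : 𝔼 → ℝ, ContDiff ℝ ∞ b ∧ HasCompactSupport b ∧
      tsupport b ⊆ (A.chart (A.idx i.1)).target ∩ (A.chart (A.idx i.1)).symm ⁻¹' G ∧
      0 < b (A.chart (A.idx i.1) i) ∧ ∀ y, 0 ≤ b y := by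
    have hx := A.mem_source_idx i.1
    obtain ⟨b, hb, hbc, hbO, -, hbp, hb0⟩ := exists_bump
      ((A.chart (A.idx i.1)).isOpen_inter_preimage_symm hG)
      (c := A.chart (A.idx i.1) i.1)
      ⟨(A.chart _).map_source hx, by
        rw [mem_preimage, (A.chart _).left_inv hx]; exact hTG i.2⟩
    exact ⟨b, hb, hbc, hbO, hbp, hb0⟩
  choose b hb hbc hbO hbp hb0 using h1
  have hopen (i : T) : IsOpen ((A.chart (A.idx i.1)).source ∩
      A.chart (A.idx i.1) ⁻¹' {y | 0 < b i y}) :=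
    (A.chart _).isOpen_inter_preimage (isOpen_lt continuous_const (hb i).continuous)
  obtain ⟨t, ht⟩ := hT.elim_finite_subcover _ hopen fun x hx =>
    mem_iUnion.2 ⟨⟨x, hx⟩, A.mem_source_idx x, hbp ⟨x, hx⟩⟩
  refine ⟨t, fun i => A.idx i.1, b, hb, hbc, hb0, fun i => (hbO i).trans inter_subset_left, ?_, ?_⟩
  · rintro i _ ⟨y, hy, rfl⟩
    exact (hbO i hy).2
  · intro x hx
    obtain ⟨i, hi, hxi⟩ := mem_iUnion₂.1 (ht hx)
    exact ⟨i, hi, hxi.1, hxi.2⟩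

/-- Puts the exclusion of `r = s`, `0 < α = β` in the form used for smoothing: a spare derivative,
exponent zero, or a spare exponent. -/
lemma class_lt_of_ne {r : ℕ} {s : ℕ∞} {α β : ℝ≥0} (hrs : (r : ℕ∞) ≤ s)
    (h : (r : ℝ≥0∞) + α ≤ (s : ℝ≥0∞) + β) (hne : ¬ ((r : ℕ∞) = s ∧ 0 < α ∧ α = β)) :
    (r : ℕ∞) < s ∨ (r : ℕ∞) = s ∧ (α = 0 ∨ α < β) := by
  refine hrs.lt_or_eq.imp_right fun hr => ⟨hr, ?_⟩
  subst hr
  have hαβ : α ≤ β := by simpa using h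
  rcases eq_or_lt_of_le hαβ with h0 | h0
  · left
    by_contra hα
    exact hne ⟨rfl, pos_iff_ne_zero.2 hα, h0⟩
  · exact Or.inr h0

variable [IsManifold (𝓡 n) ∞ M] {A : RegularConservativeAtlas vol}

/-- Handles `Y = X` on `U`, where no positive tolerance is left for smoothing. -/
lemma eqOn_zero_of_normCH_eq_zero {r : ℕ} {α : ℝ≥0} {W : VField n M} {U : Set M}
    (h : A.normCH r α W U = 0) {x : M} (hx : x ∈ U) : W x = 0 := by
  have h0 : A.normC r W U = 0 := by
    unfold RegularConservativeAtlas.normCH at h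
    split_ifs at h with hα
    · exact h
    · exact le_antisymm ((le_max_left _ _).trans h.le) bot_le
  unfold RegularConservativeAtlas.normC at h0
  simp only [ENNReal.iSup_eq_zero] at h0
  have hxs := A.mem_source_idx x
  have h1 := h0 (A.idx x) 0 (Nat.zero_le r) (A.chart (A.idx x) x) ⟨x, ⟨hxs, hx⟩, rfl⟩
  rw [RegularConservativeAtlas.derivRep, norm_iteratedFDeriv_zero, ENNReal.ofReal_eq_zero] at h1
  refine eq_of_localRep_eq (Y := 0) (A.isConservative _).mem hxs ?_
  rw [norm_le_zero_iff.1 h1, localRep_zero]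

lemma exists_bdOn_sub {s : ℕ∞} {β : ℝ≥0} {X Y : VField n M} {U : Set M} (hU : IsOpen U)
    (hX : A.MemDivFree s β X univ) (hY : A.MemDivFree s β Y U)
    {O Q : Fin A.m → Set (EuclideanSpace ℝ (Fin n))}
    (hOQ : ∀ j, IsOpen (O j) ∧ IsCompact (Q j) ∧ O j ⊆ Q j ∧ Q j ⊆ A.dom U j) {m : ℕ} {γ : ℝ≥0}
    (hm : Adm s β m γ) :
    ∃ c, 0 ≤ c ∧ ∀ j, BdOn (O j) m γ (localRep (A.chart j) (Y - X)) c := by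
  have h1 (j) : ∃ c, 0 ≤ c ∧ BdOn (O j) m γ (localRep (A.chart j) (Y - X)) c := by
    obtain ⟨hO, hQ, hOQ', hQU⟩ := hOQ j
    obtain ⟨N, hN, hbN⟩ := exists_bdOn_of_memDivFree hU hY hm hOQ' hQ hQU
    obtain ⟨N', hN', hbN'⟩ := exists_bdOn_of_memDivFree isOpen_univ hX hm hOQ' hQ
      (hQU.trans (image_mono (inter_subset_inter_right _ (subset_univ U))))
    refine ⟨N + N', add_nonneg hN hN', ?_⟩
    rw [localRep_sub]
    simpa only [sub_eq_add_neg] using hbN.add hO hbN'.neg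
  choose c hc hbc using h1
  exact ⟨∑ j, c j, Finset.sum_nonneg fun j _ => hc j, fun j => (hbc j).mono_const
    (Finset.single_le_sum (fun j _ => hc j) (Finset.mem_univ j))⟩

end Pasting
end ConservativePasting

/-! ### The pasting theorem. -/

open ConservativePasting in
theorem theorem3 {n : ℕ} (hn : 2 ≤ n) {M : Type*} [TopologicalSpace M]
    [ChartedSpace (EuclideanSpace ℝ (Fin n)) M] [IsManifold (𝓡 n) ∞ M]
    [T2Space M] [SecondCountableTopology M] [CompactSpace M] [ConnectedSpace M]
    (vol : ConservativePasting.VolumeForm n M)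
    (A : ConservativePasting.RegularConservativeAtlas vol)
    {K U : Set M} (hK : IsCompact K) (hU : IsOpen U) (hKU : K ⊆ U) (hUne : U ≠ univ)
    (hconn : IsConnected (U \ K)) :
    ∃ V : Set M, IsOpen V ∧ K ⊆ V ∧ V ⊆ U ∧
      ∀ r : ℕ, 1 ≤ r → ∃ C : ℝ, 1 < C ∧
        ∀ (s : ℕ∞) (α β : ℝ≥0), α ≤ 1 → β ≤ 1 → (r : ℕ∞) ≤ s →
          (r : ℝ≥0∞) + α ≤ (s : ℝ≥0∞) + β →
        ∀ X Y : ∀ x : M, TangentSpace (𝓡 n) x,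
          A.MemDivFree s β X univ → A.MemDivFree s β Y U → A.normC r Y U < ⊤ →
          ∃ Z : ∀ x : M, TangentSpace (𝓡 n) x,
            A.MemDivFree s β Z univ ∧
            (∀ x ∈ V, Z x = Y x) ∧
            (∀ᶠ x in 𝓝ˢ Uᶜ, Z x = X x) ∧
            A.normCH r α (fun x => Z x - X x) univ ≤
              ENNReal.ofReal C * A.normCH r α (fun x => Y x - X x) U ∧
            (¬ ((r : ℕ∞) = s ∧ 0 < α ∧ α = β) →
              ∀ x ∈ U, Z x ≠ X x → Z x ≠ Y x →
                ContMDiffAt (𝓡 n) (𝓡 n).tangent ∞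
                  (fun x => (⟨x, Z x⟩ : TangentBundle (𝓡 n) M)) x) := by
  obtain ⟨O, Q, S, V₀, L, hOQ, hS, hSU, hV₀, hKV₀, hV₀U, hL, hLbd⟩ :=
    exists_correction A hK hU hKU hconn
  -- `L W` is 0 off `S` and `W` on `V₀`, so only the compact set `S \ V₀` needs smoothing. The bumps
  -- are supported away from `K`.
  obtain ⟨t, j, b, hb, hbc, hb0, hbt, hbG, hcov⟩ := exists_bump_cover A (hS.diff hV₀)
    (hU.sdiff hK.isClosed) (fun x hx => ⟨hSU hx.1, fun hxK => hx.2 (hKV₀ hxK)⟩)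
  obtain ⟨F, hFdef⟩ : ∃ F : Set M, F = ⋃ i ∈ t, (A.chart (j i)).symm '' tsupport (b i) := ⟨_, rfl⟩
  have hF : IsCompact F := by
    rw [hFdef]
    exact t.isCompact_biUnion fun i _ => (hbc i).isCompact.image_of_continuousOn
      ((A.chart (j i)).continuousOn_symm.mono (hbt i))
  have hFG : F ⊆ U \ K := by
    rw [hFdef]
    exact iUnion₂_subset fun i _ => hbG i
  have hFb (x : M) (hx : x ∉ F) (i) (hi : i ∈ t) (hxs : x ∈ (A.chart (j i)).source) :
      b i (A.chart (j i) x) = 0 := by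
    by_contra h0
    refine hx ?_
    rw [hFdef]
    exact mem_iUnion₂.2 ⟨i, hi, _, subset_tsupport _ h0, (A.chart (j i)).left_inv hxs⟩
  -- Smoothing may destroy the equality with `Y` on the supports of the bumps, so these are removed
  -- from `V₀`; all of this is fixed before `r` and the fields.
  refine ⟨V₀ \ F, hV₀.sdiff hF.isClosed, fun x hx => ⟨hKV₀ hx, fun h => (hFG h).2 hx⟩,
    sdiff_subset.trans hV₀U, fun r hr => ?_⟩
  obtain ⟨C, hC0, hC⟩ := hLbd r hr
  -- `2 * C` comes from `L` and the factor 2 in `bdOn_of_normCH_le`, one unit from the smoothing,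
  -- and one more makes the constant exceed 1.
  refine ⟨2 * C + 2, by linarith, fun s α β hα hβ hrs hcl X Y hX hY _ => ?_⟩
  have hs : 1 ≤ s := le_trans (by exact_mod_cast hr) hrs
  obtain ⟨ν, hν⟩ : ∃ ν, ν = A.normCH r α (Y - X) U := ⟨_, rfl⟩
  change ∃ Z : VField n M, A.MemDivFree s β Z univ ∧ _ ∧ _ ∧
    A.normCH r α (Z - X) univ ≤ ENNReal.ofReal _ * A.normCH r α (Y - X) U ∧ _
  rw [← hν]
  have hXs (x : M) : SmoothAt s X x := smoothAt_of_memDivFree isOpen_univ hX (mem_univ x)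
  have hYs (x : M) (hx : x ∈ U) : SmoothAt s Y x := smoothAt_of_memDivFree hU hY hx
  have hWs (x : M) (hx : x ∈ U) : SmoothAt s (Y - X) x := (hYs x hx).sub (hXs x)
  have hWdiv (x : M) (hx : x ∈ U) : mdiv A (Y - X) x = 0 := by
    rw [mdiv_sub A ((hYs x hx).of_le hs) ((hXs x).of_le hs),
      (isDivFreeOn_iff A fun x hx => (hYs x hx).of_le hs).1 hY.divFree x hx,
      (isDivFreeOn_iff A fun x _ => (hXs x).of_le hs).1 hX.divFree x (mem_univ x), sub_zero]
  rcases eq_or_ne ν 0 with hν0 | hν0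
  · rw [hν0] at hν
    refine ⟨X, hX, fun x hx => (sub_eq_zero.1
      (eqOn_zero_of_normCH_eq_zero hν.symm (hV₀U hx.1))).symm, Eventually.of_forall fun _ => rfl,
      ?_, fun _ x _ h => absurd rfl h⟩
    rw [sub_self, hν0, mul_zero]
    simpa using (gBd_zero A r α).normCH_le le_rfl
  obtain ⟨c₁, hc₁, hW₁⟩ := exists_bdOn_sub hU hX hY hOQ (m := 1) (γ := 0)
    (Or.inl ⟨by exact_mod_cast hs, rfl⟩)
  obtain ⟨hLS, hLV, hLdiv⟩ := hL (Y - X) c₁ hc₁ hW₁ (fun x hx => (hWs x hx).of_le hs) hWdiv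
  have hLadm (m : ℕ) (γ : ℝ≥0) (hm : Adm s β m γ) : ∃ N, 0 ≤ N ∧ GBd A m γ (L (Y - X)) N := by
    -- The bounds on `L` start at order 1, so order 0 is deduced from it.
    rcases Nat.eq_zero_or_pos m with rfl | hm1
    · obtain ⟨C₁, hC₁, h1⟩ := hLbd 1 le_rfl
      exact ⟨2 * (C₁ * c₁), by positivity,
        (h1 0 _ c₁ zero_le_one hc₁ hW₁).of_succ (hm.le_one hβ) (by positivity)⟩
    · obtain ⟨c, hc, hW⟩ := exists_bdOn_sub hU hX hY hOQ hm
      obtain ⟨C₁, hC₁, h1⟩ := hLbd m hm1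
      exact ⟨C₁ * c, by positivity, h1 γ _ c (hm.le_one hβ) hc hW⟩
  have hZ₀ := memDivFree_add hs hX hLadm hLdiv
  -- The smoothing is allowed to be as large as the distance `ν` of the data. If `ν` is infinite the
  -- estimate is void and any tolerance will do.
  obtain ⟨τ, hτ, hτν⟩ : ∃ τ : ℝ, 0 < τ ∧ (ν ≠ ⊤ → ν = ENNReal.ofReal τ) := by
    rcases eq_or_ne ν ⊤ with h | h
    · exact ⟨1, one_pos, fun h' => absurd h h'⟩
    · exact ⟨ν.toReal, ENNReal.toReal_pos hν0 h, fun _ => (ENNReal.ofReal_toReal h).symm⟩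
  obtain ⟨D, hDadm, hDdiv, hD0, hDs, hDτ⟩ : ∃ D : VField n M,
      (∀ m γ, Adm s β m γ → ∃ N, 0 ≤ N ∧ GBd A m γ D N) ∧ (∀ x, mdiv A D x = 0) ∧
      (∀ x, (∀ i ∈ t, x ∈ (A.chart (j i)).source → b i (A.chart (j i) x) = 0) → D x = 0) ∧
      (¬ ((r : ℕ∞) = s ∧ 0 < α ∧ α = β) →
        ∀ x, (∃ i ∈ t, x ∈ (A.chart (j i)).source ∧ 0 < b i (A.chart (j i) x)) →
          SmoothAt ⊤ (X + L (Y - X) + D) x) ∧ GBd A r α D τ := by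
    by_cases hex : (r : ℕ∞) = s ∧ 0 < α ∧ α = β
    · exact ⟨0, fun m γ _ => ⟨0, le_rfl, gBd_zero A m γ⟩,
        fun x => mdiv_eq_zero_of_eventually A (Eventually.of_forall fun _ => rfl),
        fun _ _ => rfl, fun h => absurd hex h, (gBd_zero A r α).mono_const hτ.le⟩
    · obtain ⟨D, h1, h2, h3, h4, h5⟩ := exists_smoothing hs hβ hα (class_lt_of_ne hrs hcl hex) t
        hb hbc hb0 hbt hZ₀ hτ
      exact ⟨D, h1, h2, h3, fun _ => h4, h5⟩
  have hZV (x : M) (hx : x ∈ V₀) (hD : D x = 0) : (X + L (Y - X) + D) x = Y x := by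
    simp [hLV x hx, hD]
  have hZX (x : M) (hx : x ∉ S) (hD : D x = 0) : (X + L (Y - X) + D) x = X x := by
    simp [hLS x hx, hD]
  refine ⟨X + L (Y - X) + D, memDivFree_add hs hZ₀ hDadm hDdiv,
    fun x hx => hZV x hx.1 (hD0 x (hFb x hx.2)), ?_, ?_, fun hex x _ hxX hxY => ?_⟩
  · have hO : IsOpen (S ∪ F)ᶜ := (hS.union hF).isClosed.isOpen_compl
    filter_upwards [hO.mem_nhdsSet.2 (compl_subset_compl.2
      (union_subset hSU (hFG.trans sdiff_subset)))] with x hx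
    exact hZX x (fun h => hx (Or.inl h)) (hD0 x (hFb x fun h => hx (Or.inr h)))
  · rcases eq_or_ne ν ⊤ with h | h
    · rw [h, ENNReal.mul_top (by simpa using by linarith)]
      exact le_top
    · have hW (i) : BdOn (O i) r α (localRep (A.chart i) (Y - X)) (2 * τ) :=
        (bdOn_of_normCH_le hτ.le (fun x hx => (hWs x hx).of_le hrs) (hν ▸ (hτν h).le) i).mono_set
          ((hOQ i).2.2.1.trans (hOQ i).2.2.2)
      have hG := (hC α _ (2 * τ) hα (by positivity) hW).add hDτ
      rw [hτν h, ← ENNReal.ofReal_mul (by positivity), add_assoc, add_sub_cancel_left]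
      exact (hG.mono_const (by nlinarith)).normCH_le (by positivity)
  · refine hDs hex x ?_
    -- If no bump is positive at `x`, the smoothing does nothing there, and `x` lies in `V₀`, off
    -- `S`, or in the covered set `S \ V₀`: each is contradictory.
    by_contra hcon
    push Not at hcon
    have hDx : D x = 0 := hD0 x fun i hi hxs => le_antisymm (hcon i hi hxs) (hb0 i _)
    by_cases hxV : x ∈ V₀
    · exact hxY (hZV x hxV hDx)
    · by_cases hxS : x ∈ S
      · obtain ⟨i, hi, hxs, hpos⟩ := hcov x ⟨hxS, hxV⟩
        exact absurd hpos (hcon i hi hxs).not_gt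
      · exact hxX (hZX x hxS hDx)
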